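/- **Conventions.** A pseudograph $G$ is a finite graph, loops and multiple edges allowed. A *tube* of $G$ is a proper connected (nonempty) subgraph that contains at least one edge between any two distinct nodes of it which are joined by an edge of $G$; it is *full* if it is an induced subgraph of $G$. Two tubes are *compatible* if one properly contains the other, or if they are disjoint and no edge of $G$ joins them. A *tubing* is a set of pairwise compatible tubes that does not contain all connected components of $G$. A *bundle* is the set of all edges joining two given distinct adjacent nodes. Let $r$ be the least number of edges whose removal makes $G$ simple, and let $G_s$ be the underlying simple graph (loops deleted, each bundle replaced by one edge). A *pseudograph associahedron* $\mathcal{K}G$ of a pseudograph $G$ with $n$ nodes is a simple convex polyhedron of dimension $n-1+r$, bounded if and only if $G$ has no loops, whose poset of nonempty faces is isomorphic to the set of tubings of $G$ ordered by reverse inclusion, the faces of codimension $k$ corresponding to the tubings with $k$ tubes. *Truncating* a proper nonempty face $F$ of a pointed polyhedron $P$ means replacing $P$ by $P\cap\{\ell\le c'\}$, where $\ell$ is a linear functional whose maximum $c$ on $P$ is attained exactly on $F$, and $c'<c$ is such that $\ell(v)<c'$ for all vertices $v\notin F$ of $P$. To truncate several faces in a given order means to truncate at each step what is left of the face whose turn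 it is. **Base polyhedron.** Let $G$ be a connected pseudograph with $n$ nodes, bundles $B_1,\dots,B_m$ with $b_i=|B_i|$, and $\lambda$ loops. Let $$\triangle\!\!\!\triangle_G=\Delta_{n-1}\times\prod_{i}\Delta_{b_i-1}\times\rho^{\lambda},$$ where $\rho$ is a ray, the facets of $\Delta_{n-1}$ (if $n\ge 2$) are labeled by the nodes of $G$, the vertices of $\Delta_{b_i-1}$ by the edges of $B_i$, and the rays by the loops. A tube $t$ labels the following face $F_t$ of $\triangle\!\!\!\triangle_G$, a product of one face of each factor: in $\Delta_{n-1}$ the intersection of the facets of the nodes of $t$ if $t$ does not contain all nodes, and $\Delta_{n-1}$ otherwise; in $\Delta_{b_i-1}$ the face spanned by the edges of $B_i$ in $t$ if there are any, and $\Delta_{b_i-1}$ otherwise; in the ray of a loop its end point if the loop is incident to a node of $t$ but not contained in $t$, and the whole ray otherwise. **Theorem.** 1. Truncate the faces $F_t$ of $\triangle\!\!\!\triangle_G$ for all full tubes $t$, in any order of weakly increasing dimension of $F_t$. These truncations can be carried out, and, however they are carried out, the result is a polyhedron $\triangle\!\!\!\triangle_G^*=K\times\prod_i\Delta_{b_i-1}\times\rho^\lambda$,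 where $K$ is a pseudograph associahedron $\mathcal{K}G_s$. 2. A non-full tube $t$ labels the following face $F_t^*$ of $\triangle\!\!\!\triangle^*_G$. If $t$ contains all nodes of $G$, then $F^*_t=F_t\cap\triangle\!\!\!\triangle^*_G$. Otherwise let $D$ be the facet that was created by the truncation of $F_{\bar t}$, where $\bar t$ is the subgraph of $G$ induced on the nodes of $t$ (a full tube); then $F^*_t$ is the set of points of $D$ whose components in the factors $\Delta_{b_i-1}$ and $\rho$ lie in the corresponding components of $F_t$. Truncate the faces $F_t^*$ of $\triangle\!\!\!\triangle^*_G$ for all non-full tubes $t$, in any order of weakly increasing number of elements (nodes and edges) of $t$. These truncations can be carried out, and, however they are carried out, the result is a pseudograph associahedron $\mathcal{K}G$. -/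

import Mathlib

open scoped Graph

/-! ### Convex polyhedra, their faces, and truncations -/

namespace Polyhedral

section

variable {E : Type*} [NormedAddCommGroup E] [NormedSpace ℝ E]

/-- A convex polyhedron: an intersection of finitely many closed half-spaces. -/
def IsPolyhedron (P : Set E) : Prop :=
  ∃ s : Finset (StrongDual ℝ E × ℝ), P = {x | ∀ a ∈ s, a.1 x ≤ a.2}

/-- The dimension of the affine span. -/
noncomputable def dim (P : Set E) : ℕ := Module.finrank ℝ (vectorSpan ℝ P)

/-- The nonempty faces of `P`, including `P` itself. -/
def IsFace (P F : Set E) : Prop := F.Nonempty ∧ IsExposed ℝ P F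

/-- The poset of nonempty faces of `P`, ordered by inclusion. -/
abbrev Face (P : Set E) : Type _ := {F : Set E // IsFace P F}

/-- The facets of `P`: the faces of codimension one. -/
def IsFacet (P F : Set E) : Prop := IsFace P F ∧ dim F + 1 = dim P

/-- `P` is simple: each vertex lies on exactly `dim P` facets. -/
def IsSimple (P : Set E) : Prop :=
  ∀ v ∈ P.extremePoints ℝ, {F | IsFacet P F ∧ v ∈ F}.ncard = dim P

/-- The half-space `{x | a.1 x ≤ a.2}` truncates the proper nonempty face `F` of `P`: some
hyperplane `{x | a.1 x = c}` supports `P` exactly along `F`, and `{x | a.1 x = a.2}` is a parallel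
hyperplane that has been pushed into `P` without reaching any vertex of `P` outside `F`. -/
def IsTruncation (P F : Set E) (a : StrongDual ℝ E × ℝ) : Prop :=
  F.Nonempty ∧ F ≠ P ∧
  ∃ c : ℝ, a.2 < c ∧ (∀ x ∈ P, a.1 x ≤ c) ∧ F = {x ∈ P | a.1 x = c} ∧
    ∀ v ∈ P.extremePoints ℝ, v ∉ F → a.1 v < a.2

/-- What remains of `P` after cutting with the half-spaces `h t`, for `t` in the list `L`. -/
def cut {T : Type*} (P : Set E) (h : T → StrongDual ℝ E × ℝ) (L : List T) : Set E :=
  {x ∈ P | ∀ t ∈ L, (h t).1 x ≤ (h t).2}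

/-- The half-spaces `h t` truncate, one after the other in the order of the list `L`, the faces
`face t` of `P` (more precisely, what is left of `face t` when its turn comes). -/
def IsTruncationSequence {T : Type*} (P : Set E) (face : T → Set E)
    (h : T → StrongDual ℝ E × ℝ) (L : List T) : Prop :=
  ∀ (L' : List T) (t : T), L' ++ [t] <+: L →
    IsTruncation (cut P h L') (face t ∩ cut P h L') (h t)

/-- The faces `face t` of `P` can be truncated in the order of the list `L`: however the first
truncations have been made, they can be continued to the end of the list. -/
def CanTruncate {T : Type*} (P : Set E) (face : T → Set E) (L : List T) : Prop :=
  ∀ (h : T → StrongDual ℝ E × ℝ) (L' : List T), L' <+: L → IsTruncationSequence P face h L' →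
    ∃ h' : T → StrongDual ℝ E × ℝ,
      (∀ t ∈ L', h' t = h t) ∧ IsTruncationSequence P face h' L

end

end Polyhedral

/-! ### Tubes and tubings of a pseudograph

Mathlib's `Graph α β` allows loops and multiple edges. -/

namespace Graph

open Polyhedral

section

variable {α β : Type*}

/-- Nonempty and connected. -/
def IsConnected (G : Graph α β) : Prop := G.toSimpleGraph.Connected

/-- `C` is a connected component of `G`. -/
def IsComponent (G C : Graph α β) : Prop := C ≤c G ∧ C.IsConnected

/-- A tube: a proper connected subgraph which contains at least one edge between any two of its
nodes that are joined by an edge of `G`. -/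
structure IsTube (G t : Graph α β) : Prop where
  lt : t < G
  isConnected : t.IsConnected
  adj : ∀ x ∈ V(t), ∀ y ∈ V(t), x ≠ y → G.Adj x y → t.Adj x y

/-- A full tube: a tube which is an induced subgraph. -/
def IsFullTube (G t : Graph α β) : Prop := G.IsTube t ∧ t ≤i G

/-- Two tubes are compatible if one properly contains the other, or if they are disjoint and not
connected by a single edge of `G`. -/
def TubesCompatible (G s t : Graph α β) : Prop :=
  s < t ∨ t < s ∨ (Disjoint V(s) V(t) ∧ ∀ x ∈ V(s), ∀ y ∈ V(t), ¬ G.Adj x y)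

/-- A tubing: a set of pairwise compatible tubes that misses some connected component of `G`. -/
def IsTubing (G : Graph α β) (T : Set (Graph α β)) : Prop :=
  (∀ t ∈ T, G.IsTube t) ∧ T.Pairwise G.TubesCompatible ∧ ∃ C, G.IsComponent C ∧ C ∉ T

/-- The tubings of `G`, ordered by inclusion. -/
abbrev Tubing (G : Graph α β) : Type _ := {T : Set (Graph α β) // G.IsTubing T}

/-- The number of elements (nodes and edges) of a graph. -/
noncomputable def numElements (t : Graph α β) : ℕ := V(t).ncard + E(t).ncard

/-- The minimal number of edges one has to remove in order to get a simple graph. -/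
noncomputable def redundantEdges (G : Graph α β) : ℕ :=
  sInf {k | ∃ D : Set β, D ⊆ E(G) ∧ D.ncard = k ∧ (G.deleteEdges D).Simple}

/-- The underlying simple graph, regarded as a graph again. -/
def underlyingSimple (G : Graph α β) : Graph V(G) (Sym2 V(G)) :=
  Graph.ofSimpleGraph G.toSimpleGraph

/-- `P` is (a realization of) the pseudograph associahedron of `G`: a simple polyhedron of dimension
`n - 1 + r`, bounded (a polytope) if and only if `G` has no loops, whose poset of nonempty faces is
isomorphic to the set of tubings ordered by reverse inclusion, with the faces of codimension `k`
corresponding to the tubings with `k` tubes. -/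
structure IsPseudographAssociahedron (G : Graph α β) {E : Type*} [NormedAddCommGroup E]
    [NormedSpace ℝ E] (P : Set E) : Prop where
  isPolyhedron : IsPolyhedron P
  dim_add_one : dim P + 1 = V(G).ncard + G.redundantEdges
  isSimple : IsSimple P
  isBounded_iff : Bornology.IsBounded P ↔ G.Loopless
  faces : ∃ φ : Face P ≃o (G.Tubing)ᵒᵈ,
    ∀ F : Face P, dim F.1 + (OrderDual.ofDual (φ F)).1.ncard = dim P

/-! ### The product of simplices and rays -/

/-- A bundle: all the edges joining two given distinct nodes, if there are any. -/
def IsBundle (G : Graph α β) (B : Finset E(G)) : Prop :=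
  B.Nonempty ∧ ∃ x y, x ≠ y ∧ ∀ e : E(G), e ∈ B ↔ G.IsLink e x y

/-- The product of the simplices whose vertices are the edges of the bundles and of one ray for
each loop. -/
def bundlesAndRays (G : Graph α β) : Set (E(G) → ℝ) :=
  {y | (∀ B : Finset E(G), G.IsBundle B → (fun e : B => y e) ∈ stdSimplex ℝ B) ∧
    ∀ (e : E(G)) (x : α), G.IsLoopAt e x → 0 ≤ y e}

/-- The product of the simplex whose facets `p.1 v = 0` are labeled by the nodes `v`, of the
simplices of the bundles, and of the rays of the loops. -/
def basePolyhedron (G : Graph α β) [Fintype V(G)] : Set ((V(G) → ℝ) × (E(G) → ℝ)) :=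
  stdSimplex ℝ V(G) ×ˢ G.bundlesAndRays

/-- The edges and loops in the label of `t`: the edges of `t`, the bundles which contain no edge of
`t`, and the loops which are not incident to a node of `t`. (The nodes in the label are those of
`t`.) -/
def labelEdges (G t : Graph α β) : Set E(G) :=
  {e | (e : β) ∈ E(t) ∨ (∃ B : Finset E(G), G.IsBundle B ∧ e ∈ B ∧ ∀ f ∈ B, (f : β) ∉ E(t)) ∨
    ∃ x, G.IsLoopAt e x ∧ x ∉ V(t)}

/-- The face of the product labeled by `t`. In the node simplex it is the intersection of the facets
of the nodes of `t` if these form a proper subset of the nodes of `G`, and the whole simplex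
otherwise. In the simplex of a bundle it is spanned by the vertices of the edges in the label. The
ray of a loop is kept if the loop is in the label, and replaced by its end point otherwise. -/
def tubeFace (G : Graph α β) [Fintype V(G)] (t : Graph α β) : Set ((V(G) → ℝ) × (E(G) → ℝ)) :=
  {p ∈ G.basePolyhedron |
    (V(t) ≠ V(G) → ∀ v : V(G), (v : α) ∈ V(t) → p.1 v = 0) ∧ ∀ e ∉ G.labelEdges t, p.2 e = 0}

/-- The face labeled by a non-full tube `t` in the polyhedron `Q` that is left when the faces of all
full tubes `s` have been truncated with the half-spaces `h s`. The face of the product labeled by `t`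
lies in the one labeled by the full tube on the nodes of `t`, if the latter is proper; when that one
is replaced by a new facet, so is its subface by the corresponding face of the new facet. -/
def imageFace (G : Graph α β) (h : Graph α β → StrongDual ℝ ((V(G) → ℝ) × (E(G) → ℝ)) × ℝ)
    (Q : Set ((V(G) → ℝ) × (E(G) → ℝ))) (t : Graph α β) : Set ((V(G) → ℝ) × (E(G) → ℝ)) :=
  {p ∈ Q | (V(t) ≠ V(G) → (h (G.induce V(t))).1 p = (h (G.induce V(t))).2) ∧
    ∀ e ∉ G.labelEdges t, p.2 e = 0}

end

end Graph

/-! A simple polyhedron is studied through its facet inequalities. Its nonempty faces are the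
nonempty sets on which some set τ of inequalities is tight, and the codimension of such a face is
the size of τ. So the face poset is known as soon as it is known which facets meet. Truncating the
face of σ acts on the dual simplicial complex as a stellar subdivision: an old face τ survives
unless σ ⊆ τ, and the new facet meets the face of τ exactly when σ ⊄ τ and σ ∪ τ was a face.
Iteration gives a closed criterion, `IsSimpleSystem.truncationSequence`: old facets τ and new facets
N meet iff τ and the σ u with u ∈ N had a common point at the start and no truncated σ t is
contained in the union of τ and those σ u, u ∈ N, that were truncated after t. The positions of the
cutting hyperplanes do not matter, and the truncations can be carried out if no σ t is contained in
a later σ u (`IsSimpleSystem.canTruncate`).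

It remains to compare this criterion with the compatibility of tubes. For a full tube, σ t is its
node set. If two full tubes are incompatible, their union is connected and larger than both; it is
the set of all nodes, or a full tube that was truncated earlier and is covered by the two, and the
criterion fails either way. Conversely, a connected set covered by compatible tubes is covered by
one of them (`pairwise_tubesCompatible_iff_of_isFullTube`). For a non-full tube, σ t consists of the
edges between nodes of t that t lacks, and of the facet of the induced tube if t lacks a node. If s
and t are incompatible and the nodes of s belong to t, the obstruction is their intersection: it
misses a whole bundle, or it is a non-full tube that was truncated earlier
(`pairwise_tubesCompatible_union_iff`).

No facet of the base product survives both rounds, because those that are nonempty are themselves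
faces of tubes with one node or of tubes G - e. Hence the final facets correspond to the tubes, and
`IsPseudographAssociahedron.of_isSimpleSystem` applies. The dimension is counted at a vertex of the
product, and boundedness is decided by the rays of the loops. After the first round the product
structure persists, because the cutting functionals do not vary along the other factors
(`IsTruncationSequence.slice`). -/

namespace Polyhedral

open Filter Topology Set

/-! ### Simple polyhedra as systems of inequalities with independent tight functionals. -/

section System

variable {E : Type*} [NormedAddCommGroup E] [NormedSpace ℝ E] {ι : Type*}

/-- The part of the affine subspace `A` cut out by the inequalities with indices in `s`. -/
def solutions (A : AffineSubspace ℝ E) (a : ι → StrongDual ℝ E × ℝ) (s : Set ι) : Set E :=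
  {x | x ∈ A ∧ ∀ i ∈ s, (a i).1 x ≤ (a i).2}

/-- The solutions for which the inequalities with indices in `τ` are equalities. -/
def tightFace (A : AffineSubspace ℝ E) (a : ι → StrongDual ℝ E × ℝ) (s τ : Set ι) : Set E :=
  {x ∈ solutions A a s | ∀ i ∈ τ, (a i).1 x = (a i).2}

/-- A finite system of inequalities without lines in its solution set, such that the functionals
which are tight at a solution are linearly independent on the direction of `A`. -/
structure IsSimpleSystem (A : AffineSubspace ℝ E) (a : ι → StrongDual ℝ E × ℝ) (s : Set ι) :
    Prop where
  finite : s.Finite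
  pointed : ∀ d ∈ A.direction, (∀ i ∈ s, (a i).1 d = 0) → d = 0
  dual : ∀ x ∈ solutions A a s, ∀ i ∈ s, (a i).1 x = (a i).2 →
    ∃ d ∈ A.direction, (a i).1 d ≠ 0 ∧ ∀ j ∈ s, (a j).1 x = (a j).2 → j ≠ i → (a j).1 d = 0

variable {A : AffineSubspace ℝ E} {a : ι → StrongDual ℝ E × ℝ} {s σ τ : Set ι} {x y v d : E}

lemma add_mem_of_mem_direction (hx : x ∈ A) (hd : d ∈ A.direction) : x + d ∈ A := by
  have := AffineSubspace.vadd_mem_of_mem_direction hd hx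
  rwa [vadd_eq_add, add_comm] at this

lemma sub_mem_direction (hx : x ∈ A) (hy : y ∈ A) : x - y ∈ A.direction := by
  simpa using AffineSubspace.vsub_mem_direction hx hy

lemma convex_solutions : Convex ℝ (solutions A a s) := by
  intro x hx y hy p q hp hq hpq
  refine ⟨A.convex hx.1 hy.1 hp hq hpq, fun i hi => ?_⟩
  have h1 := mul_le_mul_of_nonneg_left (hx.2 i hi) hp
  have h2 := mul_le_mul_of_nonneg_left (hy.2 i hi) hq
  have h3 : p * (a i).2 + q * (a i).2 = (a i).2 := by rw [← add_mul, hpq, one_mul]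
  simp only [map_add, map_smul, smul_eq_mul]
  linarith

/-- Moving a little in a direction which does not increase the tight functionals. -/
lemma IsSimpleSystem.eventually_mem (hs : IsSimpleSystem A a s) (hx : x ∈ solutions A a s)
    (hd : d ∈ A.direction) (h : ∀ i ∈ s, (a i).1 x = (a i).2 → (a i).1 d ≤ 0) :
    ∀ᶠ c : ℝ in 𝓝[>] 0, x + c • d ∈ solutions A a s ∧
      ∀ i ∈ s, ((a i).1 x = (a i).2 → (a i).1 d < 0) → (a i).1 (x + c • d) < (a i).2 := by
  have h1 : ∀ᶠ c : ℝ in 𝓝[>] 0, ∀ i ∈ s, (a i).1 x < (a i).2 →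
      (a i).1 (x + c • d) < (a i).2 := by
    rw [hs.finite.eventually_all]
    intro i _
    by_cases hi : (a i).1 x < (a i).2
    · have hc : Continuous fun c : ℝ => (a i).1 (x + c • d) := by fun_prop
      have : ∀ᶠ c : ℝ in 𝓝 0, (a i).1 (x + c • d) < (a i).2 :=
        hc.continuousAt.eventually_lt continuousAt_const (by simpa using hi)
      filter_upwards [nhdsWithin_le_nhds this] with c hc _ using hc
    · exact .of_forall fun c h => absurd h hi
  filter_upwards [h1, self_mem_nhdsWithin] with c hc hpos
  have hpos : 0 < c := hpos
  refine ⟨⟨add_mem_of_mem_direction hx.1 (A.direction.smul_mem c hd), fun i hi => ?_⟩,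
    fun i hi hlt => ?_⟩
  · rcases (hx.2 i hi).lt_or_eq with h2 | h2
    · exact (hc i hi h2).le
    · have := mul_nonneg_of_nonpos_of_nonpos (h i hi h2) (neg_nonpos.2 hpos.le)
      simp only [map_add, map_smul, smul_eq_mul]
      linarith
  · rcases (hx.2 i hi).lt_or_eq with h2 | h2
    · exact hc i hi h2
    · have := mul_pos_of_neg_of_neg (hlt h2) (neg_neg_of_pos hpos)
      simp only [map_add, map_smul, smul_eq_mul]
      linarith

/-- A nonempty face contains a point at which no further inequality is tight. -/
lemma IsSimpleSystem.exists_tight_iff (hs : IsSimpleSystem A a s) (hτ : τ ⊆ s)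
    (hne : (tightFace A a s τ).Nonempty) :
    ∃ x ∈ tightFace A a s τ, ∀ i ∈ s, (a i).1 x = (a i).2 ↔ i ∈ τ := by
  classical
  obtain ⟨x, hx, hxτ⟩ := hne
  choose! d hd hdi hdj using hs.dual x hx
  set R := hs.finite.toFinset.filter fun i => (a i).1 x = (a i).2 ∧ i ∉ τ with hR
  have memR : ∀ i, i ∈ R ↔ i ∈ s ∧ (a i).1 x = (a i).2 ∧ i ∉ τ := by simp [hR]
  -- Scaled so that the tight inequalities outside τ have slope -1 along D and those in τ have slope
  -- 0; a small step makes exactly the former slack.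
  set D : E := ∑ i ∈ R, (-((a i).1 (d i))⁻¹) • d i with hD
  have hval : ∀ j ∈ s, (a j).1 x = (a j).2 → (a j).1 D = if j ∈ τ then 0 else -1 := by
    intro j hj hjx
    have hterm : ∀ i ∈ R, i ≠ j → (a j).1 ((-((a i).1 (d i))⁻¹) • d i) = 0 := by
      intro i hi hij
      obtain ⟨his, hix, _⟩ := (memR i).1 hi
      rw [map_smul, hdj i his hix j hj hjx hij.symm, smul_zero]
    rw [hD, map_sum]
    split_ifs with hjτ
    · exact Finset.sum_eq_zero fun i hi => hterm i hi fun h => ((memR i).1 hi).2.2 (h ▸ hjτ)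
    · rw [Finset.sum_eq_single_of_mem j ((memR j).2 ⟨hj, hjx, hjτ⟩) hterm, map_smul, smul_eq_mul,
        neg_mul, inv_mul_cancel₀ (hdi j hj hjx)]
  have hDdir : D ∈ A.direction := Submodule.sum_mem _ fun i hi =>
    A.direction.smul_mem _ (hd i ((memR i).1 hi).1 ((memR i).1 hi).2.1)
  obtain ⟨c, hc, hlt⟩ := (hs.eventually_mem hx hDdir fun i hi hix => by
    rw [hval i hi hix]; split_ifs <;> norm_num).exists
  have htight : ∀ i ∈ τ, (a i).1 (x + c • D) = (a i).2 := fun i hi => by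
    rw [map_add, map_smul, hval i (hτ hi) (hxτ i hi), if_pos hi, smul_zero, add_zero, hxτ i hi]
  refine ⟨x + c • D, ⟨hc, htight⟩, fun i hi => ⟨fun h => ?_, htight i⟩⟩
  by_contra hiτ
  refine (hlt i hi fun hix => ?_).ne h
  rw [hval i hi hix, if_neg hiτ]
  norm_num

/-- An inequality tight at a proper convex combination of two solutions is tight at both, so all
tight functionals vanish on their difference. -/
lemma mem_extremePoints_of_forall_direction (hx : x ∈ solutions A a s)
    (h : ∀ d ∈ A.direction, (∀ i ∈ s, (a i).1 x = (a i).2 → (a i).1 d = 0) → d = 0) :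
    x ∈ (solutions A a s).extremePoints ℝ := by
  refine mem_extremePoints.2 ⟨hx, fun y hy z hz hxyz => ?_⟩
  obtain ⟨p, q, hp, hq, hpq, rfl⟩ := hxyz
  have hyz : y - z = 0 := by
    refine h _ (sub_mem_direction hy.1 hz.1) fun i hi hix => ?_
    have h1 := hy.2 i hi
    have h2 := hz.2 i hi
    simp only [map_add, map_smul, smul_eq_mul] at hix
    have hsplit : p * ((a i).2 - (a i).1 y) + q * ((a i).2 - (a i).1 z) = 0 := by
      linear_combination (a i).2 * hpq - hix
    have h3 := mul_nonneg hp.le (sub_nonneg.2 h1)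
    have h4 := mul_nonneg hq.le (sub_nonneg.2 h2)
    have h5 : p * ((a i).2 - (a i).1 y) = 0 := by linarith
    have h6 : q * ((a i).2 - (a i).1 z) = 0 := by linarith
    rw [mul_eq_zero, or_iff_right hp.ne'] at h5
    rw [mul_eq_zero, or_iff_right hq.ne'] at h6
    rw [map_sub]
    linarith
  obtain rfl : y = z := sub_eq_zero.1 hyz
  rw [← add_smul, hpq, one_smul]
  exact ⟨rfl, rfl⟩

/-- Otherwise v would be the midpoint of two solutions v ± c d. -/
lemma IsSimpleSystem.eq_zero_of_mem_extremePoints (hs : IsSimpleSystem A a s)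
    (hv : v ∈ (solutions A a s).extremePoints ℝ) (hd : d ∈ A.direction)
    (h : ∀ i ∈ s, (a i).1 v = (a i).2 → (a i).1 d = 0) : d = 0 := by
  obtain ⟨hvP, hext⟩ := mem_extremePoints.1 hv
  have h1 := hs.eventually_mem hvP hd fun i hi hiv => (h i hi hiv).le
  have h2 := hs.eventually_mem hvP (A.direction.neg_mem hd) fun i hi hiv => by
    rw [map_neg, h i hi hiv, neg_zero]
  obtain ⟨c, ⟨⟨hc1, -⟩, hc2, -⟩, hc⟩ := ((h1.and h2).and self_mem_nhdsWithin).exists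
  have hc : 0 < c := hc
  have := (hext _ hc1 _ hc2 ⟨1 / 2, 1 / 2, by norm_num, by norm_num, by norm_num, by module⟩).1
  have h3 : c • d = 0 := by simpa using this
  exact (smul_eq_zero.1 h3).resolve_left hc.ne'

/-- A vertex is determined by the set of inequalities tight at it. -/
lemma IsSimpleSystem.finite_extremePoints (hs : IsSimpleSystem A a s) :
    ((solutions A a s).extremePoints ℝ).Finite := by
  refine Set.Finite.of_finite_image (f := fun v => {i ∈ s | (a i).1 v = (a i).2})
    (hs.finite.finite_subsets.subset ?_) fun v hv w hw hvw => ?_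
  · rintro _ ⟨v, -, rfl⟩
    exact fun i hi => hi.1
  · have hvw : {i ∈ s | (a i).1 v = (a i).2} = {i ∈ s | (a i).1 w = (a i).2} := hvw
    refine sub_eq_zero.1 (hs.eq_zero_of_mem_extremePoints hv
      (sub_mem_direction (extremePoints_subset hv).1 (extremePoints_subset hw).1)
      fun i hi hiv => ?_)
    have : i ∈ {i ∈ s | (a i).1 w = (a i).2} := hvw ▸ ⟨hi, hiv⟩
    rw [map_sub, hiv, this.2, sub_self]

/-- Moving in a direction in which some inequality bounds the move, until this happens. -/
lemma IsSimpleSystem.exists_tight_of_pos (hs : IsSimpleSystem A a s) (hx : x ∈ solutions A a s)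
    (hd : d ∈ A.direction) (h0 : ∀ i ∈ s, (a i).1 x = (a i).2 → (a i).1 d = 0)
    (hpos : ∃ i ∈ s, 0 < (a i).1 d) :
    ∃ c : ℝ, 0 ≤ c ∧ x + c • d ∈ solutions A a s ∧
      ∃ i ∈ s, (a i).1 x ≠ (a i).2 ∧ (a i).1 (x + c • d) = (a i).2 := by
  -- The ratio test of the simplex method: r i is the step length after which inequality i becomes
  -- tight.
  set r : ι → ℝ := fun i => ((a i).2 - (a i).1 x) / (a i).1 d
  obtain ⟨i, ⟨his, hid⟩, hmin⟩ := Set.exists_min_image {i ∈ s | 0 < (a i).1 d} r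
    (hs.finite.subset fun i hi => hi.1) (let ⟨i, hi, h⟩ := hpos; ⟨i, hi, h⟩)
  have hr : 0 ≤ r i := div_nonneg (sub_nonneg.2 (hx.2 i his)) hid.le
  refine ⟨r i, hr, ⟨add_mem_of_mem_direction hx.1 (A.direction.smul_mem _ hd), fun j hj => ?_⟩,
    i, his, fun h => hid.ne' (h0 i his h), ?_⟩
  · have hjx := hx.2 j hj
    simp only [map_add, map_smul, smul_eq_mul]
    rcases le_or_gt ((a j).1 d) 0 with hjd | hjd
    · have := mul_nonpos_of_nonneg_of_nonpos hr hjd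
      linarith
    · have := (le_div_iff₀ hjd).1 (hmin j ⟨hj, hjd⟩)
      linarith
  · simp only [map_add, map_smul, smul_eq_mul, r]
    rw [div_mul_cancel₀ _ hid.ne']
    ring

/-- A functional bounded above on the smallest face containing `x` is at least as large at some
vertex of that face. -/
lemma IsSimpleSystem.exists_extremePoint_ge (hs : IsSimpleSystem A a s) (ℓ : StrongDual ℝ E)
    (hx : x ∈ solutions A a s)
    (hbdd : ∃ c, ∀ y ∈ solutions A a s, (∀ i ∈ s, (a i).1 x = (a i).2 → (a i).1 y = (a i).2) →
      ℓ y ≤ c) :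
    ∃ v ∈ (solutions A a s).extremePoints ℝ, ℓ x ≤ ℓ v ∧
      ∀ i ∈ s, (a i).1 x = (a i).2 → (a i).1 v = (a i).2 := by
  -- Induction on the number of slack inequalities; each move makes at least one more of them tight.
  induction hn : {i ∈ s | (a i).1 x ≠ (a i).2}.ncard
    using Nat.strong_induction_on generalizing x with
  | _ n ih =>
  by_cases hdir : ∀ d ∈ A.direction, (∀ i ∈ s, (a i).1 x = (a i).2 → (a i).1 d = 0) → d = 0
  · exact ⟨x, mem_extremePoints_of_forall_direction hx hdir, le_rfl, fun _ _ h => h⟩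
  push Not at hdir
  obtain ⟨d, hd, hd0, hdne⟩ := hdir
  -- a direction along which `ℓ` does not decrease, and which is bounded by some inequality
  obtain ⟨d, hd, hd0, hℓ, hpos⟩ : ∃ d ∈ A.direction,
      (∀ i ∈ s, (a i).1 x = (a i).2 → (a i).1 d = 0) ∧ 0 ≤ ℓ d ∧ ∃ i ∈ s, 0 < (a i).1 d := by
    have key : ∀ d ∈ A.direction, (∀ i ∈ s, (a i).1 x = (a i).2 → (a i).1 d = 0) → 0 < ℓ d →
        ∃ i ∈ s, 0 < (a i).1 d := by
      intro d hd hd0 hℓ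
      by_contra! hneg
      obtain ⟨c, hc⟩ := hbdd
      obtain ⟨m, hm⟩ := exists_nat_gt ((c - ℓ x) / ℓ d)
      have h1 := hc (x + (m : ℝ) • d)
        ⟨add_mem_of_mem_direction hx.1 (A.direction.smul_mem _ hd), fun i hi => by
          have h2 := mul_nonpos_of_nonneg_of_nonpos (Nat.cast_nonneg m : (0 : ℝ) ≤ m) (hneg i hi)
          have h3 := hx.2 i hi
          simp only [map_add, map_smul, smul_eq_mul]
          linarith⟩
        fun i hi hix => by simp [hix, hd0 i hi hix]
      rw [div_lt_iff₀ hℓ] at hm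
      simp only [map_add, map_smul, smul_eq_mul] at h1
      linarith
    have hneg0 : ∀ i ∈ s, (a i).1 x = (a i).2 → (a i).1 (-d) = 0 := fun i hi hix => by
      rw [map_neg, hd0 i hi hix, neg_zero]
    rcases lt_trichotomy (ℓ d) 0 with h | h | h
    · have h' : 0 < ℓ (-d) := by rw [map_neg]; linarith
      exact ⟨-d, A.direction.neg_mem hd, hneg0, h'.le, key _ (A.direction.neg_mem hd) hneg0 h'⟩
    -- If ℓ is constant along d, the absence of lines provides an inequality which bounds d or -d.
    · obtain ⟨i, hi, hid⟩ : ∃ i ∈ s, (a i).1 d ≠ 0 := by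
        by_contra! h0
        exact hdne (hs.pointed d hd h0)
      rcases hid.lt_or_gt with hid | hid
      · exact ⟨-d, A.direction.neg_mem hd, hneg0, by rw [map_neg, h, neg_zero],
          i, hi, by rw [map_neg]; linarith⟩
      · exact ⟨d, hd, hd0, h.ge, i, hi, hid⟩
    · exact ⟨d, hd, hd0, h.le, key d hd hd0 h⟩
  obtain ⟨c, hc, hmem, i, hi, hix, hiy⟩ := hs.exists_tight_of_pos hx hd hd0 hpos
  have htight : ∀ i ∈ s, (a i).1 x = (a i).2 → (a i).1 (x + c • d) = (a i).2 := fun i hi hix => by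
    simp [hix, hd0 i hi hix]
  have hlt : {i ∈ s | (a i).1 (x + c • d) ≠ (a i).2}.ncard < n := by
    rw [← hn]
    refine Set.ncard_lt_ncard ⟨fun j hj => ⟨hj.1, fun h => hj.2 (htight j hj.1 h)⟩, fun h => ?_⟩
      (hs.finite.subset fun j hj => hj.1)
    exact (h ⟨hi, hix⟩ : i ∈ {i ∈ s | (a i).1 (x + c • d) ≠ (a i).2}).2 hiy
  obtain ⟨v, hv, hle, hvt⟩ := ih _ hlt hmem
    (let ⟨b, hb⟩ := hbdd; ⟨b, fun y hy hyt => hb y hy fun i hi h => hyt i hi (htight i hi h)⟩) rfl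
  refine ⟨v, hv, le_trans ?_ hle, fun i hi h => hvt i hi (htight i hi h)⟩
  have := mul_nonneg hc hℓ
  simp only [map_add, map_smul, smul_eq_mul]
  linarith

/-- The sum of the inequalities in `σ` supports the solution set along the face of `σ`. -/
lemma IsSimpleSystem.exists_support (hs : IsSimpleSystem A a s) (hσ : σ ⊆ s) :
    ∃ (ℓ : StrongDual ℝ E) (c : ℝ), (∀ x ∈ solutions A a s, ℓ x ≤ c) ∧
      ∀ x ∈ solutions A a s, ℓ x = c ↔ ∀ i ∈ σ, (a i).1 x = (a i).2 := by
  classical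
  have hfin := hs.finite.subset hσ
  refine ⟨∑ i ∈ hfin.toFinset, (a i).1, ∑ i ∈ hfin.toFinset, (a i).2, fun x hx => ?_,
    fun x hx => ?_⟩
  · rw [sum_apply]
    exact Finset.sum_le_sum fun i hi => hx.2 i (hσ (hfin.mem_toFinset.1 hi))
  · rw [sum_apply, Finset.sum_eq_sum_iff_of_le fun i hi =>
      hx.2 i (hσ (hfin.mem_toFinset.1 hi))]
    simp

/-- There are only finitely many vertices, so a supporting hyperplane of the face can be pushed in a
little without reaching a vertex outside the face. -/
lemma IsSimpleSystem.exists_isTruncation (hs : IsSimpleSystem A a s) (hσ : σ ⊆ s)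
    (hσne : σ.Nonempty) (hne : (tightFace A a s σ).Nonempty) :
    ∃ g, IsTruncation (solutions A a s) (tightFace A a s σ) g := by
  obtain ⟨ℓ, c, hle, heq⟩ := hs.exists_support hσ
  have hfin := hs.finite_extremePoints
  have hev : ∀ᶠ m in 𝓝[<] c, ∀ v ∈ (solutions A a s).extremePoints ℝ,
      v ∉ tightFace A a s σ → ℓ v < m := by
    rw [hfin.eventually_all]
    intro v hv
    by_cases hvσ : v ∈ tightFace A a s σ
    · exact .of_forall fun m h => absurd hvσ h
    · have hvP := extremePoints_subset hv
      have hlt : ℓ v < c := (hle v hvP).lt_of_ne fun h => hvσ ⟨hvP, (heq v hvP).1 h⟩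
      filter_upwards [nhdsWithin_le_nhds (lt_mem_nhds hlt)] with m hm _ using hm
  obtain ⟨m, hm, hmc⟩ := (hev.and self_mem_nhdsWithin).exists
  refine ⟨(ℓ, m), hne, fun h => ?_, c, hmc, hle, ?_, hm⟩
  -- A solution at which nothing is tight shows that the face is proper.
  · obtain ⟨x, hx, hxt⟩ := hs.exists_tight_iff (empty_subset s)
      (τ := ∅) (hne.mono fun x hx => ⟨hx.1, by simp⟩)
    obtain ⟨i, hi⟩ := hσne
    have hx' : x ∈ tightFace A a s σ := h ▸ hx.1
    exact (hxt i (hσ hi)).1 (hx'.2 i hi)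
  · ext x
    exact ⟨fun hx => ⟨hx.1, (heq x hx.1).2 hx.2⟩, fun hx => ⟨hx.1, (heq x hx.1).1 hx.2⟩⟩

/-! ### The effect of one truncation. -/

section Truncate

variable {k : ι}

lemma solutions_insert :
    solutions A a (insert k s) = {x ∈ solutions A a s | (a k).1 x ≤ (a k).2} := by
  ext x
  simp only [solutions, Set.mem_ofPred_eq, Set.forall_mem_insert]
  tauto

/-- A face that is not contained in the truncated face survives. -/
lemma IsSimpleSystem.exists_le_of_isTruncation (hs : IsSimpleSystem A a s) (hσ : σ ⊆ s)
    (hτ : τ ⊆ s) (ht : IsTruncation (solutions A a s) (tightFace A a s σ) (a k)) (hστ : ¬ σ ⊆ τ)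
    (hne : (tightFace A a s τ).Nonempty) : ∃ x ∈ tightFace A a s τ, (a k).1 x ≤ (a k).2 := by
  obtain ⟨-, -, c, hc, hle, hF, hv⟩ := ht
  by_contra! hgt
  obtain ⟨x, hx, hxt⟩ := hs.exists_tight_iff hτ hne
  obtain ⟨i, hiσ, hiτ⟩ := Set.not_subset.1 hστ
  have hxF : x ∉ tightFace A a s σ := fun h => hiτ ((hxt i (hσ hiσ)).1 (h.2 i hiσ))
  have hxc : (a k).1 x < c := (hle x hx.1).lt_of_ne fun h => hxF (hF ▸ ⟨hx.1, h⟩)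
  -- If the whole face were cut off, the new functional would be bounded below on it. A vertex of
  -- the face at which it is at most its value at x lies outside the truncated face, so it cannot
  -- have been cut off.
  obtain ⟨v, hvP, hvx, hvt⟩ := hs.exists_extremePoint_ge (-(a k).1) hx.1
    ⟨-(a k).2, fun y hy hyt => by
      simpa using (hgt y ⟨hy, fun i hi => hyt i (hτ hi) (hx.2 i hi)⟩).le⟩
  have hvx : (a k).1 v ≤ (a k).1 x := by simpa using hvx
  have hvF : v ∉ tightFace A a s σ := fun h => by
    rw [hF] at h
    linarith [h.2]
  exact absurd (hv v hvP hvF)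
    (hgt v ⟨extremePoints_subset hvP, fun i hi => hvt i (hτ hi) (hx.2 i hi)⟩).not_gt

/-- The new facet meets only the faces which meet the truncated one. -/
lemma IsSimpleSystem.nonempty_of_isTruncation (hs : IsSimpleSystem A a s)
    (hτ : τ ⊆ s) (ht : IsTruncation (solutions A a s) (tightFace A a s σ) (a k))
    (hx : x ∈ tightFace A a s τ) (hxk : (a k).1 x = (a k).2) :
    (tightFace A a s (τ ∪ σ)).Nonempty := by
  obtain ⟨-, -, c, hc, hle, hF, hv⟩ := ht
  obtain ⟨v, hvP, hvx, hvt⟩ := hs.exists_extremePoint_ge (a k).1 hx.1 ⟨c, fun y hy _ => hle y hy⟩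
  have hvF : v ∈ tightFace A a s σ := by
    by_contra h
    linarith [hv v hvP h]
  exact ⟨v, hvF.1, fun i hi => hi.elim (fun hi => hvt i (hτ hi) (hx.2 i hi)) (hvF.2 i)⟩

lemma not_subset_of_isTruncation
    (ht : IsTruncation (solutions A a s) (tightFace A a s σ) (a k))
    (hx : x ∈ tightFace A a s τ) (hxk : (a k).1 x ≤ (a k).2) : ¬ σ ⊆ τ := by
  intro hστ
  obtain ⟨-, -, c, hc, hle, hF, hv⟩ := ht
  have : x ∈ tightFace A a s σ := ⟨hx.1, fun i hi => hx.2 i (hστ hi)⟩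
  rw [hF] at this
  linarith [this.2]

lemma tightFace_insert :
    tightFace A a (insert k s) τ = {x ∈ tightFace A a s τ | (a k).1 x ≤ (a k).2} := by
  ext x
  simp only [tightFace, solutions_insert, Set.mem_ofPred_eq]
  tauto

/-- This lemma describes the old faces after a stellar subdivision of the dual complex, and the next
one describes those in the new facet. -/
lemma IsSimpleSystem.nonempty_tightFace_insert (hs : IsSimpleSystem A a s) (hσ : σ ⊆ s)
    (hτ : τ ⊆ s) (ht : IsTruncation (solutions A a s) (tightFace A a s σ) (a k)) :
    (∃ x ∈ tightFace A a s τ, (a k).1 x ≤ (a k).2) ↔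
      ¬ σ ⊆ τ ∧ (tightFace A a s τ).Nonempty :=
  ⟨fun ⟨x, hx, hxk⟩ => ⟨not_subset_of_isTruncation ht hx hxk, x, hx⟩,
    fun ⟨hστ, hne⟩ => hs.exists_le_of_isTruncation hσ hτ ht hστ hne⟩

/-- A point of the face of τ that is kept and a common point of the faces of τ and σ lie on
different sides of the new hyperplane, so the segment between them meets it. -/
lemma IsSimpleSystem.nonempty_tightFace_insert_insert (hs : IsSimpleSystem A a s) (hσ : σ ⊆ s)
    (hτ : τ ⊆ s) (ht : IsTruncation (solutions A a s) (tightFace A a s σ) (a k)) :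
    (∃ x ∈ tightFace A a s τ, (a k).1 x = (a k).2) ↔
      ¬ σ ⊆ τ ∧ (tightFace A a s (τ ∪ σ)).Nonempty := by
  refine ⟨fun ⟨x, hx, hxk⟩ => ⟨not_subset_of_isTruncation ht hx hxk.le,
    hs.nonempty_of_isTruncation hτ ht hx hxk⟩, fun ⟨hστ, y, hy, hyt⟩ => ?_⟩
  have hyτ : y ∈ tightFace A a s τ := ⟨hy, fun i hi => hyt i (.inl hi)⟩
  obtain ⟨x, hx, hxk⟩ := hs.exists_le_of_isTruncation hσ hτ ht hστ ⟨y, hyτ⟩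
  obtain ⟨-, -, c, hc, hle, hF, hv⟩ := ht
  have hyF : y ∈ tightFace A a s σ := ⟨hy, fun i hi => hyt i (.inr hi)⟩
  have hyc : (a k).1 y = c := by
    rw [hF] at hyF
    exact hyF.2
  -- the point on the segment from `x` to `y` where the new inequality is tight
  have hpos : 0 < c - (a k).1 x := by linarith
  set p := ((a k).2 - (a k).1 x) / (c - (a k).1 x) with hp
  have hp0 : 0 ≤ p := div_nonneg (by linarith) hpos.le
  have hp1 : p ≤ 1 := (div_le_one hpos).2 (by linarith)
  have hpe : p * (c - (a k).1 x) = (a k).2 - (a k).1 x := div_mul_cancel₀ _ hpos.ne'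
  refine ⟨(1 - p) • x + p • y, ⟨convex_solutions hx.1 hy (by linarith) hp0 (by ring),
    fun i hi => ?_⟩, ?_⟩
  · simp only [map_add, map_smul, smul_eq_mul, hx.2 i hi, hyτ.2 i hi]
    ring
  · simp only [map_add, map_smul, smul_eq_mul, hyc]
    linear_combination hpe

/-- A truncation of a simple polyhedron is simple. -/
lemma IsSimpleSystem.insert_of_isTruncation (hs : IsSimpleSystem A a s)
    (ht : IsTruncation (solutions A a s) (tightFace A a s σ) (a k)) :
    IsSimpleSystem A a (insert k s) where
  finite := hs.finite.insert k
  pointed d hd h := hs.pointed d hd fun i hi => h i (.inr hi)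
  dual x hx i hi hix := by
    by_cases hks : k ∈ s
    · rw [Set.insert_eq_of_mem hks] at *
      exact hs.dual x hx i hi hix
    rw [solutions_insert] at hx
    obtain ⟨hx, hxk⟩ := hx
    by_cases hxk' : (a k).1 x = (a k).2
    · -- the direction from `x` to the truncated face
      obtain ⟨v, hv, hvt⟩ := hs.nonempty_of_isTruncation
        (τ := {j ∈ s | (a j).1 x = (a j).2}) (fun j hj => hj.1) ht ⟨hx, fun j hj => hj.2⟩ hxk'
      obtain ⟨-, -, c, hc, -, hF, -⟩ := ht
      have hvc : (a k).1 v = c := by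
        have : v ∈ tightFace A a s σ := ⟨hv, fun i hi => hvt i (.inr hi)⟩
        rw [hF] at this
        exact this.2
      have hdk : (a k).1 (v - x) ≠ 0 := by
        rw [map_sub, hvc, hxk']
        linarith
      have hdj : ∀ j ∈ s, (a j).1 x = (a j).2 → (a j).1 (v - x) = 0 := fun j hj hjx => by
        rw [map_sub, hvt j (.inl ⟨hj, hjx⟩), hjx, sub_self]
      have hdir := sub_mem_direction hv.1 hx.1
      rcases hi with rfl | hi
      · refine ⟨v - x, hdir, hdk, fun j hj hjx hji => ?_⟩
        exact hdj j (hj.resolve_left hji) hjx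
      · obtain ⟨d, hd, hdi, hdo⟩ := hs.dual x hx i hi hix
        -- Among the functionals tight at x only the new one changes along v - x, so a multiple of v
        -- - x corrects the old dual vector d.
        refine ⟨d - ((a k).1 d / (a k).1 (v - x)) • (v - x),
          A.direction.sub_mem hd (A.direction.smul_mem _ hdir), ?_, fun j hj hjx hji => ?_⟩
        · rw [map_sub, map_smul, hdj i hi hix, smul_zero, sub_zero]
          exact hdi
        · rw [map_sub, map_smul, smul_eq_mul]
          rcases hj with rfl | hj
          · rw [div_mul_cancel₀ _ hdk, sub_self]
          · rw [hdj j hj hjx, mul_zero, hdo j hj hjx hji, sub_zero]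
    · have hi : i ∈ s := hi.resolve_left fun h => hxk' (h ▸ hix)
      obtain ⟨d, hd, hdi, hdo⟩ := hs.dual x hx i hi hix
      exact ⟨d, hd, hdi, fun j hj hjx hji =>
        hdo j (hj.resolve_left fun h => hxk' (h ▸ hjx)) hjx hji⟩

end Truncate

end System

/-! ### Faces, their dimensions, and simplicity. -/

section Faces

variable {E : Type*} [NormedAddCommGroup E] [NormedSpace ℝ E] {ι : Type*}
  {A : AffineSubspace ℝ E} {a : ι → StrongDual ℝ E × ℝ} {s σ τ : Set ι} {x y v d : E} {F : Set E}

/-- The indices of the inequalities which are tight on `F`. -/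
def tightSet (a : ι → StrongDual ℝ E × ℝ) (s : Set ι) (F : Set E) : Set ι :=
  {i ∈ s | ∀ x ∈ F, (a i).1 x = (a i).2}

lemma tightFace_empty : tightFace A a s ∅ = solutions A a s := by
  simp [tightFace]

lemma IsSimpleSystem.tightSet_tightFace (hs : IsSimpleSystem A a s) (hτ : τ ⊆ s)
    (hne : (tightFace A a s τ).Nonempty) : tightSet a s (tightFace A a s τ) = τ := by
  obtain ⟨x, hx, hxt⟩ := hs.exists_tight_iff hτ hne
  exact Subset.antisymm (fun i hi => (hxt i hi.1).1 (hi.2 x hx)) fun i hi =>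
    ⟨hτ hi, fun y hy => hy.2 i hi⟩

lemma IsSimpleSystem.isFace_tightFace (hs : IsSimpleSystem A a s) (hτ : τ ⊆ s)
    (hne : (tightFace A a s τ).Nonempty) : IsFace (solutions A a s) (tightFace A a s τ) := by
  obtain ⟨ℓ, c, hle, heq⟩ := hs.exists_support hτ
  refine ⟨hne, fun _ => ⟨ℓ, ?_⟩⟩
  obtain ⟨y, hy, hyt⟩ := hne
  ext x
  refine ⟨fun hx => ⟨hx.1, fun z hz => ?_⟩, fun hx => ⟨hx.1, (heq x hx.1).1 ?_⟩⟩
  · rw [(heq x hx.1).2 hx.2]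
    exact hle z hz
  · exact le_antisymm (hle x hx.1) (((heq y hy).2 hyt).ge.trans (hx.2 y hy))

/-- At a point x of F with the fewest tight inequalities, only those tight on all of F are tight;
otherwise a midpoint would have fewer. Hence x can be moved slightly away from any z in the tight
face, and since the exposing functional is maximal at x, its value at z is not smaller. -/
lemma IsSimpleSystem.eq_tightFace (hs : IsSimpleSystem A a s) (hF : IsFace (solutions A a s) F) :
    F = tightFace A a s (tightSet a s F) := by
  obtain ⟨hne, hexp⟩ := hF
  obtain ⟨ℓ, hℓ⟩ := hexp hne
  have hFP : F ⊆ solutions A a s := fun x hx => (hℓ ▸ hx : x ∈ {x ∈ _ | _}).1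
  refine Subset.antisymm (fun x hx => ⟨hFP hx, fun i hi => hi.2 x hx⟩) fun z hz => ?_
  -- a point of `F` with as few tight inequalities as possible
  set N : E → ℕ := fun x => {i ∈ s | (a i).1 x = (a i).2}.ncard
  obtain ⟨x, hxF, hmin⟩ : ∃ x ∈ F, ∀ y ∈ F, N x ≤ N y := by
    obtain ⟨m, ⟨x, hx, rfl⟩, hm⟩ := WellFounded.has_min Nat.lt_wfRel.wf (N '' F) (hne.image N)
    exact ⟨x, hx, fun y hy => not_lt.1 (hm _ ⟨y, hy, rfl⟩)⟩
  have hxP := hFP hxF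
  have htight : ∀ i ∈ s, (a i).1 x = (a i).2 → ∀ y ∈ F, (a i).1 y = (a i).2 := by
    intro i hi hix y hy
    by_contra hiy
    have hyP := hFP hy
    set w : E := (1 / 2 : ℝ) • x + (1 / 2 : ℝ) • y with hw
    have hwP : w ∈ solutions A a s :=
      convex_solutions hxP hyP (by norm_num) (by norm_num) (by norm_num)
    have hwval : ∀ f : StrongDual ℝ E, f w = (f x + f y) / 2 := fun f => by
      simp only [hw, map_add, map_smul, smul_eq_mul]
      ring
    rw [hℓ] at hxF hy
    have hwF : w ∈ F := by
      rw [hℓ]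
      refine ⟨hwP, fun z hz => ?_⟩
      rw [hwval]
      linarith [hxF.2 z hz, hy.2 z hz]
    have hwt : ∀ j ∈ s, (a j).1 w = (a j).2 → (a j).1 x = (a j).2 ∧ (a j).1 y = (a j).2 := by
      intro j hj hjw
      rw [hwval] at hjw
      have h1 := hxP.2 j hj
      have h2 := hyP.2 j hj
      exact ⟨by linarith, by linarith⟩
    refine absurd (hmin w hwF) (not_le.2 (Set.ncard_lt_ncard
      ⟨fun j hj => ⟨hj.1, (hwt j hj.1 hj.2).1⟩, fun h => ?_⟩ (hs.finite.subset fun j hj => hj.1)))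
    have hiw : i ∈ {i ∈ s | (a i).1 w = (a i).2} := h ⟨hi, hix⟩
    exact hiy (hwt i hi hiw.2).2
  obtain ⟨c, ⟨hc, -⟩, hpos⟩ := ((hs.eventually_mem hxP (sub_mem_direction hxP.1 hz.1.1)
    fun i hi hix => by
      rw [map_sub, hix, hz.2 i ⟨hi, htight i hi hix⟩, sub_self]).and self_mem_nhdsWithin).exists
  have hpos : 0 < c := hpos
  rw [hℓ] at hxF ⊢
  have h1 := hxF.2 _ hc
  simp only [map_add, map_smul, map_sub, smul_eq_mul] at h1
  have h2 : c * (ℓ x - ℓ z) ≤ 0 := by linarith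
  have h3 : ℓ x ≤ ℓ z := by
    by_contra! h
    exact absurd h2 (not_le.2 (mul_pos hpos (sub_pos.2 h)))
  exact ⟨hz.1, fun y hy => (hxF.2 y hy).trans h3⟩

/-- The directions in which the inequalities in `τ` stay tight. -/
def tightDirection (A : AffineSubspace ℝ E) (a : ι → StrongDual ℝ E × ℝ) (τ : Set ι) :
    Submodule ℝ E where
  carrier := {d | d ∈ A.direction ∧ ∀ i ∈ τ, (a i).1 d = 0}
  add_mem' hx hy := ⟨A.direction.add_mem hx.1 hy.1, fun i hi => by
    rw [map_add, hx.2 i hi, hy.2 i hi, add_zero]⟩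
  zero_mem' := ⟨A.direction.zero_mem, fun i _ => map_zero _⟩
  smul_mem' c x hx := ⟨A.direction.smul_mem c hx.1, fun i hi => by
    rw [map_smul, hx.2 i hi, smul_zero]⟩

lemma IsSimpleSystem.vectorSpan_tightFace (hs : IsSimpleSystem A a s) (hτ : τ ⊆ s)
    (hne : (tightFace A a s τ).Nonempty) :
    vectorSpan ℝ (tightFace A a s τ) = tightDirection A a τ := by
  apply le_antisymm
  · refine Submodule.span_le.2 ?_
    rintro _ ⟨x, hx, y, hy, rfl⟩
    exact ⟨sub_mem_direction hx.1.1 hy.1.1, fun i hi => by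
      change (a i).1 (x - y) = 0
      rw [map_sub, hx.2 i hi, hy.2 i hi, sub_self]⟩
  · intro d hd
    obtain ⟨x, hx, hxt⟩ := hs.exists_tight_iff hτ hne
    obtain ⟨c, ⟨hc, -⟩, hpos⟩ := ((hs.eventually_mem hx.1 hd.1 fun i hi hix =>
      (hd.2 i ((hxt i hi).1 hix)).le).and self_mem_nhdsWithin).exists
    have hpos : 0 < c := hpos
    have hmem : x + c • d ∈ tightFace A a s τ := ⟨hc, fun i hi => by
      rw [map_add, map_smul, hd.2 i hi, smul_zero, add_zero, hx.2 i hi]⟩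
    have := vsub_mem_vectorSpan ℝ hmem hx
    rw [vsub_eq_sub, add_sub_cancel_left] at this
    have h2 := Submodule.smul_mem _ c⁻¹ this
    rwa [smul_smul, inv_mul_cancel₀ hpos.ne', one_smul] at h2

variable [FiniteDimensional ℝ E]

/-- By the dual vectors, the tight functionals map the direction of A onto the functions on τ; the
rest is rank-nullity. -/
lemma IsSimpleSystem.finrank_tightDirection (hs : IsSimpleSystem A a s) (hτ : τ ⊆ s)
    (hne : (tightFace A a s τ).Nonempty) :
    Module.finrank ℝ (tightDirection A a τ) + τ.ncard = Module.finrank ℝ A.direction := by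
  classical
  obtain ⟨x, hx, hxt⟩ := hne
  have : Fintype τ := (hs.finite.subset hτ).fintype
  choose! d hd hdi hdj using hs.dual x hx
  let L : A.direction →ₗ[ℝ] τ → ℝ :=
    LinearMap.pi fun i => (a i).1.toLinearMap ∘ₗ A.direction.subtype
  have hL : ∀ w i, L w i = (a i).1 (w : E) := fun _ _ => rfl
  have hsurj : LinearMap.range L = ⊤ := by
    rw [LinearMap.range_eq_top]
    intro f
    refine ⟨∑ i : τ, (f i / (a i).1 (d i)) • ⟨d i, hd i (hτ i.2) (hxt i i.2)⟩, ?_⟩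
    ext j
    rw [hL, Submodule.coe_sum, map_sum, Finset.sum_eq_single_of_mem j (Finset.mem_univ j)]
    · rw [Submodule.coe_smul, map_smul, smul_eq_mul,
        div_mul_cancel₀ _ (hdi j (hτ j.2) (hxt j j.2))]
    · intro i _ hij
      rw [Submodule.coe_smul, map_smul, hdj i (hτ i.2) (hxt i i.2) j (hτ j.2) (hxt j j.2)
        fun h => hij (Subtype.ext h.symm), smul_zero]
  have hker : (LinearMap.ker L).map A.direction.subtype = tightDirection A a τ := by
    ext w
    simp only [Submodule.mem_map, LinearMap.mem_ker, Submodule.subtype_apply]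
    constructor
    · rintro ⟨w, hw, rfl⟩
      exact ⟨w.2, fun i hi => (hL w ⟨i, hi⟩).symm.trans (congrFun hw _)⟩
    · intro hw
      exact ⟨⟨w, hw.1⟩, funext fun i => hw.2 i i.2, rfl⟩
  have h1 := L.finrank_range_add_finrank_ker
  rw [hsurj, finrank_top, Module.finrank_fintype_fun_eq_card] at h1
  rw [← hker, Submodule.finrank_map_subtype_eq, ← h1, Set.ncard_eq_toFinset_card', add_comm,
    Set.toFinset_card]

lemma IsSimpleSystem.dim_tightFace (hs : IsSimpleSystem A a s) (hτ : τ ⊆ s)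
    (hne : (tightFace A a s τ).Nonempty) :
    dim (tightFace A a s τ) + τ.ncard = Module.finrank ℝ A.direction := by
  rw [dim, hs.vectorSpan_tightFace hτ hne, hs.finrank_tightDirection hτ hne]

lemma IsSimpleSystem.dim_solutions (hs : IsSimpleSystem A a s) (hne : (solutions A a s).Nonempty) :
    dim (solutions A a s) = Module.finrank ℝ A.direction := by
  have := hs.dim_tightFace (empty_subset s) (tightFace_empty (A := A) (a := a) ▸ hne)
  rwa [tightFace_empty, Set.ncard_empty, add_zero] at this

lemma IsSimpleSystem.ncard_tight_of_mem_extremePoints (hs : IsSimpleSystem A a s)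
    (hv : v ∈ (solutions A a s).extremePoints ℝ) :
    {i ∈ s | (a i).1 v = (a i).2}.ncard = Module.finrank ℝ A.direction := by
  have hsub : {i ∈ s | (a i).1 v = (a i).2} ⊆ s := fun i hi => hi.1
  have h := hs.finrank_tightDirection hsub ⟨v, extremePoints_subset hv, fun i hi => hi.2⟩
  have h0 : tightDirection A a {i ∈ s | (a i).1 v = (a i).2} = ⊥ := by
    rw [eq_bot_iff]
    exact fun d hd => hs.eq_zero_of_mem_extremePoints hv hd.1 fun i hi hiv => hd.2 i ⟨hi, hiv⟩
  rwa [h0, finrank_bot, zero_add] at h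

/-- The facets through a vertex are the tight faces of the single inequalities tight there, and the
number of these is the dimension. -/
lemma IsSimpleSystem.isSimple (hs : IsSimpleSystem A a s) : IsSimple (solutions A a s) := by
  intro v hv
  have hvP := extremePoints_subset hv
  rw [hs.dim_solutions ⟨v, hvP⟩, ← hs.ncard_tight_of_mem_extremePoints hv]
  have hne : ∀ i ∈ s, (a i).1 v = (a i).2 → (tightFace A a s {i}).Nonempty := fun i hi hiv =>
    ⟨v, hvP, fun j hj => by rwa [mem_singleton_iff.1 hj]⟩
  have himage : {F | IsFacet (solutions A a s) F ∧ v ∈ F} =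
      (fun i => tightFace A a s {i}) '' {i ∈ s | (a i).1 v = (a i).2} := by
    ext F
    constructor
    · rintro ⟨⟨hF, hdim⟩, hvF⟩
      have hτ : tightSet a s F ⊆ s := fun i hi => hi.1
      have hFt := hs.eq_tightFace hF
      have h1 := hs.dim_tightFace hτ (hFt ▸ hF.1)
      rw [← hFt, ← hs.dim_solutions ⟨v, hvP⟩, ← hdim] at h1
      obtain ⟨i, hi⟩ := Set.ncard_eq_one.1 (Nat.add_left_cancel h1)
      have his : i ∈ tightSet a s F := hi ▸ mem_singleton i
      exact ⟨i, ⟨his.1, his.2 v hvF⟩, by rw [hFt, hi]⟩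
    · rintro ⟨i, ⟨hi, hiv⟩, rfl⟩
      have hτ : {i} ⊆ s := singleton_subset_iff.2 hi
      refine ⟨⟨hs.isFace_tightFace hτ (hne i hi hiv), ?_⟩, hvP, fun j hj => by
        rwa [mem_singleton_iff.1 hj]⟩
      rw [hs.dim_solutions ⟨v, hvP⟩, ← hs.dim_tightFace hτ (hne i hi hiv), Set.ncard_singleton]
  rw [himage, Set.InjOn.ncard_image]
  intro i hi j hj hij
  have h1 := hs.tightSet_tightFace (singleton_subset_iff.2 hi.1) (hne i hi.1 hi.2)
  have h2 := hs.tightSet_tightFace (singleton_subset_iff.2 hj.1) (hne j hj.1 hj.2)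
  have hij : tightFace A a s {i} = tightFace A a s {j} := hij
  rw [hij, h2] at h1
  exact (singleton_injective h1).symm

end Faces

/-! ### Sequences of truncations. -/

section Sequence

variable {E : Type*} [NormedAddCommGroup E] [NormedSpace ℝ E] {ι T : Type*}
  {A : AffineSubspace ℝ E} {a : ι → StrongDual ℝ E × ℝ} {s : Set ι} {h : T → StrongDual ℝ E × ℝ}
  {L : List T} {σ : T → Set ι} {face : T → Set E}

/-- In a list without repetitions, `[u, w].Sublist L` encodes that u comes before w. -/
lemma pair_sublist_append_singleton {L : List T} {t u w : T} :
    [u, w].Sublist (L ++ [t]) ↔ [u, w].Sublist L ∨ u ∈ L ∧ w = t := by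
  rw [List.sublist_append_iff]
  constructor
  · rintro ⟨l₁, l₂, hl, h1, h2⟩
    rw [List.sublist_singleton] at h2
    rcases h2 with rfl | rfl
    · rw [List.append_nil] at hl
      exact .inl (hl ▸ h1)
    · obtain ⟨rfl, rfl⟩ : l₁ = [u] ∧ t = w := by
        cases l₁ with
        | nil => simp at hl
        | cons x l₁ => cases l₁ <;> simp_all
      exact .inr ⟨List.singleton_sublist.1 h1, rfl⟩
  · rintro (h | ⟨h, rfl⟩)
    · exact ⟨_, _, (List.append_nil _).symm, h, List.nil_sublist _⟩
    · exact ⟨[u], [w], rfl, List.singleton_sublist.2 h, List.Sublist.refl _⟩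

lemma pair_sublist_or {L : List T} {u w : T} (hu : u ∈ L) (hw : w ∈ L) (hne : u ≠ w) :
    [u, w].Sublist L ∨ [w, u].Sublist L := by
  induction L using List.reverseRecOn with
  | nil => simp at hu
  | append_singleton L t ih =>
    simp only [pair_sublist_append_singleton]
    simp only [List.mem_append, List.mem_singleton] at hu hw
    grind

/-- The indices of the inequalities after the truncations in `L`. -/
def cutIndices (s : Set ι) (L : List T) : Set (ι ⊕ T) := Sum.inl '' s ∪ Sum.inr '' {t | t ∈ L}

lemma cut_solutions :
    cut (solutions A a s) h L = solutions A (Sum.elim a h) (cutIndices s L) := by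
  ext x
  simp only [cut, solutions, cutIndices, mem_ofPred_eq, mem_union, mem_image]
  constructor
  · rintro ⟨⟨hA, h1⟩, h2⟩
    refine ⟨hA, ?_⟩
    rintro _ (⟨i, hi, rfl⟩ | ⟨t, ht, rfl⟩)
    exacts [h1 i hi, h2 t ht]
  · rintro ⟨hA, h1⟩
    exact ⟨⟨hA, fun i hi => h1 (.inl i) (.inl ⟨i, hi, rfl⟩)⟩,
      fun t ht => h1 (.inr t) (.inr ⟨t, ht, rfl⟩)⟩

lemma mem_tightFace_cutIndices {τ : Set ι} {N : Set T} {x : E} :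
    x ∈ tightFace A (Sum.elim a h) (cutIndices s L) (Sum.inl '' τ ∪ Sum.inr '' N) ↔
      x ∈ cut (solutions A a s) h L ∧ (∀ i ∈ τ, (a i).1 x = (a i).2) ∧
        ∀ t ∈ N, (h t).1 x = (h t).2 := by
  rw [cut_solutions, tightFace, mem_ofPred_eq, and_congr_right_iff]
  intro _
  constructor
  · exact fun h1 => ⟨fun i hi => h1 (.inl i) (.inl ⟨i, hi, rfl⟩),
      fun t ht => h1 (.inr t) (.inr ⟨t, ht, rfl⟩)⟩
  · rintro ⟨h1, h2⟩ _ (⟨i, hi, rfl⟩ | ⟨t, ht, rfl⟩)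
    exacts [h1 i hi, h2 t ht]

lemma cut_subset {P : Set E} : cut P h L ⊆ P := fun _ hx => hx.1

lemma cutIndices_append_singleton {t : T} :
    cutIndices s (L ++ [t]) = insert (Sum.inr t) (cutIndices s L) := by
  ext k
  rcases k with i | u <;> simp [cutIndices, or_comm]

lemma face_inter_cut {t : T}
    (hface : ∀ x ∈ solutions A a s, x ∈ face t ↔ ∀ i ∈ σ t, (a i).1 x = (a i).2) :
    face t ∩ cut (solutions A a s) h L =
      tightFace A (Sum.elim a h) (cutIndices s L) (Sum.inl '' σ t) := by
  ext x
  rw [← union_empty (Sum.inl '' σ t), ← image_empty Sum.inr, mem_tightFace_cutIndices]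
  constructor
  · exact fun ⟨h1, h2⟩ => ⟨h2, (hface x h2.1).1 h1, by simp⟩
  · exact fun ⟨h1, h2, _⟩ => ⟨(hface x h1.1).2 h2, h1⟩

lemma IsTruncationSequence.of_append {P : Set E} {L' : List T}
    (hseq : IsTruncationSequence P face h (L ++ L')) : IsTruncationSequence P face h L :=
  fun L₀ t hp => hseq L₀ t (hp.trans (List.prefix_append _ _))

/-- Successive truncations of a simple polyhedron: the result is simple, and its faces are
determined by those of the original polyhedron. -/
theorem IsSimpleSystem.truncationSequence (hs : IsSimpleSystem A a s) (hσ : ∀ t ∈ L, σ t ⊆ s)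
    (hface : ∀ t ∈ L, ∀ x ∈ solutions A a s, x ∈ face t ↔ ∀ i ∈ σ t, (a i).1 x = (a i).2)
    (hL : L.Nodup) (hseq : IsTruncationSequence (solutions A a s) face h L) :
    IsSimpleSystem A (Sum.elim a h) (cutIndices s L) ∧
    ∀ τ ⊆ s, ∀ N : Set T, (∀ t ∈ N, t ∈ L) →
      ((tightFace A (Sum.elim a h) (cutIndices s L) (Sum.inl '' τ ∪ Sum.inr '' N)).Nonempty ↔
        (tightFace A a s (τ ∪ {i | ∃ t ∈ N, i ∈ σ t})).Nonempty ∧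
        ∀ t ∈ L, ∃ i ∈ σ t, i ∉ τ ∧ ∀ u ∈ N, [t, u].Sublist L → i ∉ σ u) := by
  classical
  induction L using List.reverseRecOn with
  | nil =>
    constructor
    · have hmem : ∀ k ∈ cutIndices s ([] : List T), ∃ i ∈ s, Sum.inl i = k := by
        simp [cutIndices]
      have hsol : solutions A (Sum.elim a h) (cutIndices s []) = solutions A a s := by
        rw [← cut_solutions]
        simp [cut]
      refine ⟨by simpa [cutIndices] using hs.finite.image _, fun d hd h0 => hs.pointed d hd
        fun i hi => h0 (.inl i) (by simp [cutIndices, hi]), fun x hx k hk hkx => ?_⟩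
      rw [hsol] at hx
      obtain ⟨i, hi, rfl⟩ := hmem k hk
      obtain ⟨d, hd, hdi, hdj⟩ := hs.dual x hx i hi hkx
      refine ⟨d, hd, hdi, fun k hk hkx hki => ?_⟩
      obtain ⟨j, hj, rfl⟩ := hmem k hk
      exact hdj j hj hkx fun h => hki (h ▸ rfl)
    · intro τ hτ N hN
      obtain rfl : N = ∅ := eq_empty_of_forall_notMem fun t ht => by simpa using hN t ht
      have : tightFace A (Sum.elim a h) (cutIndices s []) (Sum.inl '' τ ∪ Sum.inr '' ∅) =
          tightFace A a s τ := by
        ext x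
        rw [mem_tightFace_cutIndices]
        simp [cut, tightFace]
      rw [this]
      simp
  | append_singleton L t ih =>
    have hmem : ∀ u ∈ L, u ∈ L ++ [t] := fun u hu => List.mem_append_left _ hu
    have htL : t ∈ L ++ [t] := by simp
    have hnd : t ∉ L ∧ L.Nodup := by
      rw [List.nodup_append_comm] at hL
      simpa using hL
    obtain ⟨hsL, hN⟩ := ih (fun u hu => hσ u (hmem u hu)) (fun u hu => hface u (hmem u hu)) hnd.2
      hseq.of_append
    have htr := hseq L t List.prefix_rfl
    rw [face_inter_cut (hface t htL), cut_solutions] at htr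
    have htr : IsTruncation (solutions A (Sum.elim a h) (cutIndices s L))
      (tightFace A (Sum.elim a h) (cutIndices s L) (Sum.inl '' σ t)) (Sum.elim a h (.inr t)) := htr
    have hσL : (Sum.inl '' σ t : Set (ι ⊕ T)) ⊆ cutIndices s L :=
      (image_mono (hσ t htL)).trans subset_union_left
    rw [cutIndices_append_singleton]
    refine ⟨hsL.insert_of_isTruncation htr, fun τ hτ N hNL => ?_⟩
    have hNL' : ∀ u ∈ N \ {t}, u ∈ L := fun u hu =>
      (List.mem_append.1 (hNL u hu.1)).resolve_right (by simpa using hu.2)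
    have hτL : (Sum.inl '' τ ∪ Sum.inr '' (N \ {t}) : Set (ι ⊕ T)) ⊆ cutIndices s L :=
      union_subset_union (image_mono hτ) (image_mono fun u hu => hNL' u hu)
    have hsub : (Sum.inl '' σ t : Set (ι ⊕ T)) ⊆ Sum.inl '' τ ∪ Sum.inr '' (N \ {t}) ↔ σ t ⊆ τ := by
      constructor
      · intro h1 i hi
        simpa using h1 ⟨i, hi, rfl⟩
      · exact fun h1 => (image_mono h1).trans subset_union_left
    have hnot : ∀ w, ¬ [t, w].Sublist (L ++ [t]) := fun w hw => by
      rcases pair_sublist_append_singleton.1 hw with hw | hw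
      · exact hnd.1 (hw.subset (by simp))
      · exact hnd.1 hw.1
    -- If t ∈ N, the last truncation reduces N to N \ {t} and enlarges τ by σ t. Otherwise it only
    -- adds the condition σ t ⊄ τ.
    by_cases htN : t ∈ N
    · have key := hsL.nonempty_tightFace_insert_insert hσL hτL htr
      have h1 : (tightFace A (Sum.elim a h) (insert (Sum.inr t) (cutIndices s L))
          (Sum.inl '' τ ∪ Sum.inr '' N)).Nonempty ↔
          ∃ x ∈ tightFace A (Sum.elim a h) (cutIndices s L)
            (Sum.inl '' τ ∪ Sum.inr '' (N \ {t})), (h t).1 x = (h t).2 := by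
        refine exists_congr fun x => ?_
        rw [tightFace_insert, mem_ofPred_eq, mem_tightFace_cutIndices, mem_tightFace_cutIndices]
        constructor
        · rintro ⟨⟨h1, h2, h3⟩, h4⟩
          exact ⟨⟨h1, h2, fun u hu => h3 u hu.1⟩, h3 t htN⟩
        · rintro ⟨⟨h1, h2, h3⟩, h4⟩
          refine ⟨⟨h1, h2, fun u hu => ?_⟩, h4.le⟩
          by_cases hut : u = t
          · exact hut ▸ h4
          · exact h3 u ⟨hu, hut⟩
      have h2 : (Sum.inl '' τ ∪ Sum.inr '' (N \ {t}) ∪ Sum.inl '' σ t : Set (ι ⊕ T)) =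
          Sum.inl '' (τ ∪ σ t) ∪ Sum.inr '' (N \ {t}) := by
        rw [image_union, union_right_comm]
      have h3 : τ ∪ σ t ∪ {i | ∃ u ∈ N \ {t}, i ∈ σ u} = τ ∪ {i | ∃ u ∈ N, i ∈ σ u} := by
        ext i
        constructor
        · rintro ((hi | hi) | ⟨u, hu, hi⟩)
          exacts [.inl hi, .inr ⟨t, htN, hi⟩, .inr ⟨u, hu.1, hi⟩]
        · rintro (hi | ⟨u, hu, hi⟩)
          · exact .inl (.inl hi)
          · by_cases hut : u = t
            · exact .inl (.inr (hut ▸ hi))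
            · exact .inr ⟨u, ⟨hu, hut⟩, hi⟩
      rw [h1]
      refine key.trans ?_
      rw [hsub, h2, hN _ (union_subset hτ (hσ t htL)) _ hNL', h3, Set.not_subset]
      constructor
      · rintro ⟨⟨i, hi, hiτ⟩, hne, hall⟩
        refine ⟨hne, fun u hu => ?_⟩
        rcases List.mem_append.1 hu with hu | hu
        · obtain ⟨j, hj, hjτ, hjN⟩ := hall u hu
          refine ⟨j, hj, fun h => hjτ (.inl h), fun w hw huw hjw => ?_⟩
          rcases pair_sublist_append_singleton.1 huw with huw | ⟨-, rfl⟩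
          · by_cases hwt : w = t
            · exact hjτ (.inr (hwt ▸ hjw))
            · exact hjN w ⟨hw, hwt⟩ huw hjw
          · exact hjτ (.inr hjw)
        · obtain rfl := List.mem_singleton.1 hu
          exact ⟨i, hi, hiτ, fun w _ huw => absurd huw (hnot w)⟩
      · rintro ⟨hne, hall⟩
        obtain ⟨i, hi, hiτ, -⟩ := hall t htL
        refine ⟨⟨i, hi, hiτ⟩, hne, fun u hu => ?_⟩
        obtain ⟨j, hj, hjτ, hjN⟩ := hall u (hmem u hu)
        refine ⟨j, hj, ?_, fun w hw huw =>
          hjN w hw.1 (pair_sublist_append_singleton.2 (.inl huw))⟩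
        rintro (h | h)
        exacts [hjτ h, hjN t htN (pair_sublist_append_singleton.2 (.inr ⟨hu, rfl⟩)) h]
    · have key := hsL.nonempty_tightFace_insert hσL hτL htr
      have h1 : (tightFace A (Sum.elim a h) (insert (Sum.inr t) (cutIndices s L))
          (Sum.inl '' τ ∪ Sum.inr '' N)).Nonempty ↔
          ∃ x ∈ tightFace A (Sum.elim a h) (cutIndices s L)
            (Sum.inl '' τ ∪ Sum.inr '' (N \ {t})), (h t).1 x ≤ (h t).2 := by
        rw [tightFace_insert, sdiff_singleton_eq_self htN]
        rfl
      rw [h1]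
      refine key.trans ?_
      rw [hsub, hN _ hτ _ hNL', sdiff_singleton_eq_self htN, Set.not_subset]
      have hiff : ∀ u, ∀ w ∈ N, [u, w].Sublist (L ++ [t]) ↔ [u, w].Sublist L := fun u w hw => by
        rw [pair_sublist_append_singleton]
        exact or_iff_left fun h => htN (h.2 ▸ hw)
      constructor
      · rintro ⟨⟨i, hi, hiτ⟩, hne, hall⟩
        refine ⟨hne, fun u hu => ?_⟩
        rcases List.mem_append.1 hu with hu | hu
        · obtain ⟨j, hj, hjτ, hjN⟩ := hall u hu
          exact ⟨j, hj, hjτ, fun w hw huw => hjN w hw ((hiff u w hw).1 huw)⟩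
        · obtain rfl := List.mem_singleton.1 hu
          exact ⟨i, hi, hiτ, fun w _ huw => absurd huw (hnot w)⟩
      · rintro ⟨hne, hall⟩
        obtain ⟨i, hi, hiτ, -⟩ := hall t htL
        refine ⟨⟨i, hi, hiτ⟩, hne, fun u hu => ?_⟩
        obtain ⟨j, hj, hjτ, hjN⟩ := hall u (hmem u hu)
        exact ⟨j, hj, hjτ, fun w hw huw => hjN w hw ((hiff u w hw).2 huw)⟩

lemma cut_congr {P : Set E} {h' : T → StrongDual ℝ E × ℝ} (hh : ∀ t ∈ L, h' t = h t) :
    cut P h' L = cut P h L := by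
  ext x
  refine and_congr_right fun _ => forall₂_congr fun t ht => by rw [hh t ht]

lemma IsTruncationSequence.congr {P : Set E} {h' : T → StrongDual ℝ E × ℝ}
    (hseq : IsTruncationSequence P face h L) (hh : ∀ t ∈ L, h' t = h t) :
    IsTruncationSequence P face h' L := by
  intro L' t hp
  have hsub := hp.sublist.subset
  rw [cut_congr fun u hu => hh u (hsub (List.mem_append_left _ hu)), hh t (hsub (by simp))]
  exact hseq L' t hp

lemma IsTruncationSequence.append_singleton {P : Set E} {t : T}
    (hseq : IsTruncationSequence P face h L)
    (ht : IsTruncation (cut P h L) (face t ∩ cut P h L) (h t)) :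
    IsTruncationSequence P face h (L ++ [t]) := by
  intro L' u hp
  rcases List.prefix_concat_iff.1 hp with hp | hp
  · obtain ⟨rfl, hu⟩ := List.append_inj' hp rfl
    obtain rfl : u = t := by simpa using hu
    exact ht
  · exact hseq L' u hp

/-- Faces can be truncated one after the other if none of them lies in one that comes earlier. -/
theorem IsSimpleSystem.canTruncate (hs : IsSimpleSystem A a s) (hσ : ∀ t ∈ L, σ t ⊆ s)
    (hface : ∀ t ∈ L, ∀ x ∈ solutions A a s, x ∈ face t ↔ ∀ i ∈ σ t, (a i).1 x = (a i).2)
    (hL : L.Nodup) (hσne : ∀ t ∈ L, (σ t).Nonempty)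
    (hne : ∀ t ∈ L, (tightFace A a s (σ t)).Nonempty)
    (hord : L.Pairwise fun t u => ¬ σ t ⊆ σ u) : CanTruncate (solutions A a s) face L := by
  classical
  rintro h L₁ ⟨L₂, rfl⟩ hseq
  induction L₂ generalizing L₁ h with
  | nil => exact ⟨h, fun _ _ => rfl, by rwa [List.append_nil]⟩
  | cons t L₂ ih =>
    have hmem : ∀ u ∈ L₁, u ∈ L₁ ++ t :: L₂ := fun u hu => List.mem_append_left _ hu
    have htL : t ∈ L₁ ++ t :: L₂ := by simp
    have hnd := List.nodup_append.1 hL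
    have ht : t ∉ L₁ := fun h1 => hnd.2.2 t h1 t (by simp) rfl
    obtain ⟨hsL, hN⟩ := hs.truncationSequence (fun u hu => hσ u (hmem u hu))
      (fun u hu => hface u (hmem u hu)) hnd.1 hseq
    -- The criterion with τ = σ t and N = ∅: the face was nonempty at the start, and no earlier σ u
    -- is contained in σ t.
    have hne' : (tightFace A (Sum.elim a h) (cutIndices s L₁) (Sum.inl '' σ t)).Nonempty := by
      have := (hN (σ t) (hσ t htL) ∅ (by simp)).2 ⟨by simpa using hne t htL, fun u hu => by
        have := (List.pairwise_append.1 hord).2.2 u hu t (by simp)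
        obtain ⟨i, hi, hit⟩ := Set.not_subset.1 this
        exact ⟨i, hi, hit, by simp⟩⟩
      simpa using this
    obtain ⟨g, hg⟩ := hsL.exists_isTruncation
      ((image_mono (hσ t htL)).trans subset_union_left) ((hσne t htL).image _) hne'
    rw [← cut_solutions, ← face_inter_cut (hface t htL)] at hg
    have hup : ∀ u ∈ L₁, Function.update h t g u = h u := fun u hu =>
      Function.update_of_ne (ne_of_mem_of_not_mem hu ht) _ _
    have hassoc : L₁ ++ t :: L₂ = L₁ ++ [t] ++ L₂ := by simp
    rw [hassoc] at hσ hface hL hσne hne hord ⊢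
    obtain ⟨h', hh', hseq'⟩ := ih (L₁ := L₁ ++ [t]) (h := Function.update h t g) hσ hface hL hσne
      hne hord ((hseq.congr hup).append_singleton (by
        rw [cut_congr hup, Function.update_self]
        exact hg))
    exact ⟨h', fun u hu => (hh' u (List.mem_append_left _ hu)).trans (hup u hu), hseq'⟩

/-- Truncations preserve the recession directions. -/
lemma IsTruncationSequence.add_smul_mem {P : Set E} {d : E}
    (hseq : IsTruncationSequence P face h L) (hd : ∀ x ∈ P, ∀ c : ℝ, 0 ≤ c → x + c • d ∈ P) :
    ∀ x ∈ cut P h L, ∀ c : ℝ, 0 ≤ c → x + c • d ∈ cut P h L := by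
  induction L using List.reverseRecOn with
  | nil => simpa [cut] using hd
  | append_singleton L t ih =>
    have ih := ih hseq.of_append
    obtain ⟨-, -, b, -, hb, -, -⟩ := hseq L t List.prefix_rfl
    intro x hx c hc
    have hxL : x ∈ cut P h L := ⟨hx.1, fun u hu => hx.2 u (List.mem_append_left _ hu)⟩
    -- The cutting functional is bounded above on what is left, so it cannot increase along a ray.
    have hneg : (h t).1 d ≤ 0 := by
      by_contra! hpos
      obtain ⟨m, hm⟩ := exists_nat_gt ((b - (h t).1 x) / (h t).1 d)
      have h1 := hb _ (ih x hxL m m.cast_nonneg)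
      rw [div_lt_iff₀ hpos] at hm
      simp only [map_add, map_smul, smul_eq_mul] at h1
      linarith
    have h2 := ih x hxL c hc
    refine ⟨h2.1, fun u hu => ?_⟩
    rcases List.mem_append.1 hu with hu | hu
    · exact h2.2 u hu
    · obtain rfl : u = t := by simpa using hu
      have h3 := mul_nonpos_of_nonneg_of_nonpos hc hneg
      have h4 := hx.2 u (by simp)
      simp only [map_add, map_smul, smul_eq_mul]
      linarith

lemma IsPolyhedron.cut {P : Set E} (hP : IsPolyhedron P) : IsPolyhedron (cut P h L) := by
  classical
  obtain ⟨S, rfl⟩ := hP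
  refine ⟨S ∪ L.toFinset.image h, ?_⟩
  ext x
  simp only [Polyhedral.cut, Finset.mem_union, Finset.mem_image, List.mem_toFinset, mem_ofPred_eq]
  constructor
  · rintro ⟨h1, h2⟩ g (hg | ⟨t, ht, rfl⟩)
    exacts [h1 g hg, h2 t ht]
  · exact fun h1 => ⟨fun g hg => h1 g (.inl hg), fun t ht => h1 _ (.inr ⟨t, ht, rfl⟩)⟩

end Sequence

end Polyhedral

namespace Graph

open Set Polyhedral

/-! ### Polyhedra whose facets are labeled by tubes. -/

section

variable {α β ι E : Type*} [NormedAddCommGroup E] [NormedSpace ℝ E] [FiniteDimensional ℝ E]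
  {G : Graph α β} {A : AffineSubspace ℝ E} {a : ι → StrongDual ℝ E × ℝ} {s : Set ι}

/-- G is a component of itself and no tube, so the condition on components is automatic. -/
lemma IsConnected.isTubing_iff (hG : G.IsConnected) {T : Set (Graph α β)} :
    G.IsTubing T ↔ (∀ t ∈ T, G.IsTube t) ∧ T.Pairwise G.TubesCompatible := by
  refine ⟨fun h => ⟨h.1, h.2.1⟩, fun h => ⟨h.1, h.2, G, ⟨.rfl, hG⟩, fun hT => ?_⟩⟩
  exact lt_irrefl G (h.1 G hT).lt

/-- A simple polyhedron whose facets are labeled by the tubes of `G`, such that the facets of a set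
of tubes have a common point if and only if the tubes are pairwise compatible. -/
theorem IsPseudographAssociahedron.of_isSimpleSystem (hG : G.IsConnected)
    (hs : IsSimpleSystem A a s) {eff : Set ι} (heff : eff ⊆ s) {tube : ι → Graph α β}
    (hinj : InjOn tube eff) (htube : tube '' eff = {t | G.IsTube t})
    (hact : ∀ x ∈ solutions A a s, ∀ i ∈ s, (a i).1 x = (a i).2 → i ∈ eff)
    (hnerve : ∀ N ⊆ eff,
      ((tightFace A a s N).Nonempty ↔ (tube '' N).Pairwise G.TubesCompatible))
    (hP : IsPolyhedron (solutions A a s))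
    (hdim : Module.finrank ℝ A.direction + 1 = V(G).ncard + G.redundantEdges)
    (hbdd : Bornology.IsBounded (solutions A a s) ↔ G.Loopless) :
    G.IsPseudographAssociahedron (solutions A a s) := by
  have hne : (solutions A a s).Nonempty := by
    rw [← tightFace_empty, hnerve ∅ (empty_subset _), image_empty]
    exact pairwise_empty _
  -- The inequalities outside `eff` are not tight at any solution and do not contribute to faces.
  have hsub : ∀ F : Face (solutions A a s), tightSet a s F.1 ⊆ eff := by
    rintro ⟨F, ⟨x, hx⟩, hF⟩ i hi
    exact hact x (hF.subset hx) i hi.1 (hi.2 x hx)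
  have hFt : ∀ F : Face (solutions A a s), F.1 = tightFace A a s (tightSet a s F.1) :=
    fun F => hs.eq_tightFace F.2
  have htub : ∀ F : Face (solutions A a s), G.IsTubing (tube '' tightSet a s F.1) := by
    refine fun F => hG.isTubing_iff.2 ⟨fun t ht => ?_, (hnerve _ (hsub F)).1 (hFt F ▸ F.2.1)⟩
    have := image_mono (hsub F) ht
    rwa [htube] at this
  let f : Face (solutions A a s) → (G.Tubing)ᵒᵈ := fun F =>
    OrderDual.toDual ⟨tube '' tightSet a s F.1, htub F⟩
  have hf : ∀ F F', f F ≤ f F' ↔ F ≤ F' := by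
    intro F F'
    change tube '' tightSet a s F'.1 ⊆ tube '' tightSet a s F.1 ↔ F.1 ⊆ F'.1
    rw [hinj.image_subset_image_iff (hsub F') (hsub F)]
    constructor
    · intro h
      rw [hFt F, hFt F']
      exact fun x hx => ⟨hx.1, fun i hi => hx.2 i (h hi)⟩
    · exact fun h i hi => ⟨hi.1, fun x hx => hi.2 x (h hx)⟩
  have hsurj : Function.Surjective (OrderEmbedding.ofMapLEIff f hf) := by
    intro T
    obtain ⟨⟨T, hT⟩, rfl⟩ := OrderDual.toDual.surjective T
    obtain ⟨hT1, hT2⟩ := hG.isTubing_iff.1 hT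
    have himage : tube '' {i ∈ eff | tube i ∈ T} = T := by
      ext t
      constructor
      · rintro ⟨i, hi, rfl⟩
        exact hi.2
      · intro ht
        have : t ∈ tube '' eff := htube ▸ hT1 t ht
        obtain ⟨i, hi, rfl⟩ := this
        exact ⟨i, ⟨hi, ht⟩, rfl⟩
    have hN : {i ∈ eff | tube i ∈ T} ⊆ eff := fun i hi => hi.1
    have hne := (hnerve _ hN).2 (himage.symm ▸ hT2)
    refine ⟨⟨_, hs.isFace_tightFace (hN.trans heff) hne⟩, Subtype.ext ?_⟩
    change tube '' tightSet a s (tightFace A a s {i ∈ eff | tube i ∈ T}) = T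
    rw [hs.tightSet_tightFace (hN.trans heff) hne, himage]
  refine ⟨hP, by rw [hs.dim_solutions hne, hdim], hs.isSimple, hbdd,
    RelIso.ofSurjective _ hsurj, fun F => ?_⟩
  change dim F.1 + (tube '' tightSet a s F.1).ncard = _
  rw [(hinj.mono (hsub F)).ncard_image, hs.dim_solutions hne,
    ← hs.dim_tightFace (τ := tightSet a s F.1) (fun i hi => hi.1) (hFt F ▸ F.2.1), ← hFt F]

end

/-! ### Connected node sets and compatibility of full tubes. -/

section Tubes

variable {α β : Type*} {G s t : Graph α β} {X Y : Set α}

/-- The subgraph induced on `X` is nonempty and connected. -/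
def ConnectedOn (G : Graph α β) (X : Set α) : Prop :=
  X.Nonempty ∧ ∀ S ⊆ X, S.Nonempty → (∀ x ∈ S, ∀ y ∈ X, G.Adj x y → y ∈ S) → X ⊆ S

/-- Replaces walks by node sets closed under adjacency, the form in which connectedness is used
below. -/
lemma isConnected_iff : t.IsConnected ↔ t.ConnectedOn V(t) := by
  constructor
  · intro hc
    have hpre := hc.preconnected
    obtain ⟨v⟩ := hc.nonempty
    refine ⟨⟨v, v.2⟩, fun S hS ⟨x, hx⟩ hcl y hy => ?_⟩
    obtain ⟨p⟩ := hpre ⟨x, hS hx⟩ ⟨y, hy⟩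
    suffices ∀ (u w : V(t)), t.toSimpleGraph.Walk u w → (u : α) ∈ S → (w : α) ∈ S from
      this _ _ p hx
    intro u w p
    induction p with
    | nil => exact id
    | cons h _ ih => exact fun hu => ih (hcl _ hu _ (Subtype.coe_prop _) h.2)
  · rintro ⟨⟨v, hv⟩, h⟩
    have : Nonempty V(t) := ⟨⟨v, hv⟩⟩
    refine ⟨fun x y => ?_⟩
    have := h {z | ∃ hz : z ∈ V(t), t.toSimpleGraph.Reachable x ⟨z, hz⟩} (fun z hz => hz.1)
      ⟨x, x.2, .rfl⟩ (fun z ⟨hz, hxz⟩ w hw hzw => ⟨hw, ?_⟩)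
    · exact (this y.2).2
    · by_cases hne : z = w
      · exact hne ▸ hxz
      · exact hxz.trans (SimpleGraph.Adj.reachable ⟨fun h => hne (congrArg Subtype.val h), hzw⟩)

lemma ConnectedOn.congr {γ : Type*} {H : Graph α γ} (hX : G.ConnectedOn X)
    (h : ∀ x ∈ X, ∀ y ∈ X, x ≠ y → G.Adj x y → H.Adj x y) : H.ConnectedOn X := by
  refine ⟨hX.1, fun S hS hne hcl => hX.2 S hS hne fun x hx y hy hxy => ?_⟩
  by_cases hne : x = y
  · exact hne ▸ hx
  · exact hcl x hx y hy (h x (hS hx) y hy hne hxy)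

/-- Between distinct nodes, t has the same adjacencies as G, so its connectedness depends on its
node set alone. -/
lemma isConnected_iff_connectedOn (hle : t ≤ G)
    (hadj : ∀ x ∈ V(t), ∀ y ∈ V(t), x ≠ y → G.Adj x y → t.Adj x y) :
    t.IsConnected ↔ G.ConnectedOn V(t) := by
  rw [isConnected_iff]
  exact ⟨fun h => h.congr fun _ _ _ _ _ => Adj.mono hle, fun h => h.congr hadj⟩

lemma IsTube.connectedOn (ht : G.IsTube t) : G.ConnectedOn V(t) :=
  (isConnected_iff_connectedOn ht.lt.le ht.adj).1 ht.isConnected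

lemma IsTube.vertexSet_subset (ht : G.IsTube t) : V(t) ⊆ V(G) := ht.lt.le.vertexSet_mono

lemma IsTube.vertexSet_nonempty (ht : G.IsTube t) : V(t).Nonempty := ht.connectedOn.1

lemma induce_isInducedSubgraph (hX : X ⊆ V(G)) : G.induce X ≤i G :=
  ⟨induce_le hX, fun _ _ _ h hx hy => ⟨h, hx, hy⟩⟩

lemma eq_induce_of_isInducedSubgraph (h : t ≤i G) : t = G.induce V(t) :=
  Graph.ext rfl fun _ _ _ => ⟨fun hl => ⟨hl.mono h.le, hl.left_mem, hl.right_mem⟩,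
    fun hl => h.isLink_of_mem_mem hl.1 hl.2.1 hl.2.2⟩

lemma IsFullTube.eq_induce (ht : G.IsFullTube t) : t = G.induce V(t) :=
  eq_induce_of_isInducedSubgraph ht.2

lemma IsFullTube.ext (hs : G.IsFullTube s) (ht : G.IsFullTube t) (h : V(s) = V(t)) : s = t := by
  rw [hs.eq_induce, ht.eq_induce, h]

lemma IsFullTube.vertexSet_ne (ht : G.IsFullTube t) : V(t) ≠ V(G) := fun h =>
  ht.1.lt.ne (ht.2.ext_of_vertexSet h)

lemma ConnectedOn.isFullTube (hX : G.ConnectedOn X) (hsub : X ⊆ V(G)) (hne : X ≠ V(G)) :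
    G.IsFullTube (G.induce X) := by
  have hadj : ∀ x ∈ V(G.induce X), ∀ y ∈ V(G.induce X), x ≠ y → G.Adj x y →
      (G.induce X).Adj x y := fun x hx y hy _ ⟨e, he⟩ => ⟨e, he, hx, hy⟩
  refine ⟨⟨lt_of_le_of_ne (induce_le hsub) fun h => hne (congrArg vertexSet h), ?_, hadj⟩,
    induce_isInducedSubgraph hsub⟩
  exact (isConnected_iff_connectedOn (induce_le hsub) hadj).2 hX

lemma IsTube.isFullTube_induce (ht : G.IsTube t) (hne : V(t) ≠ V(G)) :
    G.IsFullTube (G.induce V(t)) :=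
  ht.connectedOn.isFullTube ht.vertexSet_subset hne

lemma ConnectedOn.union (hX : G.ConnectedOn X) (hY : G.ConnectedOn Y)
    (h : (∃ x ∈ X, x ∈ Y) ∨ ∃ x ∈ X, ∃ y ∈ Y, G.Adj x y) : G.ConnectedOn (X ∪ Y) := by
  refine ⟨hX.1.mono subset_union_left, fun S hS hne hcl => ?_⟩
  have hXS : (S ∩ X).Nonempty → X ⊆ S := fun hne => (hX.2 _ inter_subset_right hne
    fun x hx y hy hxy => ⟨hcl x hx.1 y (.inl hy) hxy, hy⟩).trans inter_subset_left
  have hYS : (S ∩ Y).Nonempty → Y ⊆ S := fun hne => (hY.2 _ inter_subset_right hne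
    fun x hx y hy hxy => ⟨hcl x hx.1 y (.inr hy) hxy, hy⟩).trans inter_subset_left
  have hXY : X ⊆ S → Y ⊆ S := fun hsub => by
    rcases h with ⟨x, hx, hy⟩ | ⟨x, hx, y, hy, hxy⟩
    exacts [hYS ⟨x, hsub hx, hy⟩, hYS ⟨y, hcl x (hsub hx) y (.inr hy) hxy, hy⟩]
  have hYX : Y ⊆ S → X ⊆ S := fun hsub => by
    rcases h with ⟨x, hx, hy⟩ | ⟨x, hx, y, hy, hxy⟩
    exacts [hXS ⟨x, hsub hy, hx⟩, hXS ⟨x, hcl y (hsub hy) x (.inl hx) hxy.symm, hx⟩]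
  obtain ⟨z, hz⟩ := hne
  rcases hS hz with hzX | hzY
  · have := hXS ⟨z, hz, hzX⟩
    exact union_subset this (hXY this)
  · have := hYS ⟨z, hz, hzY⟩
    exact union_subset (hYX this) this

/-- A connected set covered by pairwise compatible tubes is covered by one of them. -/
lemma ConnectedOn.exists_subset {N : Set (Graph α β)} (hX : G.ConnectedOn X) (hN : N.Finite)
    (hVfin : ∀ t ∈ N, V(t).Finite)
    (hcompat : N.Pairwise G.TubesCompatible) (hcov : ∀ x ∈ X, ∃ t ∈ N, x ∈ V(t)) :
    ∃ t ∈ N, X ⊆ V(t) := by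
  obtain ⟨x₀, hx₀⟩ := hX.1
  obtain ⟨t₀, ht₀, hxt₀⟩ := hcov x₀ hx₀
  -- Take a tube meeting X with as many nodes as possible. A tube containing a neighbour of one of
  -- its nodes is nested with it, so its trace on X is closed under adjacency in X.
  obtain ⟨t, ⟨htN, hne⟩, hmax⟩ := Set.exists_max_image {t ∈ N | (X ∩ V(t)).Nonempty}
    (fun t => V(t).ncard) (hN.subset fun t ht => ht.1) ⟨t₀, ht₀, x₀, hx₀, hxt₀⟩
  refine ⟨t, htN, (hX.2 _ inter_subset_left hne fun x hx y hy hxy => ⟨hy, ?_⟩).trans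
    inter_subset_right⟩
  obtain ⟨u, huN, hyu⟩ := hcov y hy
  by_cases htu : t = u
  · exact htu ▸ hyu
  rcases hcompat htN huN htu with h | h | h
  · have := Set.eq_of_subset_of_ncard_le h.le.vertexSet_mono (hmax u ⟨huN, y, hy, hyu⟩)
      (hVfin u huN)
    exact this ▸ hyu
  · exact h.le.vertexSet_mono hyu
  · exact absurd hxy (h.2 x hx.2 y hyu)

lemma TubesCompatible.symm (h : G.TubesCompatible s t) : G.TubesCompatible t s := by
  rcases h with h | h | ⟨h1, h2⟩
  · exact .inr (.inl h)
  · exact .inl h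
  · exact .inr (.inr ⟨h1.symm, fun x hx y hy hxy => h2 y hy x hx hxy.symm⟩)

lemma IsFullTube.le_iff (hs : G.IsTube s) (ht : G.IsFullTube t) : s ≤ t ↔ V(s) ⊆ V(t) :=
  ⟨fun h => h.vertexSet_mono, fun h => ht.2.le_of_le_subset hs.lt.le h⟩

/-- Two different full tubes are compatible unless their union is connected and larger than both. -/
lemma IsFullTube.connectedOn_union (hs : G.IsFullTube s) (ht : G.IsFullTube t)
    (hne : s ≠ t) (hst : ¬ G.TubesCompatible s t) :
    G.ConnectedOn (V(s) ∪ V(t)) ∧ ¬ V(s) ⊆ V(t) ∧ ¬ V(t) ⊆ V(s) := by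
  refine ⟨hs.1.connectedOn.union ht.1.connectedOn ?_, fun h => ?_, fun h => ?_⟩
  · by_contra! hcon
    exact hst (.inr (.inr ⟨Set.disjoint_left.2 hcon.1, hcon.2⟩))
  · exact hst (.inl (((IsFullTube.le_iff hs.1 ht).2 h).lt_of_ne hne))
  · exact hst (.inr (.inl (((IsFullTube.le_iff ht.1 hs).2 h).lt_of_ne hne.symm)))

/-- The sets of full tubes whose faces have a common point after the truncations in `L`. -/
theorem pairwise_tubesCompatible_iff_of_isFullTube (hG : G.IsConnected) (hV : V(G).Finite)
    {L : List (Graph α β)} (hL : L.Nodup) (hmem : ∀ t, t ∈ L ↔ G.IsFullTube t)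
    (hsort : L.Pairwise fun t u => V(u).ncard ≤ V(t).ncard) {N : Set (Graph α β)}
    (hN : ∀ t ∈ N, t ∈ L) :
    N.Pairwise G.TubesCompatible ↔ (∃ v ∈ V(G), ∀ t ∈ N, v ∉ V(t)) ∧
      ∀ t ∈ L, ∃ v ∈ V(t), ∀ u ∈ N, [t, u].Sublist L → v ∉ V(u) := by
  have hfull : ∀ t ∈ N, G.IsFullTube t := fun t ht => (hmem t).1 (hN t ht)
  have hNfin : N.Finite := (List.finite_toSet L).subset hN
  have hVfin : ∀ t ∈ N, V(t).Finite := fun t ht => hV.subset (hfull t ht).1.vertexSet_subset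
  have hcard : ∀ {t u}, [t, u].Sublist L → V(u).ncard ≤ V(t).ncard :=
    List.pairwise_iff_forall_sublist.1 hsort
  have hndp : ∀ {t u}, [t, u].Sublist L → t ≠ u := List.pairwise_iff_forall_sublist.1 hL
  constructor
  · intro hcompat
    constructor
    · by_contra! hcov
      obtain ⟨t, ht, hsub⟩ := (isConnected_iff.1 hG).exists_subset hNfin hVfin hcompat hcov
      exact (hfull t ht).vertexSet_ne ((hfull t ht).1.vertexSet_subset.antisymm hsub)
    · intro t ht
      by_contra! hcov
      have htf := (hmem t).1 ht
      -- If later tubes of N covered t, one of them would contain t; having no more nodes than t, it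
      -- would equal t.
      obtain ⟨u, ⟨huN, htu⟩, hsub⟩ := htf.1.connectedOn.exists_subset
        (N := {u ∈ N | [t, u].Sublist L}) (hNfin.subset fun u hu => hu.1)
        (fun u hu => hVfin u hu.1) (hcompat.mono fun u hu => hu.1)
        fun x hx => let ⟨u, h1, h2, h3⟩ := hcov x hx; ⟨u, ⟨h1, h2⟩, h3⟩
      exact hndp htu (htf.ext (hfull u huN)
        (Set.eq_of_subset_of_ncard_le hsub (hcard htu) (hVfin u huN)))
  · rintro ⟨⟨v, hvG, hv⟩, hall⟩ s hs t ht hst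
    by_contra hcon
    obtain ⟨hconn, h1, h2⟩ := (hfull s hs).connectedOn_union (hfull t ht) hst hcon
    have hsubV := union_subset (hfull s hs).1.vertexSet_subset (hfull t ht).1.vertexSet_subset
    -- The union misses v, so it carries a full tube. This tube has more nodes than s and t, hence
    -- precedes both, and they cover it.
    have hu := hconn.isFullTube hsubV fun h => by
      rcases (h ▸ hvG : v ∈ V(s) ∪ V(t)) with h | h
      exacts [hv s hs h, hv t ht h]
    have hfin : (V(s) ∪ V(t)).Finite := hV.subset hsubV
    have huL := (hmem _).2 hu
    have after : ∀ w ∈ N, V(w) ⊂ V(s) ∪ V(t) → [G.induce (V(s) ∪ V(t)), w].Sublist L := by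
      intro w hw hlt
      refine (pair_sublist_or huL (hN w hw) fun h =>
        hlt.ne (congrArg vertexSet h).symm).resolve_right
        fun h => (Set.ncard_lt_ncard hlt hfin).not_ge (hcard h)
    obtain ⟨x, hx, hxN⟩ := hall _ huL
    rcases hx with hx | hx
    · exact hxN s hs (after s hs ⟨subset_union_left, fun h => h2 (subset_union_right.trans h)⟩) hx
    · exact hxN t ht (after t ht ⟨subset_union_right, fun h => h1 (subset_union_left.trans h)⟩) hx

end Tubes

/-! ### Edge labels and compatibility with non-full tubes. -/

section Labels

variable {α β : Type*} {G s t : Graph α β}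

lemma exists_isBundle [Finite E(G)] {e : β} {x y : α} (h : G.IsLink e x y) (hxy : x ≠ y) :
    ∃ B : Finset E(G), G.IsBundle B ∧ ∀ f : E(G), f ∈ B ↔ G.IsLink f x y := by
  classical
  have := Fintype.ofFinite E(G)
  exact ⟨Finset.univ.filter fun f : E(G) => G.IsLink f x y,
    ⟨⟨⟨e, h.edge_mem⟩, by simpa using h⟩, x, y, hxy, by simp⟩, by simp⟩

lemma mem_edgeSet_induce_iff {e : β} {x y : α} {X : Set α} (hxy : G.IsLink e x y) :
    e ∈ E(G.induce X) ↔ x ∈ X ∧ y ∈ X := by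
  rw [edgeSet_induce]
  constructor
  · rintro ⟨x', y', h, hx, hy⟩
    rcases h.eq_and_eq_or_eq_and_eq hxy with ⟨rfl, rfl⟩ | ⟨rfl, rfl⟩
    exacts [⟨hx, hy⟩, ⟨hy, hx⟩]
  · exact fun h => ⟨x, y, hxy, h.1, h.2⟩

/-- A tube contains an edge between any two of its adjacent nodes, so a bundle has an edge in t
exactly when both its end nodes are in t. -/
lemma IsTube.notMem_labelEdges_iff [Finite E(G)] (ht : G.IsTube t) {e : E(G)} :
    e ∉ G.labelEdges t ↔ (e : β) ∉ E(t) ∧ (e : β) ∈ E(G.induce V(t)) := by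
  obtain ⟨x, y, hxy⟩ := exists_isLink_of_mem_edgeSet e.2
  simp only [labelEdges, mem_ofPred_eq, not_or, not_exists, not_and, mem_edgeSet_induce_iff hxy]
  refine and_congr_right fun het => ?_
  by_cases hne : x = y
  · subst hne
    constructor
    · rintro ⟨-, h⟩
      have := not_not.1 (h x hxy)
      exact ⟨this, this⟩
    · rintro ⟨h, -⟩
      refine ⟨fun B hB heB => ?_, fun z hz => ?_⟩
      · obtain ⟨-, u, v, huv, hB⟩ := hB
        rcases ((hB e).1 heB).eq_and_eq_or_eq_and_eq hxy with ⟨rfl, rfl⟩ | ⟨rfl, rfl⟩ <;>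
          exact absurd rfl huv
      · rcases IsLink.eq_and_eq_or_eq_and_eq hz hxy with ⟨rfl, -⟩ | ⟨rfl, -⟩ <;> exact not_not.2 h
  · constructor
    · rintro ⟨h, -⟩
      obtain ⟨B, hB, hBm⟩ := exists_isBundle hxy hne
      have := h B hB ((hBm e).2 hxy)
      push Not at this
      obtain ⟨f, hfB, hft⟩ := this
      have := (ht.lt.le.isLink_iff hft).2 ((hBm f).1 hfB)
      exact ⟨this.left_mem, this.right_mem⟩
    · rintro ⟨hx, hy⟩
      refine ⟨fun B hB heB => ?_, fun z hz => ?_⟩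
      · obtain ⟨-, u, v, huv, hB⟩ := hB
        have hadj : t.Adj u v := by
          rcases ((hB e).1 heB).eq_and_eq_or_eq_and_eq hxy with ⟨rfl, rfl⟩ | ⟨rfl, rfl⟩
          · exact ht.adj _ hx _ hy hne ⟨e, hxy⟩
          · exact ht.adj _ hy _ hx huv ⟨e, hxy.symm⟩
        obtain ⟨f, hf⟩ := hadj
        have hfG := hf.mono ht.lt.le
        exact fun hcon => hcon ⟨f, hfG.edge_mem⟩ ((hB _).2 hfG) hf.edge_mem
      · exfalso
        rcases IsLink.eq_and_eq_or_eq_and_eq hz hxy with ⟨rfl, rfl⟩ | ⟨rfl, rfl⟩ <;> exact hne rfl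

lemma IsFullTube.labelEdges_eq [Finite E(G)] (ht : G.IsFullTube t) : G.labelEdges t = univ := by
  refine eq_univ_of_forall fun e => ?_
  by_contra h
  rw [ht.1.notMem_labelEdges_iff, ← ht.eq_induce] at h
  exact h.1 h.2

lemma IsTube.le_of_edgeSet_subset (hs : G.IsTube s) (ht : G.IsTube t) (hV : V(s) ⊆ V(t))
    (hE : E(s) ⊆ E(t)) : s ≤ t :=
  (Compatible.of_le_le hs.lt.le ht.lt.le).le_iff.2 ⟨hV, hE⟩

lemma edgeSet_subset_induce (h : t ≤ G) : E(t) ⊆ E(G.induce V(t)) := fun _ he =>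
  let ⟨x, y, hxy⟩ := exists_isLink_of_mem_edgeSet he
  ⟨x, y, hxy.mono h, hxy.left_mem, hxy.right_mem⟩

lemma edgeSet_induce_mono {X Y : Set α} (h : X ⊆ Y) : E(G.induce X) ⊆ E(G.induce Y) :=
  fun _ ⟨x, y, hl, hx, hy⟩ => ⟨x, y, hl, h hx, h hy⟩

lemma numElements_lt_of_lt (hV : V(t).Finite) (hE : E(t).Finite) (h : s < t) :
    s.numElements < t.numElements := by
  have h1 := Set.ncard_le_ncard h.le.vertexSet_mono hV
  have h2 := Set.ncard_le_ncard h.le.edgeSet_mono hE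
  unfold numElements
  rcases vertexSet_ssubset_or_edgeSet_ssubset_of_lt h with h3 | h3
  · have := Set.ncard_lt_ncard h3 hV
    omega
  · have := Set.ncard_lt_ncard h3 hE
    omega

lemma IsTube.mem_edgeSet_of_mem_labelEdges [Finite E(G)] (ht : G.IsTube t) {e : E(G)}
    (he : e ∈ G.labelEdges t) (hV : (e : β) ∈ E(G.induce V(t))) : (e : β) ∈ E(t) := by
  by_contra h
  exact ht.notMem_labelEdges_iff.2 ⟨h, hV⟩ he

/-- The edges of two tubes with nested node sets have a tube in common. -/
lemma IsTube.isTube_restrict (hs : G.IsTube s)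
    (hadj : ∀ x ∈ V(s), ∀ y ∈ V(s), x ≠ y → G.Adj x y →
      ∃ e, G.IsLink e x y ∧ e ∈ E(s) ∧ e ∈ E(t)) : G.IsTube (s.restrict E(t)) := by
  have hle : s.restrict E(t) ≤ s := restrict_le
  have hadj' : ∀ x ∈ V(s.restrict E(t)), ∀ y ∈ V(s.restrict E(t)), x ≠ y → G.Adj x y →
      (s.restrict E(t)).Adj x y := fun x hx y hy hne hxy =>
    let ⟨e, he, hes, het⟩ := hadj x hx y hy hne hxy
    ⟨e, het, (hs.lt.le.isLink_iff hes).2 he⟩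
  exact ⟨hle.trans_lt hs.lt, (isConnected_iff_connectedOn (hle.trans hs.lt.le) hadj').2
    hs.connectedOn, hadj'⟩

/-- Compatible tubes have nested or separated node sets, and for full tubes this is all that
compatibility requires. -/
lemma pairwise_induce_of_pairwise {N M : Set (Graph α β)}
    (hN : ∀ t ∈ N, G.IsFullTube t) (hM : ∀ t ∈ M, G.IsTube t)
    (h : (N ∪ M).Pairwise G.TubesCompatible) :
    (N ∪ {u | ∃ t ∈ M, V(t) ≠ V(G) ∧ G.induce V(t) = u}).Pairwise G.TubesCompatible := by
  have key : ∀ p ∈ N ∪ {u | ∃ t ∈ M, V(t) ≠ V(G) ∧ G.induce V(t) = u},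
      G.IsFullTube p ∧ ∃ t ∈ N ∪ M, V(t) = V(p) := by
    rintro p (hp | ⟨t, ht, hV, rfl⟩)
    · exact ⟨hN p hp, p, .inl hp, rfl⟩
    · exact ⟨(hM t ht).isFullTube_induce hV, t, .inr ht, rfl⟩
  intro p hp q hq hne
  obtain ⟨hpf, s, hs, hsp⟩ := key p hp
  obtain ⟨hqf, t, ht, htq⟩ := key q hq
  have hst : s ≠ t := fun hst => hne (hpf.ext hqf (by rw [← hsp, ← htq, hst]))
  rcases h hs ht hst with h | h | h
  · refine .inl (((IsFullTube.le_iff hpf.1 hqf).2 ?_).lt_of_ne hne)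
    rw [← hsp, ← htq]
    exact h.le.vertexSet_mono
  · refine .inr (.inl (((IsFullTube.le_iff hqf.1 hpf).2 ?_).lt_of_ne hne.symm))
    rw [← hsp, ← htq]
    exact h.le.vertexSet_mono
  · rw [hsp, htq] at h
    exact .inr (.inr h)

section NonFull

variable [Finite E(G)] {L : List (Graph α β)} {N M : Set (Graph α β)}

/-- The tubes of M containing both ends of B are pairwise nested. An edge of B in the smallest one
is in all of them, and the other tubes impose nothing on B. -/
lemma exists_mem_bundle_of_pairwise (hV : V(G).Finite) (hM : ∀ t ∈ M, G.IsTube t)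
    (h : M.Pairwise G.TubesCompatible) {B : Finset E(G)} (hB : G.IsBundle B) :
    ∃ e ∈ B, ∀ t ∈ M, e ∈ G.labelEdges t := by
  obtain ⟨⟨e₀, he₀⟩, x, y, hxy, hB⟩ := hB
  have hmem : ∀ e ∈ B, ∀ t ∈ M, e ∉ G.labelEdges t → (e : β) ∉ E(t) ∧ x ∈ V(t) ∧ y ∈ V(t) :=
    fun e he t ht hel => by
      rwa [(hM t ht).notMem_labelEdges_iff, mem_edgeSet_induce_iff ((hB e).1 he)] at hel
  by_cases hne : {t ∈ M | x ∈ V(t) ∧ y ∈ V(t)}.Nonempty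
  · obtain ⟨_, ⟨t, ⟨htM, hx, hy⟩, rfl⟩, hmin⟩ := WellFounded.has_min Nat.lt_wfRel.wf _
      (hne.image numElements)
    obtain ⟨f, hf⟩ := (hM t htM).adj x hx y hy hxy ⟨e₀, (hB e₀).1 he₀⟩
    have hfG := hf.mono (hM t htM).lt.le
    have hfB : ⟨f, hfG.edge_mem⟩ ∈ B := (hB _).2 hfG
    refine ⟨⟨f, hfG.edge_mem⟩, hfB, fun u hu => ?_⟩
    by_contra hfl
    obtain ⟨hfu, hxu, hyu⟩ := hmem _ hfB u hu hfl
    have htu : t ≠ u := fun h => hfu (h ▸ hf.edge_mem)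
    rcases h htM hu htu with h | h | h
    · exact hfu (h.le.edgeSet_mono hf.edge_mem)
    · exact hmin _ ⟨u, ⟨hu, hxu, hyu⟩, rfl⟩ (numElements_lt_of_lt
        (hV.subset (hM t htM).vertexSet_subset)
        ((Set.toFinite E(G)).subset (hM t htM).lt.le.edgeSet_mono) h)
    · exact Set.disjoint_left.1 h.1 hx hxu
  · refine ⟨e₀, he₀, fun t ht => ?_⟩
    by_contra hel
    exact hne ⟨t, ht, (hmem e₀ he₀ t ht hel).2⟩

/-- Otherwise everything tight on the face of t comes from N or from later tubes of M. Consider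
these later tubes with nodes in V(t), and the induced subgraph on V(t) if it is in N or equals G. A
smallest one is contained in t, against the order of the list or the non-fullness of t. -/
lemma exists_face_of_pairwise (hV : V(G).Finite) (hL : L.Nodup)
    (hmem : ∀ t, t ∈ L ↔ G.IsTube t ∧ ¬ G.IsFullTube t)
    (hsort : L.Pairwise fun t u => t.numElements ≤ u.numElements)
    (hN : ∀ t ∈ N, G.IsFullTube t) (hM : ∀ t ∈ M, t ∈ L)
    (h : (N ∪ M).Pairwise G.TubesCompatible) (ht : t ∈ L) :
    (V(t) ≠ V(G) ∧ G.induce V(t) ∉ N ∧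
      ∀ u ∈ M, [t, u].Sublist L → ¬ (V(u) ≠ V(G) ∧ G.induce V(u) = G.induce V(t))) ∨
    ∃ e ∉ G.labelEdges t, ∀ u ∈ M, [t, u].Sublist L → e ∈ G.labelEdges u := by
  by_contra! hcon
  obtain ⟨h1, h2⟩ := hcon
  obtain ⟨htt, htf⟩ := (hmem t).1 ht
  have hMt : ∀ t ∈ M, G.IsTube t := fun t ht => ((hmem t).1 (hM t ht)).1
  -- the tubes after `t` in `M`, and the full tube on the nodes of `t`
  set R : Set (Graph α β) := {r | V(r) ⊆ V(t) ∧ r ≤ G ∧ ((r ∈ M ∧ [t, r].Sublist L) ∨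
    (V(r) = V(t) ∧ r ≤i G ∧ (r ∈ N ∨ r = G)))} with hR
  have hRne : R.Nonempty := by
    by_cases hVt : V(t) = V(G)
    · exact ⟨G, hVt.ge, le_rfl, .inr ⟨hVt.symm, .rfl, .inr rfl⟩⟩
    have hfull := htt.isFullTube_induce hVt
    by_cases htN : G.induce V(t) ∈ N
    · exact ⟨G.induce V(t), Subset.rfl, hfull.1.lt.le, .inr ⟨rfl, hfull.2, .inl htN⟩⟩
    · obtain ⟨u, huM, htu, huV, hueq⟩ := h1 hVt htN
      exact ⟨u, (congrArg vertexSet hueq).subset, (hMt u huM).lt.le, .inl ⟨huM, htu⟩⟩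
  obtain ⟨_, ⟨r, hrR, rfl⟩, hmin⟩ := WellFounded.has_min Nat.lt_wfRel.wf _
    (hRne.image numElements)
  obtain ⟨hrV, hrG, hr⟩ := hrR
  have hcomp : ∀ s ∈ M, s = r ∨ G.TubesCompatible s r := by
    intro s hs
    rcases hr with ⟨hrM, -⟩ | ⟨-, -, hrN | rfl⟩
    · exact or_iff_not_imp_left.2 (h (.inr hs) (.inr hrM))
    · exact or_iff_not_imp_left.2 (h (.inr hs) (.inl hrN))
    · exact .inr (.inl (hMt s hs).lt)
  -- An edge of r that t lacks is also lacking in a later s ∈ M which contains its ends.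
  -- Compatibility of s and r then leaves only s < r, against minimality.
  have hE : E(r) ⊆ E(t) := by
    intro e he
    by_contra het
    obtain ⟨x, y, hxy⟩ := exists_isLink_of_mem_edgeSet he
    have hxyG := hxy.mono hrG
    obtain ⟨s, hsM, hts, hes⟩ := h2 ⟨e, hxyG.edge_mem⟩ (htt.notMem_labelEdges_iff.2
      ⟨het, (mem_edgeSet_induce_iff hxyG).2 ⟨hrV hxy.left_mem, hrV hxy.right_mem⟩⟩)
    rw [(hMt s hsM).notMem_labelEdges_iff, mem_edgeSet_induce_iff hxyG] at hes
    obtain ⟨hes, hxs, -⟩ := hes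
    rcases hcomp s hsM with rfl | hlt | hlt | hdisj
    · exact hes he
    · exact hmin _ ⟨s, ⟨hlt.le.vertexSet_mono.trans hrV, (hMt s hsM).lt.le, .inl ⟨hsM, hts⟩⟩, rfl⟩
        (numElements_lt_of_lt (hV.subset hrG.vertexSet_mono)
          ((Set.toFinite E(G)).subset hrG.edgeSet_mono) hlt)
    · exact hes (hlt.le.edgeSet_mono he)
    · exact Set.disjoint_left.1 hdisj.1 hxs hxy.left_mem
  have hrt : r ≤ t := (Compatible.of_le_le hrG htt.lt.le).le_iff.2 ⟨hrV, hE⟩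
  rcases hr with ⟨hrM, htr⟩ | ⟨hVr, hri, -⟩
  · have h3 : t ≠ r := List.pairwise_iff_forall_sublist.1 hL htr
    have h4 : t.numElements ≤ r.numElements := List.pairwise_iff_forall_sublist.1 hsort htr
    exact h4.not_gt (numElements_lt_of_lt (hV.subset htt.vertexSet_subset)
      ((Set.toFinite E(G)).subset htt.lt.le.edgeSet_mono) (hrt.lt_of_ne h3.symm))
  · have : t = r := (hri.le_of_le_subset htt.lt.le hVr.ge).antisymm hrt
    exact htf ⟨htt, this ▸ hri⟩

/-- If s and t are incompatible, the bundle condition makes their intersection `s.restrict E(t)` a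
tube. It is not full and is smaller than both, so it precedes those of them that are in M. But all
that is tight on its face comes from s or t, which `hface` excludes. -/
lemma tubesCompatible_of_vertexSet_subset (hV : V(G).Finite)
    (hmem : ∀ t, t ∈ L ↔ G.IsTube t ∧ ¬ G.IsFullTube t)
    (hsort : L.Pairwise fun t u => t.numElements ≤ u.numElements)
    (hN : ∀ t ∈ N, G.IsFullTube t) (hM : ∀ t ∈ M, t ∈ L)
    (hbundle : ∀ B : Finset E(G), G.IsBundle B → ∃ e ∈ B, ∀ t ∈ M, e ∈ G.labelEdges t)
    (hface : ∀ t ∈ L, (V(t) ≠ V(G) ∧ G.induce V(t) ∉ N ∧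
      ∀ u ∈ M, [t, u].Sublist L → ¬ (V(u) ≠ V(G) ∧ G.induce V(u) = G.induce V(t))) ∨
      ∃ e ∉ G.labelEdges t, ∀ u ∈ M, [t, u].Sublist L → e ∈ G.labelEdges u)
    (hs : s ∈ N ∪ M) (ht : t ∈ N ∪ M) (hne : s ≠ t) (hst : V(s) ⊆ V(t)) :
    G.TubesCompatible s t := by
  by_contra hcon
  have htube : ∀ t ∈ N ∪ M, G.IsTube t := fun t ht =>
    ht.elim (fun h => (hN t h).1) fun h => ((hmem t).1 (hM t h)).1
  have hst' : ¬ s ≤ t := fun h => hcon (.inl (h.lt_of_ne hne))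
  have hts' : ¬ t ≤ s := fun h => hcon (.inr (.inl (h.lt_of_ne hne.symm)))
  have htM : t ∈ M := ht.resolve_left fun h =>
    hst' ((IsFullTube.le_iff (htube s hs) (hN t h)).2 hst)
  have hlab : ∀ u ∈ N ∪ M, ∀ e : E(G), (u ∈ M → e ∈ G.labelEdges u) →
      (e : β) ∈ E(G.induce V(u)) → (e : β) ∈ E(u) := by
    rintro u (hu | hu) e he hV
    · rw [(hN u hu).eq_induce]
      exact hV
    · exact (htube u (.inr hu)).mem_edgeSet_of_mem_labelEdges (he hu) hV
  have hr : G.IsTube (s.restrict E(t)) := by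
    refine (htube s hs).isTube_restrict fun x hx y hy hxy ⟨e, he⟩ => ?_
    obtain ⟨B, hB, hBm⟩ := exists_isBundle he hxy
    obtain ⟨f, hfB, hf⟩ := hbundle B hB
    have hfl := (hBm f).1 hfB
    exact ⟨f, hfl, hlab s hs f (hf s) ((mem_edgeSet_induce_iff hfl).2 ⟨hx, hy⟩),
      hlab t ht f (hf t) ((mem_edgeSet_induce_iff hfl).2 ⟨hst hx, hst hy⟩)⟩
  obtain ⟨e, hes, het⟩ : ∃ e ∈ E(s), e ∉ E(t) := Set.not_subset.1 fun h =>
    hst' ((htube s hs).le_of_edgeSet_subset (htube t ht) hst h)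
  have hrL : s.restrict E(t) ∈ L := by
    refine (hmem _).2 ⟨hr, fun hfull => het ?_⟩
    obtain ⟨x, y, hxy⟩ := exists_isLink_of_mem_edgeSet hes
    exact (hfull.2.isLink_of_mem_mem (hxy.mono (htube s hs).lt.le) hxy.left_mem
      hxy.right_mem).1
  have after : ∀ u ∈ M, s.restrict E(t) < u → [s.restrict E(t), u].Sublist L := by
    intro u hu hlt
    refine (pair_sublist_or hrL (hM u hu) hlt.ne).resolve_right fun h => ?_
    exact (numElements_lt_of_lt (hV.subset (htube u (.inr hu)).vertexSet_subset)
      ((Set.toFinite E(G)).subset (htube u (.inr hu)).lt.le.edgeSet_mono) hlt).not_ge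
      (List.pairwise_iff_forall_sublist.1 hsort h)
  have hrs : s.restrict E(t) < s := by
    refine restrict_le.lt_of_ne fun h => het ?_
    rw [← h] at hes
    exact hes.2
  have hrt : s.restrict E(t) < t := by
    refine (hr.le_of_edgeSet_subset (htube t ht) hst fun e he => he.2).lt_of_ne fun h => hts' ?_
    exact h.symm.trans_le restrict_le
  rcases hface _ hrL with ⟨hVr, hrN, hrM⟩ | ⟨f, hf, hfM⟩
  · rcases hs with hsN | hsM
    · exact hrN ((hN s hsN).eq_induce ▸ hsN)
    · exact hrM s hsM (after s hsM hrs) ⟨hVr, rfl⟩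
  · rw [hr.notMem_labelEdges_iff] at hf
    have hfs : (f : β) ∈ E(s) := hlab s hs f (fun hsM => hfM s hsM (after s hsM hrs)) hf.2
    have hft : (f : β) ∈ E(t) := hlab t ht f (fun htM => hfM t htM (after t htM hrt))
      (edgeSet_induce_mono hst hf.2)
    exact hf.1 ⟨hfs, hft⟩

/-- The sets of full and non-full tubes whose faces have a common point after the truncations. -/
theorem pairwise_tubesCompatible_union_iff (hV : V(G).Finite) (hL : L.Nodup)
    (hmem : ∀ t, t ∈ L ↔ G.IsTube t ∧ ¬ G.IsFullTube t)
    (hsort : L.Pairwise fun t u => t.numElements ≤ u.numElements)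
    (hN : ∀ t ∈ N, G.IsFullTube t) (hM : ∀ t ∈ M, t ∈ L) :
    (N ∪ M).Pairwise G.TubesCompatible ↔
      ((N ∪ {u | ∃ t ∈ M, V(t) ≠ V(G) ∧ G.induce V(t) = u}).Pairwise G.TubesCompatible ∧
        ∀ B : Finset E(G), G.IsBundle B → ∃ e ∈ B, ∀ t ∈ M, e ∈ G.labelEdges t) ∧
      ∀ t ∈ L, (V(t) ≠ V(G) ∧ G.induce V(t) ∉ N ∧
        ∀ u ∈ M, [t, u].Sublist L → ¬ (V(u) ≠ V(G) ∧ G.induce V(u) = G.induce V(t))) ∨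
        ∃ e ∉ G.labelEdges t, ∀ u ∈ M, [t, u].Sublist L → e ∈ G.labelEdges u := by
  have hMt : ∀ t ∈ M, G.IsTube t := fun t ht => ((hmem t).1 (hM t ht)).1
  constructor
  · exact fun h => ⟨⟨pairwise_induce_of_pairwise hN hMt h, fun B hB =>
      exists_mem_bundle_of_pairwise hV hMt (h.mono subset_union_right) hB⟩,
      fun t ht => exists_face_of_pairwise hV hL hmem hsort hN hM h ht⟩
  · rintro ⟨⟨hbar, hbundle⟩, hface⟩ s hs t ht hne
    by_cases hst : V(s) ⊆ V(t)
    · exact tubesCompatible_of_vertexSet_subset hV hmem hsort hN hM hbundle hface hs ht hne hst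
    by_cases hts : V(t) ⊆ V(s)
    · exact (tubesCompatible_of_vertexSet_subset hV hmem hsort hN hM hbundle hface ht hs hne.symm
        hts).symm
    have htube : ∀ t ∈ N ∪ M, G.IsTube t := fun t ht => ht.elim (fun h => (hN t h).1) (hMt t)
    have hmemb : ∀ u ∈ N ∪ M, V(u) ≠ V(G) →
        G.induce V(u) ∈ N ∪ {u | ∃ t ∈ M, V(t) ≠ V(G) ∧ G.induce V(t) = u} := by
      rintro u (hu | hu) hne
      · exact .inl ((hN u hu).eq_induce ▸ hu)
      · exact .inr ⟨u, hu, hne, rfl⟩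
    -- Since the node sets are not nested, neither tube has all nodes, and the induced full tubes
    -- must be separated.
    have hsV : V(s) ≠ V(G) := fun h => hts (h ▸ (htube t ht).vertexSet_subset)
    have htV : V(t) ≠ V(G) := fun h => hst (h ▸ (htube s hs).vertexSet_subset)
    rcases hbar (hmemb s hs hsV) (hmemb t ht htV) fun h => hst (congrArg vertexSet h).subset
      with h | h | h
    · exact absurd h.le.vertexSet_mono hst
    · exact absurd h.le.vertexSet_mono hts
    · exact .inr (.inr h)

end NonFull

end Labels

end Graph

namespace Polyhedral

open Set

/-! ### Products of simplices and rays as simple systems. -/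

section Blocks

variable {E X : Type*} [NormedAddCommGroup E] [NormedSpace ℝ E]
  {φ : E ≃L[ℝ] (X → ℝ)} {𝓑 : Set (Finset X)}

/-- The points whose coordinates have sum one on each of the blocks in `𝓑`. -/
def blockSubspace (φ : E ≃L[ℝ] (X → ℝ)) (𝓑 : Set (Finset X)) : AffineSubspace ℝ E where
  carrier := {x | ∀ B ∈ 𝓑, ∑ i ∈ B, φ x i = 1}
  smul_vsub_vadd_mem' c p q r hp hq hr B hB := by
    simp only [vsub_eq_sub, vadd_eq_add, map_add, map_smul, map_sub, Pi.add_apply, Pi.smul_apply,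
      Pi.sub_apply, smul_eq_mul, Finset.sum_add_distrib, ← Finset.mul_sum, Finset.sum_sub_distrib,
      hp B hB, hq B hB, hr B hB]
    ring

/-- The inequality saying that a coordinate is nonnegative. -/
def coordIneq (φ : E ≃L[ℝ] (X → ℝ)) (i : X) : StrongDual ℝ E × ℝ :=
  (-((ContinuousLinearMap.proj i : (X → ℝ) →L[ℝ] ℝ).comp (φ : E →L[ℝ] (X → ℝ))), 0)

lemma mem_blockSubspace {x : E} : x ∈ blockSubspace φ 𝓑 ↔ ∀ B ∈ 𝓑, ∑ i ∈ B, φ x i = 1 := Iff.rfl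

@[simp] lemma coordIneq_fst_apply (i : X) (x : E) : (coordIneq φ i).1 x = -φ x i := rfl

@[simp] lemma coordIneq_snd (i : X) : (coordIneq φ i).2 = 0 := rfl

lemma mem_solutions_coordIneq {x : E} :
    x ∈ solutions (blockSubspace φ 𝓑) (coordIneq φ) univ ↔
      (∀ B ∈ 𝓑, ∑ i ∈ B, φ x i = 1) ∧ ∀ i, 0 ≤ φ x i := by
  simp [solutions, mem_blockSubspace]

lemma isPolyhedron_coordIneq [Fintype X] :
    IsPolyhedron (solutions (blockSubspace φ 𝓑) (coordIneq φ) univ) := by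
  classical
  let f : Finset X → StrongDual ℝ E := fun B =>
    ∑ i ∈ B, (ContinuousLinearMap.proj i : (X → ℝ) →L[ℝ] ℝ).comp (φ : E →L[ℝ] (X → ℝ))
  have hf : ∀ B x, f B x = ∑ i ∈ B, φ x i := fun B x => by simp [f, sum_apply]
  have h𝓑 : 𝓑.Finite := Set.toFinite 𝓑
  refine ⟨h𝓑.toFinset.image (fun B => (f B, 1)) ∪ h𝓑.toFinset.image (fun B => (-f B, -1)) ∪
    Finset.univ.image (coordIneq φ), ?_⟩
  ext x
  rw [mem_solutions_coordIneq]
  simp only [Finset.mem_union, Finset.mem_image, Finite.mem_toFinset, Finset.mem_univ, true_and,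
    mem_ofPred_eq]
  constructor
  · rintro ⟨h1, h2⟩ a ((⟨B, hB, rfl⟩ | ⟨B, hB, rfl⟩) | ⟨i, rfl⟩)
    · exact ((hf B x).trans (h1 B hB)).le
    · exact (congrArg Neg.neg ((hf B x).trans (h1 B hB))).le
    · simpa using h2 i
  · intro h
    refine ⟨fun B hB => ?_, fun i => by simpa using h _ (.inr ⟨i, rfl⟩)⟩
    have h1 : f B x ≤ 1 := h (f B, 1) (.inl (.inl ⟨B, hB, rfl⟩))
    have h2 : -f B x ≤ -1 := h (-f B, -1) (.inl (.inr ⟨B, hB, rfl⟩))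
    rw [hf] at h1 h2
    linarith

lemma mem_direction_blockSubspace {x d : E} (hx : x ∈ blockSubspace φ 𝓑) :
    d ∈ (blockSubspace φ 𝓑).direction ↔ ∀ B ∈ 𝓑, ∑ i ∈ B, φ d i = 0 := by
  constructor
  · intro hd B hB
    have h1 := mem_blockSubspace.1 (add_mem_of_mem_direction hx hd) B hB
    have h2 := mem_blockSubspace.1 hx B hB
    simp only [map_add, Pi.add_apply, Finset.sum_add_distrib] at h1
    linarith
  · intro hd
    have : x + d ∈ blockSubspace φ 𝓑 := mem_blockSubspace.2 fun B hB => by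
      simp only [map_add, Pi.add_apply, Finset.sum_add_distrib, hd B hB, add_zero]
      exact mem_blockSubspace.1 hx B hB
    simpa using sub_mem_direction this hx

lemma exists_ne_zero_of_mem_solutions {x : E}
    (hx : x ∈ solutions (blockSubspace φ 𝓑) (coordIneq φ) univ) {B : Finset X} (hB : B ∈ 𝓑) :
    ∃ i ∈ B, φ x i ≠ 0 := by
  by_contra! h
  have := (mem_solutions_coordIneq.1 hx).1 B hB
  rw [Finset.sum_eq_zero h] at this
  exact zero_ne_one this

/-- If coordinate i vanishes at x, its block has a nonvanishing coordinate k, and the direction e_i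
- e_k respects the block sums and leaves the other vanishing coordinates alone. A coordinate in no
block can be moved by itself. -/
lemma isSimpleSystem_coordIneq [Fintype X]
    (h𝓑 : ∀ B ∈ 𝓑, ∀ B' ∈ 𝓑, ∀ i ∈ B, i ∈ B' → B = B') :
    IsSimpleSystem (blockSubspace φ 𝓑) (coordIneq φ) univ where
  finite := Set.toFinite _
  pointed d _ h := by
    have : φ d = 0 := funext fun i => by simpa using h i (mem_univ i)
    simpa using this
  dual x hx i _ hix := by
    classical
    have hix : φ x i = 0 := by simpa using hix
    by_cases hi : ∃ B ∈ 𝓑, i ∈ B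
    · obtain ⟨B, hB, hiB⟩ := hi
      obtain ⟨k, hkB, hk⟩ := exists_ne_zero_of_mem_solutions hx hB
      have hik : i ≠ k := fun h => hk (h ▸ hix)
      refine ⟨φ.symm (Pi.single i 1 - Pi.single k 1),
        (mem_direction_blockSubspace hx.1).2 fun B' hB' => ?_, by simp [hik],
        fun j _ hjx hji => ?_⟩
      · have hiff : i ∈ B' ↔ k ∈ B' := ⟨fun h => h𝓑 B hB B' hB' i hiB h ▸ hkB,
          fun h => h𝓑 B hB B' hB' k hkB h ▸ hiB⟩
        simp [Finset.sum_sub_distrib, Pi.single_apply, hiff]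
      · have hjx : φ x j = 0 := by simpa using hjx
        have hjk : j ≠ k := fun h => hk (h ▸ hjx)
        simp [hji, hjk]
    · refine ⟨φ.symm (Pi.single i 1), (mem_direction_blockSubspace hx.1).2 fun B' hB' => ?_,
        by simp, fun j _ _ hji => by simp [hji]⟩
      have : i ∉ B' := fun h => hi ⟨B', hB', h⟩
      simp [Pi.single_apply, this]

/-- A set of coordinates which has exactly one element in each block. -/
def IsTransversal (𝓑 : Set (Finset X)) (R : Set X) : Prop :=
  (∀ B ∈ 𝓑, ∃ i ∈ B, i ∈ R ∧ ∀ j ∈ B, j ∈ R → j = i) ∧ ∀ i ∈ R, ∃ B ∈ 𝓑, i ∈ B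

/-- The point with coordinates one in `R` and zero outside. -/
noncomputable def indicatorPoint (φ : E ≃L[ℝ] (X → ℝ)) (R : Set X) : E :=
  φ.symm (R.indicator 1)

lemma apply_indicatorPoint (R : Set X) (i : X) :
    φ (indicatorPoint φ R) i = R.indicator 1 i := by
  simp [indicatorPoint]

lemma exists_isTransversal (h𝓑 : ∀ B ∈ 𝓑, ∀ B' ∈ 𝓑, ∀ i ∈ B, i ∈ B' → B = B')
    {τ : Set X} (hτ : ∀ B ∈ 𝓑, ∃ i ∈ B, i ∉ τ) :
    ∃ R, IsTransversal 𝓑 R ∧ ∀ i ∈ R, i ∉ τ := by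
  choose r hrB hrτ using hτ
  refine ⟨{i | ∃ B, ∃ hB : B ∈ 𝓑, r B hB = i}, ⟨fun B hB => ⟨r B hB, hrB B hB, ⟨B, hB, rfl⟩, ?_⟩,
    ?_⟩, ?_⟩
  · rintro _ hj ⟨B', hB', rfl⟩
    obtain rfl := h𝓑 B hB B' hB' _ hj (hrB B' hB')
    rfl
  · rintro _ ⟨B, hB, rfl⟩
    exact ⟨B, hB, hrB B hB⟩
  · rintro _ ⟨B, hB, rfl⟩
    exact hrτ B hB

lemma IsTransversal.indicatorPoint_mem {R : Set X} (hR : IsTransversal 𝓑 R) :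
    indicatorPoint φ R ∈ solutions (blockSubspace φ 𝓑) (coordIneq φ) univ := by
  classical
  refine mem_solutions_coordIneq.2 ⟨fun B hB => ?_, fun i => ?_⟩
  · obtain ⟨i, hiB, hiR, huniq⟩ := hR.1 B hB
    rw [Finset.sum_eq_single_of_mem i hiB fun j hj hji => by
      rw [apply_indicatorPoint, indicator_of_notMem fun h => hji (huniq j hj h)],
      apply_indicatorPoint, indicator_of_mem hiR, Pi.one_apply]
  · rw [apply_indicatorPoint]
    exact indicator_nonneg (fun _ _ => zero_le_one) i

lemma IsTransversal.tight_iff {R : Set X} (i : X) :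
    (coordIneq φ i).1 (indicatorPoint φ R) = (coordIneq φ i).2 ↔ i ∉ R := by
  rw [coordIneq_fst_apply, coordIneq_snd, neg_eq_zero, apply_indicatorPoint]
  by_cases h : i ∈ R <;> simp [h]

lemma IsTransversal.indicatorPoint_mem_extremePoints {R : Set X} (hR : IsTransversal 𝓑 R) :
    indicatorPoint φ R ∈
      (solutions (blockSubspace φ 𝓑) (coordIneq φ) univ).extremePoints ℝ := by
  have hmem := hR.indicatorPoint_mem (φ := φ)
  refine mem_extremePoints_of_forall_direction hmem fun d hd h => ?_
  have h0 : ∀ i ∉ R, φ d i = 0 := fun i hi => by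
    simpa using h i (mem_univ i) ((IsTransversal.tight_iff i).2 hi)
  have : φ d = 0 := funext fun i => by
    by_cases hi : i ∈ R
    · obtain ⟨B, hB, hiB⟩ := hR.2 i hi
      obtain ⟨k, hkB, hkR, huniq⟩ := hR.1 B hB
      obtain rfl := huniq i hiB hi
      have := (mem_direction_blockSubspace hmem.1).1 hd B hB
      rwa [Finset.sum_eq_single_of_mem i hiB fun j hj hji =>
        h0 j fun hjR => hji (huniq j hj hjR)] at this
    · exact h0 i hi
  simpa using this

/-- Choosing a coordinate outside τ in each block gives a vertex of the face. -/
lemma nonempty_tightFace_coordIneq (h𝓑 : ∀ B ∈ 𝓑, ∀ B' ∈ 𝓑, ∀ i ∈ B, i ∈ B' → B = B')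
    {τ : Set X} :
    (tightFace (blockSubspace φ 𝓑) (coordIneq φ) univ τ).Nonempty ↔ ∀ B ∈ 𝓑, ∃ i ∈ B, i ∉ τ := by
  constructor
  · rintro ⟨x, hx, hxτ⟩ B hB
    obtain ⟨i, hi, hix⟩ := exists_ne_zero_of_mem_solutions hx hB
    exact ⟨i, hi, fun h => hix (by simpa using hxτ i h)⟩
  · intro h
    obtain ⟨R, hR, hRτ⟩ := exists_isTransversal h𝓑 h
    exact ⟨indicatorPoint φ R, hR.indicatorPoint_mem, fun i hi =>
      (IsTransversal.tight_iff i).2 fun hiR => hRτ i hiR hi⟩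

/-- The dimension is the number of inequalities tight at a vertex; at the vertex of R these are the
coordinates outside R. -/
lemma finrank_direction_blockSubspace [Fintype X]
    (h𝓑 : ∀ B ∈ 𝓑, ∀ B' ∈ 𝓑, ∀ i ∈ B, i ∈ B' → B = B') {R : Set X} (hR : IsTransversal 𝓑 R) :
    Module.finrank ℝ (blockSubspace φ 𝓑).direction = Rᶜ.ncard := by
  have : FiniteDimensional ℝ E := φ.symm.toLinearEquiv.finiteDimensional
  rw [← (isSimpleSystem_coordIneq h𝓑).ncard_tight_of_mem_extremePoints
    hR.indicatorPoint_mem_extremePoints]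
  congr 1
  ext i
  rw [mem_ofPred_eq, IsTransversal.tight_iff]
  simp

end Blocks

/-! ### Truncations of a product along faces of one factor. -/

section Product

variable {E₁ E₂ T : Type*} [NormedAddCommGroup E₁] [NormedSpace ℝ E₁] [NormedAddCommGroup E₂]
  [NormedSpace ℝ E₂]

/-- The inequality on the first factor obtained by fixing the second component. -/
def sliceIneq (h : T → StrongDual ℝ (E₁ × E₂) × ℝ) (y₀ : E₂) (t : T) : StrongDual ℝ E₁ × ℝ :=
  ((h t).1.comp (ContinuousLinearMap.inl ℝ E₁ E₂), (h t).2 - (h t).1 (0, y₀))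

lemma sliceIneq_fst_apply (h : T → StrongDual ℝ (E₁ × E₂) × ℝ) (y₀ : E₂) (t : T) (x : E₁) :
    (sliceIneq h y₀ t).1 x = (h t).1 (x, y₀) - (h t).1 (0, y₀) := by
  rw [← map_sub]
  simp [sliceIneq]

/-- Truncations of a product along faces which come from the first factor. -/
lemma IsTruncationSequence.slice {S : Set E₁} {B : Set E₂} {face : T → Set (E₁ × E₂)}
    {face' : T → Set E₁} {h : T → StrongDual ℝ (E₁ × E₂) × ℝ} {L : List T} {y₀ : E₂}
    (hy₀ : y₀ ∈ B.extremePoints ℝ)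
    (hface : ∀ t ∈ L, ∀ x ∈ S, ∀ y ∈ B, (x, y) ∈ face t ↔ x ∈ face' t)
    (hseq : IsTruncationSequence (S ×ˢ B) face h L) :
    cut (S ×ˢ B) h L = cut S (sliceIneq h y₀) L ×ˢ B ∧
      IsTruncationSequence S face' (sliceIneq h y₀) L := by
  have hy₀B : y₀ ∈ B := extremePoints_subset hy₀
  induction L using List.reverseRecOn with
  | nil => exact ⟨by ext; simp [cut], fun L' t hp => by simp at hp⟩
  | append_singleton L t ih =>
    obtain ⟨hcut, hseq'⟩ := ih (fun u hu => hface u (List.mem_append_left _ hu)) hseq.of_append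
    have htr := hseq L t List.prefix_rfl
    set Q := cut S (sliceIneq h y₀) L with hQ
    have hQS : Q ⊆ S := cut_subset
    have hF : face t ∩ Q ×ˢ B = (face' t ∩ Q) ×ˢ B := by
      ext ⟨x, y⟩
      simp only [mem_inter_iff, mem_prod]
      constructor
      · exact fun ⟨h1, h2, h3⟩ => ⟨⟨(hface t (by simp) x (hQS h2) y h3).1 h1, h2⟩, h3⟩
      · exact fun ⟨⟨h1, h2⟩, h3⟩ => ⟨(hface t (by simp) x (hQS h2) y h3).2 h1, h2, h3⟩
    rw [hcut, hF] at htr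
    obtain ⟨⟨⟨x₁, y₁⟩, hx₁, -⟩, hneP, c, hc, hle, hFc, hv⟩ := htr
    have hmemF : ∀ x ∈ Q, ∀ y ∈ B, x ∈ face' t ↔ (h t).1 (x, y) = c := by
      intro x hx y hy
      have : (x, y) ∈ (face' t ∩ Q) ×ˢ B ↔ (x, y) ∈ {p ∈ Q ×ˢ B | (h t).1 p = c} := by rw [← hFc]
      simpa [hx, hy] using this
    -- The functional has the value c on {x₁} × B, so it does not vary along B.
    have hconst : ∀ y ∈ B, (h t).1 (0, y) = (h t).1 (0, y₀) := by
      intro y hy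
      have h1 := (hmemF x₁ hx₁.2 y hy).1 hx₁.1
      have h2 := (hmemF x₁ hx₁.2 y₀ hy₀B).1 hx₁.1
      have h3 : ∀ z : E₂, ((0 : E₁), z) = (x₁, z) - (x₁, 0) := fun z => by simp
      rw [h3 y, h3 y₀, map_sub, map_sub, h1, h2]
    have hval : ∀ x : E₁, ∀ y ∈ B, (h t).1 (x, y) ≤ (h t).2 ↔
        (sliceIneq h y₀ t).1 x ≤ (sliceIneq h y₀ t).2 := by
      intro x y hy
      have h1 : (x, y) = (x, y₀) + ((0, y) - (0, y₀)) := by simp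
      rw [h1, map_add, map_sub, hconst y hy, sub_self, add_zero, sliceIneq_fst_apply]
      exact (sub_le_sub_iff_right _).symm
    constructor
    · ext ⟨x, y⟩
      have h1 : (x, y) ∈ cut (S ×ˢ B) h (L ++ [t]) ↔
          (x, y) ∈ cut (S ×ˢ B) h L ∧ (h t).1 (x, y) ≤ (h t).2 := by
        simp only [cut, mem_ofPred_eq, List.forall_mem_append, List.forall_mem_singleton, and_assoc]
      have h2 : x ∈ cut S (sliceIneq h y₀) (L ++ [t]) ↔
          x ∈ Q ∧ (sliceIneq h y₀ t).1 x ≤ (sliceIneq h y₀ t).2 := by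
        simp only [hQ, cut, mem_ofPred_eq, List.forall_mem_append, List.forall_mem_singleton,
          and_assoc]
      rw [h1, hcut, mem_prod, mem_prod, h2]
      constructor
      · exact fun ⟨⟨h3, h4⟩, h5⟩ => ⟨⟨h3, (hval x y h4).1 h5⟩, h4⟩
      · exact fun ⟨⟨h3, h5⟩, h4⟩ => ⟨⟨h3, h4⟩, (hval x y h4).2 h5⟩
    · refine hseq'.append_singleton ⟨⟨x₁, hx₁⟩, fun h => hneP (by rw [h]), c - (h t).1 (0, y₀),
        sub_lt_sub_right hc _, fun x hx => ?_, ?_, fun v hvQ hvF => ?_⟩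
      · rw [sliceIneq_fst_apply]
        exact sub_le_sub_right (hle (x, y₀) ⟨hx, hy₀B⟩) _
      · ext x
        simp only [mem_inter_iff, mem_ofPred_eq, sliceIneq_fst_apply, sub_left_inj]
        constructor
        · exact fun ⟨h1, h2⟩ => ⟨h2, (hmemF x h2 y₀ hy₀B).1 h1⟩
        · exact fun ⟨h2, h1⟩ => ⟨(hmemF x h2 y₀ hy₀B).2 h1, h2⟩
      · rw [sliceIneq_fst_apply]
        -- Here y₀ has to be a vertex of B: then (v, y₀) is a vertex of the product.
        refine sub_lt_sub_right (hv (v, y₀) ?_ fun h => hvF h.1) _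
        rw [extremePoints_prod]
        exact ⟨hvQ, hy₀⟩

end Product

end Polyhedral

namespace Graph

open Set Polyhedral

/-! ### The base polyhedron: coordinates, dimension, and faces of full tubes. -/

section Base

variable {α β : Type*} {G s t : Graph α β}

lemma IsBundle.eq_of_mem {B B' : Finset E(G)} (hB : G.IsBundle B) (hB' : G.IsBundle B') {e : E(G)}
    (he : e ∈ B) (he' : e ∈ B') : B = B' := by
  obtain ⟨-, x, y, -, hB⟩ := hB
  obtain ⟨-, x', y', -, hB'⟩ := hB'
  ext f
  rw [hB, hB']
  rcases ((hB e).1 he).eq_and_eq_or_eq_and_eq ((hB' e).1 he') with ⟨rfl, rfl⟩ | ⟨rfl, rfl⟩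
  · rfl
  · exact isLink_comm

lemma exists_isLoopAt_or_isBundle [Finite E(G)] (e : E(G)) :
    (∃ x, G.IsLoopAt e x) ∨ ∃ B : Finset E(G), G.IsBundle B ∧ e ∈ B := by
  obtain ⟨x, y, hxy⟩ := exists_isLink_of_mem_edgeSet e.2
  by_cases hne : x = y
  · exact .inl ⟨x, by rwa [← hne] at hxy⟩
  · obtain ⟨B, hB, hBm⟩ := exists_isBundle hxy hne
    exact .inr ⟨B, hB, (hBm e).2 hxy⟩

lemma IsBundle.not_isLoopAt {B : Finset E(G)} (hB : G.IsBundle B) {e : E(G)} (he : e ∈ B) (z : α) :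
    ¬ G.IsLoopAt e z := by
  obtain ⟨-, x, y, hne, hB⟩ := hB
  intro hz
  rcases ((hB e).1 he).eq_and_eq_or_eq_and_eq hz with ⟨rfl, rfl⟩ | ⟨rfl, rfl⟩ <;> exact hne rfl

/-- Removing the fewest edges that make `G` simple leaves one edge of each bundle and no loop. -/
lemma exists_removal [Finite E(G)] :
    ∃ D ⊆ E(G), D.ncard = G.redundantEdges ∧ (∀ (e : E(G)) x, G.IsLoopAt e x → (e : β) ∈ D) ∧
      ∀ B : Finset E(G), G.IsBundle B →
        ∃ e ∈ B, (e : β) ∉ D ∧ ∀ f ∈ B, (f : β) ∉ D → f = e := by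
  have hne : {k | ∃ D : Set β, D ⊆ E(G) ∧ D.ncard = k ∧ (G.deleteEdges D).Simple}.Nonempty := by
    refine ⟨_, E(G), Subset.rfl, rfl, @Simple.mk _ _ _ ⟨fun e x h => ?_⟩ fun e f x y h => ?_⟩
    · exact (deleteEdges_isLoopAt.1 h).2 (deleteEdges_isLoopAt.1 h).1.edge_mem
    · have := h.edge_mem
      simp at this
  obtain ⟨D, hDE, hcard, hsimple⟩ := Nat.sInf_mem hne
  have hlink : ∀ {e x y}, G.IsLink e x y → e ∉ D → (G.deleteEdges D).IsLink e x y :=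
    fun h he => by simpa using ⟨h, he⟩
  have hloop : ∀ (e : E(G)) x, G.IsLoopAt e x → (e : β) ∈ D := fun e x h => by
    by_contra he
    exact hsimple.not_isLoopAt e x (hlink h he)
  refine ⟨D, hDE, hcard, hloop, fun B hB => ?_⟩
  obtain ⟨⟨e₀, he₀⟩, x, y, hxy, hBm⟩ := id hB
  obtain ⟨e, heB, heD⟩ : ∃ e ∈ B, (e : β) ∉ D := by
    by_contra! hall
    -- If D contained the whole bundle, e₀ could be put back, and fewer removed edges would suffice.
    refine (Set.ncard_sdiff_singleton_lt_of_mem (hall e₀ he₀)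
      ((Set.toFinite E(G)).subset hDE)).not_ge ?_
    rw [hcard]
    refine Nat.sInf_le ⟨D \ {(e₀ : β)}, sdiff_subset.trans hDE, rfl,
      @Simple.mk _ _ _ ⟨fun e z h => ?_⟩ fun e f u v he hf => ?_⟩
    · rw [deleteEdges_isLoopAt] at h
      refine h.2 ⟨hloop ⟨e, h.1.edge_mem⟩ z h.1, ?_⟩
      rintro rfl
      exact hB.not_isLoopAt he₀ z h.1
    · simp only [deleteEdges_isLink] at he hf
      have key : ∀ {e}, G.IsLink e u v → e ∉ D \ {(e₀ : β)} → G.IsLink e₀ u v → e = e₀ := by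
        intro e he heD he₀l
        by_contra hee
        have heB : ⟨e, he.edge_mem⟩ ∈ B := by
          rw [hBm]
          rcases he₀l.eq_and_eq_or_eq_and_eq ((hBm e₀).1 he₀) with ⟨rfl, rfl⟩ | ⟨rfl, rfl⟩
          exacts [he, he.symm]
        exact heD ⟨hall _ heB, hee⟩
      by_cases h1 : e = e₀
      · subst h1
        exact (key hf.1 hf.2 he.1).symm
      by_cases h2 : f = e₀
      · subst h2
        exact key he.1 he.2 hf.1
      · have h3 : e ∉ D := fun h => he.2 ⟨h, h1⟩
        have h4 : f ∉ D := fun h => hf.2 ⟨h, h2⟩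
        exact hsimple.eq_of_isLink (hlink he.1 h3) (hlink hf.1 h4)
  exact ⟨e, heB, heD, fun f hfB hfD => Subtype.ext (hsimple.eq_of_isLink
    (hlink ((hBm f).1 hfB) hfD) (hlink ((hBm e).1 heB) heD))⟩

/-- The node and edge coordinates. -/
noncomputable def coordEquiv (G : Graph α β) :
    ((V(G) → ℝ) × (E(G) → ℝ)) ≃L[ℝ] (V(G) ⊕ E(G) → ℝ) :=
  (ContinuousLinearEquiv.sumPiEquivProdPi ℝ V(G) E(G) fun _ => ℝ).symm

@[simp] lemma coordEquiv_inl (p : (V(G) → ℝ) × (E(G) → ℝ)) (v : V(G)) :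
    G.coordEquiv p (.inl v) = p.1 v := rfl

@[simp] lemma coordEquiv_inr (p : (V(G) → ℝ) × (E(G) → ℝ)) (e : E(G)) :
    G.coordEquiv p (.inr e) = p.2 e := rfl

/-- The node coordinates that vanish on the face of a full tube. -/
def nodeSet (G t : Graph α β) : Set V(G) := {v | (v : α) ∈ V(t)}

lemma ncard_nodeSet (ht : G.IsTube t) : (G.nodeSet t).ncard = V(t).ncard := by
  rw [← Subtype.val_injective.injOn.ncard_image]
  congr 1
  ext x
  exact ⟨fun ⟨v, hv, h⟩ => h ▸ hv, fun hx => ⟨⟨x, ht.vertexSet_subset hx⟩, hx, rfl⟩⟩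

lemma nodeSet_subset_iff (ht : G.IsTube t) : G.nodeSet t ⊆ G.nodeSet s ↔ V(t) ⊆ V(s) :=
  ⟨fun h x hx => @h ⟨x, ht.vertexSet_subset hx⟩ hx, fun h _ hv => h hv⟩

lemma IsFullTube.exists_notMem_nodeSet (ht : G.IsFullTube t) : ∃ v, v ∉ G.nodeSet t := by
  by_contra! h
  exact ht.vertexSet_ne (ht.1.vertexSet_subset.antisymm fun x hx => h ⟨x, hx⟩)

variable [Fintype V(G)]

/-- The set of all nodes, and the bundles. -/
def blocks (G : Graph α β) [Fintype V(G)] : Set (Finset (V(G) ⊕ E(G))) :=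
  insert (Finset.univ.map .inl) ((fun B => B.map .inr) '' {B | G.IsBundle B})

lemma forall_mem_blocks {p : Finset (V(G) ⊕ E(G)) → Prop} :
    (∀ B ∈ G.blocks, p B) ↔ p (Finset.univ.map .inl) ∧ ∀ B, G.IsBundle B → p (B.map .inr) := by
  simp [blocks]

lemma blocks_disjoint : ∀ B ∈ G.blocks, ∀ B' ∈ G.blocks, ∀ i ∈ B, i ∈ B' → B = B' := by
  simp only [forall_mem_blocks]
  refine ⟨⟨fun _ _ _ => trivial, fun B hB i hi hi' => ?_⟩, fun B hB => ⟨fun i hi hi' => ?_,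
    fun B' hB' i hi hi' => ?_⟩⟩
  · simp only [Finset.mem_map] at hi hi'
    obtain ⟨_, -, rfl⟩ := hi
    obtain ⟨_, -, h⟩ := hi'
    cases h
  · simp only [Finset.mem_map] at hi hi'
    obtain ⟨_, -, rfl⟩ := hi
    obtain ⟨_, -, h⟩ := hi'
    cases h
  · simp only [Finset.mem_map] at hi hi'
    obtain ⟨e, he, rfl⟩ := hi
    obtain ⟨e', he', h⟩ := hi'
    obtain rfl : e' = e := Sum.inr_injective h
    rw [hB.eq_of_mem hB' he he']

/-- Supplies the order hypothesis of `IsSimpleSystem.canTruncate` for the first round. -/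
lemma pairwise_not_nodeSet_subset {L : List (Graph α β)} (hL : L.Nodup)
    (hfull : ∀ t ∈ L, G.IsFullTube t) (hsort : L.Pairwise fun s t => V(t).ncard ≤ V(s).ncard) :
    L.Pairwise fun s t => ¬ G.nodeSet s ⊆ G.nodeSet t := by
  refine (hL.and hsort).imp_of_mem fun {s t} hs ht h hsub => h.1 ?_
  rw [nodeSet_subset_iff (hfull s hs).1] at hsub
  exact (hfull s hs).ext (hfull t ht) (Set.eq_of_subset_of_ncard_le hsub h.2
    ((Set.toFinite V(G)).subset (hfull t ht).1.vertexSet_subset))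

variable [Fintype E(G)]

/-- Each edge is a loop or lies in a bundle, so the factors together require every coordinate to be
nonnegative. -/
lemma solutions_blocks :
    solutions (blockSubspace G.coordEquiv G.blocks) (coordIneq G.coordEquiv) univ =
      G.basePolyhedron := by
  ext p
  rw [mem_solutions_coordIneq, forall_mem_blocks]
  simp only [Finset.sum_map, Function.Embedding.inl_apply, Function.Embedding.inr_apply,
    coordEquiv_inl, coordEquiv_inr, Sum.forall, basePolyhedron, mem_prod, stdSimplex,
    bundlesAndRays, mem_ofPred_eq]
  constructor
  · rintro ⟨⟨h1, h2⟩, h3, h4⟩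
    refine ⟨⟨h3, h1⟩, fun B hB => ⟨fun e => h4 e, ?_⟩, fun e _ _ => h4 e⟩
    rw [← h2 B hB, ← Finset.sum_coe_sort B]
  · rintro ⟨⟨h3, h1⟩, h2, h4⟩
    refine ⟨⟨h1, fun B hB => ?_⟩, h3, fun e => ?_⟩
    · rw [← (h2 B hB).2, ← Finset.sum_coe_sort B]
    · rcases exists_isLoopAt_or_isBundle e with ⟨x, hx⟩ | ⟨B, hB, he⟩
      exacts [h4 e x hx, (h2 B hB).1 ⟨e, he⟩]

lemma isSimpleSystem_blocks :
    IsSimpleSystem (blockSubspace G.coordEquiv G.blocks) (coordIneq G.coordEquiv) univ :=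
  isSimpleSystem_coordIneq blocks_disjoint

lemma nonempty_tightFace_blocks {τ : Set (V(G) ⊕ E(G))} :
    (tightFace (blockSubspace G.coordEquiv G.blocks) (coordIneq G.coordEquiv) univ τ).Nonempty ↔
      (∃ v, .inl v ∉ τ) ∧ ∀ B : Finset E(G), G.IsBundle B → ∃ e ∈ B, .inr e ∉ τ := by
  rw [nonempty_tightFace_coordIneq blocks_disjoint, forall_mem_blocks]
  simp [-Subtype.exists]

/-- R consists of v and the edges kept by a minimal removal; outside it are the other n - 1 nodes
and the r removed edges. -/
lemma exists_isTransversal_blocks (v : V(G)) :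
    ∃ R, IsTransversal G.blocks R ∧ Rᶜ.ncard + 1 = V(G).ncard + G.redundantEdges := by
  obtain ⟨D, hDE, hcard, hloop, hD⟩ := G.exists_removal
  refine ⟨{i | Sum.elim (· = v) (fun e => (e : β) ∉ D) i}, ⟨?_, ?_⟩, ?_⟩
  · rw [forall_mem_blocks]
    refine ⟨⟨.inl v, by simp, rfl, ?_⟩, fun B hB => ?_⟩
    · rintro (w | e) hw hwR
      · exact congrArg Sum.inl hwR
      · simp at hw
    · obtain ⟨e, he, heD, huniq⟩ := hD B hB
      refine ⟨.inr e, by simpa using he, heD, ?_⟩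
      rintro (w | f) hf hfR
      · simp at hf
      · exact congrArg Sum.inr (huniq f (by simpa using hf) hfR)
  · rintro (w | e) hR
    · exact ⟨_, .inl rfl, by simp⟩
    · rcases exists_isLoopAt_or_isBundle e with ⟨x, hx⟩ | ⟨B, hB, he⟩
      · exact absurd (hloop e x hx) hR
      · exact ⟨_, .inr ⟨B, hB, rfl⟩, by simpa using he⟩
  · have h1 : {i : V(G) ⊕ E(G) | Sum.elim (· = v) (fun e => (e : β) ∉ D) i}ᶜ =
        Sum.inl '' ({v} : Set V(G))ᶜ ∪ Sum.inr '' {e : E(G) | (e : β) ∈ D} := by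
      ext (w | e)
      · simp only [mem_union, mem_image, Sum.inl.injEq, exists_eq_right, reduceCtorEq, and_false,
          exists_false, or_false]
        exact Iff.rfl
      · simp only [mem_union, mem_image, Sum.inr.injEq, exists_eq_right, reduceCtorEq, and_false,
          exists_false, false_or]
        exact not_not
    have h2 : {e : E(G) | (e : β) ∈ D}.ncard = D.ncard := by
      rw [← Subtype.val_injective.injOn.ncard_image]
      congr 1
      ext e
      exact ⟨fun ⟨e', he', h⟩ => h ▸ he', fun he => ⟨⟨e, hDE he⟩, he, rfl⟩⟩
    have h3 := Set.ncard_add_ncard_compl ({v} : Set V(G))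
    rw [Set.ncard_singleton, Nat.card_coe_set_eq] at h3
    rw [h1, Set.ncard_union_eq, Sum.inl_injective.injOn.ncard_image,
      Sum.inr_injective.injOn.ncard_image, h2, hcard, ← h3]
    · ring
    · rw [Set.disjoint_left]
      rintro _ ⟨w, -, rfl⟩ ⟨e, -, h⟩
      cases h

lemma IsFullTube.mem_tubeFace_iff (ht : G.IsFullTube t) {p : (V(G) → ℝ) × (E(G) → ℝ)}
    (hp : p ∈ G.basePolyhedron) : p ∈ G.tubeFace t ↔ ∀ v ∈ G.nodeSet t, p.1 v = 0 := by
  simp only [tubeFace, ht.labelEdges_eq, mem_ofPred_eq, hp, true_and, mem_univ, not_true_eq_false,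
    false_imp_iff, implies_true, and_true]
  exact ⟨fun h v hv => h ht.vertexSet_ne v hv, fun h _ v hv => h v hv⟩

lemma IsFullTube.mem_tubeFace_iff_tight (ht : G.IsFullTube t) {p : (V(G) → ℝ) × (E(G) → ℝ)}
    (hp : p ∈ solutions (blockSubspace G.coordEquiv G.blocks) (coordIneq G.coordEquiv) univ) :
    p ∈ G.tubeFace t ↔ ∀ i ∈ Sum.inl '' G.nodeSet t,
      (coordIneq G.coordEquiv i).1 p = (coordIneq G.coordEquiv i).2 := by
  rw [solutions_blocks] at hp
  rw [ht.mem_tubeFace_iff hp, forall_mem_image]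
  simp only [coordIneq_fst_apply, coordIneq_snd, coordEquiv_inl, neg_eq_zero]

lemma IsFullTube.nonempty_tightFace (ht : G.IsFullTube t) :
    (tightFace (blockSubspace G.coordEquiv G.blocks) (coordIneq G.coordEquiv) univ
      (Sum.inl '' G.nodeSet t)).Nonempty := by
  rw [nonempty_tightFace_blocks]
  obtain ⟨v, hv⟩ := ht.exists_notMem_nodeSet
  refine ⟨⟨v, by simpa using hv⟩, fun B hB => ?_⟩
  obtain ⟨e, he⟩ := hB.1
  exact ⟨e, he, by simp⟩

lemma IsFullTube.dim_tubeFace (ht : G.IsFullTube t) : dim (G.tubeFace t) + V(t).ncard =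
    Module.finrank ℝ (blockSubspace G.coordEquiv G.blocks).direction := by
  have : G.tubeFace t = tightFace (blockSubspace G.coordEquiv G.blocks) (coordIneq G.coordEquiv)
      univ (Sum.inl '' G.nodeSet t) := by
    ext p
    constructor
    · intro hp
      have hpS : p ∈
          solutions (blockSubspace G.coordEquiv G.blocks) (coordIneq G.coordEquiv) univ :=
        solutions_blocks (G := G) ▸ hp.1
      exact ⟨hpS, (ht.mem_tubeFace_iff_tight hpS).1 hp⟩
    · exact fun hp => (ht.mem_tubeFace_iff_tight hp.1).2 hp.2
  rw [this, ← isSimpleSystem_blocks.dim_tightFace (subset_univ _) ht.nonempty_tightFace,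
    Sum.inl_injective.injOn.ncard_image, ncard_nodeSet ht.1]

/-- Increasing dimension of the faces means decreasing number of nodes. -/
lemma pairwise_ncard_of_pairwise_dim {L : List (Graph α β)} (hL : ∀ t ∈ L, G.IsFullTube t)
    (hsort : L.Pairwise fun s t => dim (G.tubeFace s) ≤ dim (G.tubeFace t)) :
    L.Pairwise fun s t => V(t).ncard ≤ V(s).ncard := by
  refine hsort.imp_of_mem fun {s t} hs ht h => ?_
  have h1 := (hL s hs).dim_tubeFace
  have h2 := (hL t ht).dim_tubeFace
  omega

end Base

/-! ### The first round of truncations. -/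

section FullTubes

variable {α β : Type*} {G : Graph α β} {L : List (Graph α β)}

lemma connectedOn_singleton {v : α} : G.ConnectedOn {v} := by
  refine ⟨singleton_nonempty v, fun S hS hne _ => ?_⟩
  rw [hne.subset_singleton_iff.1 hS]

lemma isFullTube_induce_singleton {v w : V(G)} (h : w ≠ v) : G.IsFullTube (G.induce {(v : α)}) := by
  refine connectedOn_singleton.isFullTube (singleton_subset_iff.2 v.2) fun hV => h ?_
  exact Subtype.ext (hV.ge w.2)

variable [Fintype V(G)] [Fintype E(G)]

lemma canTruncate_tubeFace (hL : L.Nodup) (hmem : ∀ t, t ∈ L ↔ G.IsFullTube t)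
    (hsort : L.Pairwise fun s t => V(t).ncard ≤ V(s).ncard) :
    CanTruncate G.basePolyhedron G.tubeFace L := by
  have hfull : ∀ t ∈ L, G.IsFullTube t := fun t ht => (hmem t).1 ht
  rw [← solutions_blocks]
  refine isSimpleSystem_blocks.canTruncate (σ := fun t => Sum.inl '' G.nodeSet t)
    (fun _ _ => subset_univ _) (fun t ht x hx => (hfull t ht).mem_tubeFace_iff_tight hx) hL
    (fun t ht => ?_) (fun t ht => (hfull t ht).nonempty_tightFace) ?_
  · obtain ⟨x, hx⟩ := (hfull t ht).1.vertexSet_nonempty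
    exact ⟨.inl ⟨x, (hfull t ht).1.vertexSet_subset hx⟩, ⟨x, _⟩, hx, rfl⟩
  · refine (pairwise_not_nodeSet_subset hL hfull hsort).imp fun {s t} h hsub => h ?_
    exact (image_subset_image_iff Sum.inl_injective).1 hsub

/-- The simple system after the truncation of the faces of the full tubes. -/
theorem isSimpleSystem_of_isTruncationSequence (hG : G.IsConnected) (hL : L.Nodup)
    (hmem : ∀ t, t ∈ L ↔ G.IsFullTube t)
    (hsort : L.Pairwise fun s t => V(t).ncard ≤ V(s).ncard)
    {h : Graph α β → StrongDual ℝ ((V(G) → ℝ) × (E(G) → ℝ)) × ℝ}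
    (hseq : IsTruncationSequence G.basePolyhedron G.tubeFace h L) :
    IsSimpleSystem (blockSubspace G.coordEquiv G.blocks) (Sum.elim (coordIneq G.coordEquiv) h)
      (cutIndices univ L) ∧
    (∀ p ∈ cut G.basePolyhedron h L, ∀ v, p.1 v ≠ 0) ∧
    ∀ (D : Set E(G)) (N : Set (Graph α β)), (∀ t ∈ N, t ∈ L) →
      ((tightFace (blockSubspace G.coordEquiv G.blocks) (Sum.elim (coordIneq G.coordEquiv) h)
        (cutIndices univ L) (Sum.inl '' (Sum.inr '' D) ∪ Sum.inr '' N)).Nonempty ↔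
        N.Pairwise G.TubesCompatible ∧
          ∀ B : Finset E(G), G.IsBundle B → ∃ e ∈ B, e ∉ D) := by
  have hfull : ∀ t ∈ L, G.IsFullTube t := fun t ht => (hmem t).1 ht
  rw [← solutions_blocks] at hseq ⊢
  obtain ⟨hs, hN⟩ := isSimpleSystem_blocks.truncationSequence
    (σ := fun t => Sum.inl '' G.nodeSet t)
    (fun _ _ => subset_univ _) (fun t ht x hx => (hfull t ht).mem_tubeFace_iff_tight hx) hL hseq
  refine ⟨hs, fun p hp v hpv => ?_, fun D N hNL => ?_⟩
  · have hne := (hN {.inl v} (subset_univ _) ∅ (by simp)).1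
      ⟨p, mem_tightFace_cutIndices.2 ⟨hp, by simpa using hpv, by simp⟩⟩
    obtain ⟨⟨w, hw⟩, -⟩ := nonempty_tightFace_blocks.1 hne.1
    have hwv : w ≠ v := by simpa using hw
    obtain ⟨i, ⟨u, hu, rfl⟩, hi, -⟩ := hne.2 _ ((hmem _).2 (isFullTube_induce_singleton hwv))
    have hu : (u : α) ∈ ({(v : α)} : Set α) := hu
    exact hi (congrArg Sum.inl (Subtype.ext hu))
  · rw [hN _ (subset_univ _) N hNL, nonempty_tightFace_blocks,
      pairwise_tubesCompatible_iff_of_isFullTube hG (Set.toFinite _) hL hmem hsort hNL]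
    have h1 : (∃ v : V(G), (Sum.inl v : V(G) ⊕ E(G)) ∉ Sum.inr '' D ∪
        {i | ∃ t ∈ N, i ∈ Sum.inl '' G.nodeSet t}) ↔ ∃ v ∈ V(G), ∀ t ∈ N, v ∉ V(t) := by
      constructor
      · rintro ⟨v, hv⟩
        exact ⟨v, v.2, fun t ht hvt => hv (.inr ⟨t, ht, v, hvt, rfl⟩)⟩
      · rintro ⟨v, hvG, hv⟩
        refine ⟨⟨v, hvG⟩, ?_⟩
        rintro (⟨e, -, he⟩ | ⟨t, ht, w, hw, hwv⟩)
        · cases he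
        · obtain rfl := Sum.inl_injective hwv
          exact hv t ht hw
    have h2 : (∀ B : Finset E(G), G.IsBundle B → ∃ e ∈ B, (Sum.inr e : V(G) ⊕ E(G)) ∉
        Sum.inr '' D ∪ {i | ∃ t ∈ N, i ∈ Sum.inl '' G.nodeSet t}) ↔
        ∀ B : Finset E(G), G.IsBundle B → ∃ e ∈ B, e ∉ D := by
      simp [-Subtype.exists]
    have h3 : (∀ t ∈ L, ∃ i ∈ (Sum.inl '' G.nodeSet t : Set (V(G) ⊕ E(G))), i ∉ Sum.inr '' D ∧
        ∀ u ∈ N, [t, u].Sublist L → i ∉ (Sum.inl '' G.nodeSet u : Set (V(G) ⊕ E(G)))) ↔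
        ∀ t ∈ L, ∃ v ∈ V(t), ∀ u ∈ N, [t, u].Sublist L → v ∉ V(u) := by
      refine forall₂_congr fun t ht => ⟨?_, ?_⟩
      · rintro ⟨_, ⟨v, hv, rfl⟩, -, hvN⟩
        exact ⟨v, hv, fun u hu htu hvu => hvN u hu htu ⟨v, hvu, rfl⟩⟩
      · rintro ⟨v, hv, hvN⟩
        refine ⟨_, ⟨⟨v, (hfull t ht).1.vertexSet_subset hv⟩, hv, rfl⟩, by simp, ?_⟩
        rintro u hu htu ⟨w, hw, hwv⟩
        obtain rfl := Sum.inl_injective hwv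
        exact hvN u hu htu hw
    rw [h1, h2, h3]
    tauto

end FullTubes

/-! ### Full tubes of G and tubes of the underlying simple graph. -/

section UnderlyingSimple

variable {α β : Type*} {G s t : Graph α β}

lemma underlyingSimple_adj {u v : V(G)} : G.underlyingSimple.Adj u v ↔ u ≠ v ∧ G.Adj u v := by
  simp [underlyingSimple]

lemma underlyingSimple_isConnected (hG : G.IsConnected) : G.underlyingSimple.IsConnected :=
  (toSimpleGraphOfSimpleGraphIso G.toSimpleGraph).connected_iff.2 hG

lemma vertexSet_underlyingSimple : V(G.underlyingSimple) = univ := rfl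

instance : G.underlyingSimple.Simple := by
  refine @Simple.mk _ _ _ ⟨fun e x h => ?_⟩ fun e f x y he hf => he.1.trans hf.1.symm
  exact (underlyingSimple_adj.1 ⟨e, h⟩).1 rfl

lemma redundantEdges_eq_zero [G.Simple] : G.redundantEdges = 0 :=
  Nat.sInf_eq_zero.2 (.inl ⟨∅, empty_subset _, ncard_empty _, by rwa [deleteEdges_empty]⟩)

/-- Adjacent nodes are joined by only one edge, which a tube containing them must contain. -/
lemma IsTube.isFullTube_of_simple [hs : G.Simple] (ht : G.IsTube t) : G.IsFullTube t := by
  refine ⟨ht, ht.lt.le, fun e x y hxy hx hy => ?_⟩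
  obtain ⟨f, hf⟩ := ht.adj x hx y hy hxy.ne ⟨e, hxy⟩
  rwa [hs.eq_of_isLink hxy (hf.mono ht.lt.le)]

lemma connectedOn_underlyingSimple {Y : Set α} (hY : Y ⊆ V(G)) :
    G.underlyingSimple.ConnectedOn {v | (v : α) ∈ Y} ↔ G.ConnectedOn Y := by
  constructor
  · rintro ⟨⟨v, hv⟩, h⟩
    refine ⟨⟨v, hv⟩, fun S hS ⟨x, hx⟩ hcl y hy => ?_⟩
    exact @h {v | (v : α) ∈ S} (fun v hv => hS hv) ⟨⟨x, hY (hS hx)⟩, hx⟩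
      (fun u hu w hw huw => hcl u hu w hw (underlyingSimple_adj.1 huw).2) ⟨y, hY hy⟩ hy
  · rintro ⟨⟨x, hx⟩, h⟩
    refine ⟨⟨⟨x, hY hx⟩, hx⟩, fun S hS ⟨v, hv⟩ hcl w hw => ?_⟩
    have := @h (Subtype.val '' S) (by rintro _ ⟨u, hu, rfl⟩; exact hS hu) ⟨v, v, hv, rfl⟩ (by
      rintro _ ⟨u, hu, rfl⟩ y hy huy
      refine ⟨⟨y, hY hy⟩, ?_, rfl⟩
      by_cases hne : u = ⟨y, hY hy⟩
      · exact hne ▸ hu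
      · exact hcl u hu _ hy (underlyingSimple_adj.2 ⟨hne, huy⟩)) w hw
    obtain ⟨u, hu, huw⟩ := this
    exact Subtype.ext huw ▸ hu

/-- The tube of the underlying simple graph on the nodes of `t`. -/
def simpleTube (G t : Graph α β) : Graph V(G) (Sym2 V(G)) := G.underlyingSimple.induce (G.nodeSet t)

lemma IsFullTube.simpleTube (ht : G.IsFullTube t) :
    G.underlyingSimple.IsFullTube (G.simpleTube t) := by
  refine ((connectedOn_underlyingSimple ht.1.vertexSet_subset).2 ht.1.connectedOn).isFullTube
    (subset_univ _) fun h => ?_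
  obtain ⟨v, hv⟩ := ht.exists_notMem_nodeSet
  have h : G.nodeSet t = univ := h
  exact hv (h ▸ mem_univ v)

/-- Connectedness of a node set ignores loops and parallel edges, so both kinds of tubes have the
same node sets. -/
lemma simpleTube_image : G.simpleTube '' {t | G.IsFullTube t} =
    {t | G.underlyingSimple.IsTube t} := by
  ext u
  constructor
  · rintro ⟨t, ht, rfl⟩
    exact (IsFullTube.simpleTube ht).1
  · intro hu
    have huf := IsTube.isFullTube_of_simple hu
    have hsub : Subtype.val '' V(u) ⊆ V(G) := by
      rintro _ ⟨v, -, rfl⟩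
      exact v.2
    have hpre : {v : V(G) | (v : α) ∈ Subtype.val '' V(u)} = V(u) := by
      ext v
      simp
    have hconn : G.ConnectedOn (Subtype.val '' V(u)) := by
      rw [← connectedOn_underlyingSimple hsub, hpre]
      exact huf.1.connectedOn
    refine ⟨G.induce (Subtype.val '' V(u)), hconn.isFullTube hsub fun h => huf.vertexSet_ne ?_, ?_⟩
    · rw [vertexSet_underlyingSimple, ← hpre]
      exact eq_univ_of_forall fun v => h.ge v.2
    · rw [huf.eq_induce]
      exact congrArg _ hpre

lemma simpleTube_injOn : InjOn G.simpleTube {t | G.IsFullTube t} := fun s hs t ht h => by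
  have h : G.nodeSet s = G.nodeSet t := congrArg vertexSet h
  exact IsFullTube.ext hs ht (((nodeSet_subset_iff hs.1).1 h.subset).antisymm
    ((nodeSet_subset_iff ht.1).1 h.symm.subset))

lemma simpleTube_le_iff (hs : G.IsFullTube s) (ht : G.IsFullTube t) :
    G.simpleTube s ≤ G.simpleTube t ↔ s ≤ t := by
  rw [IsFullTube.le_iff hs.simpleTube.1 ht.simpleTube, IsFullTube.le_iff hs.1 ht]
  exact nodeSet_subset_iff hs.1

lemma tubesCompatible_simpleTube_iff (hs : G.IsFullTube s) (ht : G.IsFullTube t) :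
    G.underlyingSimple.TubesCompatible (G.simpleTube s) (G.simpleTube t) ↔
      G.TubesCompatible s t := by
  have h3 : (Disjoint V(G.simpleTube s) V(G.simpleTube t) ∧ ∀ x ∈ V(G.simpleTube s),
      ∀ y ∈ V(G.simpleTube t), ¬ G.underlyingSimple.Adj x y) ↔
      Disjoint V(s) V(t) ∧ ∀ x ∈ V(s), ∀ y ∈ V(t), ¬ G.Adj x y := by
    simp only [Set.disjoint_left]
    constructor
    · rintro ⟨h1, h2⟩
      have h1' : ∀ ⦃x⦄, x ∈ V(s) → x ∉ V(t) := fun x hx =>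
        @h1 ⟨x, hs.1.vertexSet_subset hx⟩ hx
      refine ⟨h1', fun x hx y hy hxy => h2 ⟨x, hs.1.vertexSet_subset hx⟩ hx
        ⟨y, ht.1.vertexSet_subset hy⟩ hy (underlyingSimple_adj.2 ⟨fun h => h1' hx ?_, hxy⟩)⟩
      have hxy : x = y := congrArg Subtype.val h
      rwa [hxy]
    · rintro ⟨h1, h2⟩
      exact ⟨fun v hv => h1 hv, fun v hv w hw hvw =>
        h2 v hv w hw (underlyingSimple_adj.1 hvw).2⟩
  rw [TubesCompatible, TubesCompatible, h3, lt_iff_le_not_ge, lt_iff_le_not_ge, lt_iff_le_not_ge,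
    lt_iff_le_not_ge, simpleTube_le_iff hs ht, simpleTube_le_iff ht hs]

end UnderlyingSimple

/-! ### The factor K of the first round. -/

section Simplex

variable {α β : Type*} {G : Graph α β} [Fintype V(G)] {L : List (Graph α β)}

lemma solutions_simplex :
    solutions (blockSubspace (.refl ℝ (V(G) → ℝ)) {Finset.univ}) (coordIneq (.refl ℝ _)) univ =
      stdSimplex ℝ V(G) := by
  ext x
  simp [mem_solutions_coordIneq, stdSimplex, and_comm]

/-- The truncations of the simplex at the faces of the full tubes give a graph associahedron. -/
theorem isPseudographAssociahedron_underlyingSimple (hG : G.IsConnected) (hL : L.Nodup)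
    (hmem : ∀ t, t ∈ L ↔ G.IsFullTube t)
    (hsort : L.Pairwise fun s t => V(t).ncard ≤ V(s).ncard)
    {h : Graph α β → StrongDual ℝ (V(G) → ℝ) × ℝ}
    (hseq : IsTruncationSequence (stdSimplex ℝ V(G))
      (fun t => {x | ∀ v ∈ G.nodeSet t, x v = 0}) h L) :
    G.underlyingSimple.IsPseudographAssociahedron (cut (stdSimplex ℝ V(G)) h L) := by
  have hfull : ∀ t ∈ L, G.IsFullTube t := fun t ht => (hmem t).1 ht
  have hdisj : ∀ B ∈ ({Finset.univ} : Set (Finset V(G))),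
      ∀ B' ∈ ({Finset.univ} : Set (Finset V(G))),
      ∀ i ∈ B, i ∈ B' → B = B' := by
    rintro _ rfl _ rfl _ _ _
    rfl
  have hs₀ := isSimpleSystem_coordIneq (φ := .refl ℝ (V(G) → ℝ)) hdisj
  have hne₀ : ∀ τ : Set V(G), (tightFace (blockSubspace (.refl ℝ (V(G) → ℝ)) {Finset.univ})
      (coordIneq (.refl ℝ _)) univ τ).Nonempty ↔ ∃ v, v ∉ τ := fun τ => by
    rw [nonempty_tightFace_coordIneq hdisj]
    simp [-Subtype.exists]
  have hbdd : Bornology.IsBounded (cut (stdSimplex ℝ V(G)) h L) :=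
    (bounded_stdSimplex V(G)).subset cut_subset
  rw [← solutions_simplex] at hseq hbdd ⊢
  obtain ⟨hs, hN⟩ := hs₀.truncationSequence (σ := G.nodeSet) (fun _ _ => subset_univ _)
    (fun t ht x hx => by simp) hL hseq
  have hpoly := (isPolyhedron_coordIneq (φ := .refl ℝ (V(G) → ℝ))
    (𝓑 := {Finset.univ})).cut (h := h) (L := L)
  rw [cut_solutions] at hbdd hpoly ⊢
  have hL' : {t | t ∈ L} = {t | G.IsFullTube t} := by
    ext t
    exact hmem t
  -- The coordinate inequalities are outside `eff`; `⊥` is a dummy label for them.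
  refine .of_isSimpleSystem (underlyingSimple_isConnected hG) hs (eff := Sum.inr '' {t | t ∈ L})
    subset_union_right (tube := Sum.elim (fun _ => ⊥) G.simpleTube) ?_ ?_ ?_ ?_ hpoly ?_
    (iff_of_true hbdd inferInstance)
  · rintro _ ⟨s, hs, rfl⟩ _ ⟨t, ht, rfl⟩ hst
    rw [simpleTube_injOn ((hmem s).1 hs) ((hmem t).1 ht) hst]
  · rw [← image_comp, Sum.elim_comp_inr, hL', simpleTube_image]
  · rintro x hx (v | t) hi hix
    · exfalso
      rw [← cut_solutions] at hx
      have hne := (hN {v} (subset_univ _) ∅ (by simp)).1 ⟨x, mem_tightFace_cutIndices.2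
        ⟨hx, by simpa using hix, by simp⟩⟩
      obtain ⟨w, hw⟩ := (hne₀ _).1 hne.1
      have hwv : w ≠ v := by simpa using hw
      obtain ⟨u, hu, huv, -⟩ := hne.2 _ ((hmem _).2 (isFullTube_induce_singleton hwv))
      exact huv (Subtype.ext hu)
    · exact (hi.resolve_left (by simp))
  · intro N hNL
    obtain ⟨N, hN', rfl⟩ := subset_image_iff.1 hNL
    have hN'' : ∀ t ∈ N, t ∈ L := fun t ht => hN' ht
    rw [← image_comp, Sum.elim_comp_inr, (simpleTube_injOn.mono fun t ht =>
      (hmem t).1 (hN' ht)).pairwise_image]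
    have h1 : N.Pairwise (Function.onFun G.underlyingSimple.TubesCompatible G.simpleTube) ↔
        N.Pairwise G.TubesCompatible := by
      refine forall₂_congr fun s hs => forall₂_congr fun t ht => ?_
      exact imp_congr_right fun _ =>
        tubesCompatible_simpleTube_iff (hfull s (hN'' s hs)) (hfull t (hN'' t ht))
    have h2 := hN ∅ (subset_univ _) N hN''
    rw [image_empty, empty_union] at h2
    rw [h1, h2, pairwise_tubesCompatible_iff_of_isFullTube hG (Set.toFinite _) hL hmem hsort hN'',
      hne₀]
    refine and_congr ⟨?_, ?_⟩ (forall₂_congr fun t ht => ⟨?_, ?_⟩)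
    · rintro ⟨v, hv⟩
      exact ⟨v, v.2, fun t ht hvt => hv (.inr ⟨t, ht, hvt⟩)⟩
    · rintro ⟨v, hvG, hv⟩
      refine ⟨⟨v, hvG⟩, ?_⟩
      rintro (he | ⟨t, ht, hvt⟩)
      exacts [he, hv t ht hvt]
    · rintro ⟨v, hv, -, hvN⟩
      exact ⟨v, hv, fun u hu htu hvu => hvN u hu htu hvu⟩
    · rintro ⟨v, hv, hvN⟩
      exact ⟨⟨v, (hfull t ht).1.vertexSet_subset hv⟩, hv, notMem_empty _, hvN⟩
  · obtain ⟨⟨v, hv⟩, -⟩ := isConnected_iff.1 hG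
    have hR : IsTransversal ({Finset.univ} : Set (Finset V(G))) {(⟨v, hv⟩ : V(G))} := by
      refine ⟨?_, fun i _ => ⟨_, rfl, Finset.mem_univ i⟩⟩
      rintro _ rfl
      exact ⟨⟨v, hv⟩, Finset.mem_univ _, rfl, fun j _ hj => hj⟩
    have h3 := Set.ncard_add_ncard_compl ({(⟨v, hv⟩ : V(G))} : Set V(G))
    rw [Set.ncard_singleton] at h3
    rw [finrank_direction_blockSubspace hdisj hR, redundantEdges_eq_zero,
      vertexSet_underlyingSimple, Set.ncard_univ, add_zero, add_comm, h3]

end Simplex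

/-! ### The second round of truncations. -/

section NonFullTubes

variable {α β : Type*} {G s t : Graph α β} {L : List (Graph α β)}

/-- The indices of the inequalities that are tight on the face of a non-full tube. -/
def tightIndices (G t : Graph α β) : Set ((V(G) ⊕ E(G)) ⊕ Graph α β) :=
  Sum.inl '' (Sum.inr '' (G.labelEdges t)ᶜ) ∪
    Sum.inr '' {u | V(t) ≠ V(G) ∧ G.induce V(t) = u}

@[simp] lemma inr_mem_tightIndices {u : Graph α β} :
    Sum.inr u ∈ G.tightIndices t ↔ V(t) ≠ V(G) ∧ G.induce V(t) = u := by
  simp [tightIndices]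

@[simp] lemma inl_inr_mem_tightIndices {e : E(G)} :
    Sum.inl (Sum.inr e) ∈ G.tightIndices t ↔ e ∉ G.labelEdges t := by
  simp [tightIndices, -Subtype.exists]

@[simp] lemma inl_inl_notMem_tightIndices {v : V(G)} :
    Sum.inl (Sum.inl v) ∉ G.tightIndices t := by
  simp [tightIndices]

lemma IsTube.exists_notMem_labelEdges [Finite E(G)] (ht : G.IsTube t) (hnf : ¬ G.IsFullTube t) :
    ∃ e, e ∉ G.labelEdges t := by
  have : ¬ t ≤i G := fun h => hnf ⟨ht, h⟩
  obtain ⟨e, x, y, hxy, hx, hy, he⟩ := ht.lt.le.not_isInducedSubgraph_iff.1 this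
  exact ⟨⟨e, hxy.edge_mem⟩, ht.notMem_labelEdges_iff.2
    ⟨he, (mem_edgeSet_induce_iff hxy).2 ⟨hx, hy⟩⟩⟩

/-- A proper node set can be read off from the facet of the induced tube. An edge of t that s lacked
would be tight on the face of s, but not on that of t. -/
lemma IsTube.le_of_tightIndices_subset [Finite E(G)] (hs : G.IsTube s) (ht : G.IsTube t)
    (h : G.tightIndices s ⊆ G.tightIndices t) : t ≤ s := by
  have hV : V(t) ⊆ V(s) := by
    by_cases hsV : V(s) = V(G)
    · exact hsV ▸ ht.vertexSet_subset
    · have := inr_mem_tightIndices.1 (h (inr_mem_tightIndices.2 ⟨hsV, rfl⟩))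
      exact (congrArg vertexSet this.2).subset
  refine ht.le_of_edgeSet_subset hs hV fun e he => ?_
  by_contra hes
  have heG := ht.lt.le.edgeSet_mono he
  have h1 : (⟨e, heG⟩ : E(G)) ∉ G.labelEdges s := hs.notMem_labelEdges_iff.2
    ⟨hes, edgeSet_induce_mono hV (edgeSet_subset_induce ht.lt.le he)⟩
  exact (ht.notMem_labelEdges_iff.1 (inl_inr_mem_tightIndices.1
    (h (inl_inr_mem_tightIndices.2 h1)))).1 he

lemma pairwise_not_tightIndices_subset [Finite E(G)] (hV : V(G).Finite) (hL : L.Nodup)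
    (htube : ∀ t ∈ L, G.IsTube t)
    (hsort : L.Pairwise fun s t => s.numElements ≤ t.numElements) :
    L.Pairwise fun s t => ¬ G.tightIndices s ⊆ G.tightIndices t := by
  refine (hL.and hsort).imp_of_mem fun {s t} hs ht h hsub => h.2.not_gt ?_
  have hle := (htube s hs).le_of_tightIndices_subset (htube t ht) hsub
  exact numElements_lt_of_lt (hV.subset (htube s hs).vertexSet_subset)
    ((Set.toFinite E(G)).subset (htube s hs).lt.le.edgeSet_mono) (hle.lt_of_ne h.1.symm)

/-- Deleting a loop or an edge of a bundle with further edges leaves a tube. -/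
lemma isTube_deleteEdges_singleton [Finite E(G)] (hG : G.IsConnected) {e : E(G)}
    (he : ∀ B : Finset E(G), G.IsBundle B → ∃ f ∈ B, f ≠ e) :
    G.IsTube (G.deleteEdges {(e : β)}) ∧ ¬ G.IsFullTube (G.deleteEdges {(e : β)}) ∧
      ∀ f, f ∉ G.labelEdges (G.deleteEdges {(e : β)}) → f = e := by
  have hadj : ∀ x ∈ V(G.deleteEdges {(e : β)}), ∀ y ∈ V(G.deleteEdges {(e : β)}), x ≠ y →
      G.Adj x y → (G.deleteEdges {(e : β)}).Adj x y := by
    rintro x - y - hne ⟨f, hf⟩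
    obtain ⟨B, hB, hBm⟩ := exists_isBundle hf hne
    obtain ⟨g, hgB, hge⟩ := he B hB
    exact ⟨g, by simpa [Subtype.coe_inj] using ⟨(hBm g).1 hgB, hge⟩⟩
  have htube : G.IsTube (G.deleteEdges {(e : β)}) := by
    refine ⟨deleteEdges_le.lt_of_ne fun h => ?_, ?_, hadj⟩
    · have : (e : β) ∈ E(G.deleteEdges {(e : β)}) := h.symm ▸ e.2
      simp at this
    · exact (isConnected_iff_connectedOn deleteEdges_le hadj).2 (isConnected_iff.1 hG)
  refine ⟨htube, fun h => h.vertexSet_ne rfl, fun f hf => ?_⟩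
  have := (htube.notMem_labelEdges_iff.1 hf).1
  simp only [edgeSet_deleteEdges, mem_sdiff, Subtype.coe_prop, mem_singleton_iff, true_and,
    not_not] at this
  exact Subtype.ext this

variable [Fintype V(G)]

/-- This recession direction survives the truncations and makes the result unbounded. -/
lemma basePolyhedron_add_smul_mem {e : E(G)} {x : α} (he : G.IsLoopAt e x) [DecidableEq E(G)] :
    ∀ p ∈ G.basePolyhedron, ∀ c : ℝ, 0 ≤ c →
      p + c • ((0 : V(G) → ℝ), (Pi.single e 1 : E(G) → ℝ)) ∈ G.basePolyhedron := by
  rintro p ⟨h1, h2, h3⟩ c hc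
  refine ⟨by simpa using h1, fun B hB => ?_, fun f y hf => ?_⟩
  · convert h2 B hB using 2 with f
    have hne : (f : E(G)) ≠ e := fun h => hB.not_isLoopAt f.2 x (h ▸ he)
    simp [hne]
  · have h4 := h3 f y hf
    have h5 : 0 ≤ (Pi.single e 1 : E(G) → ℝ) f := by
      by_cases h : f = e
      · subst h
        simp
      · simp [h]
    simp only [Prod.snd_add, Prod.smul_snd, Pi.add_apply, Pi.smul_apply, smul_eq_mul]
    exact add_nonneg h4 (mul_nonneg hc h5)

variable [Fintype E(G)]

lemma mem_imageFace_iff_tight {h : Graph α β → StrongDual ℝ ((V(G) → ℝ) × (E(G) → ℝ)) × ℝ}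
    {Q : Set ((V(G) → ℝ) × (E(G) → ℝ))} {p : (V(G) → ℝ) × (E(G) → ℝ)} (hp : p ∈ Q) :
    p ∈ G.imageFace h Q t ↔ ∀ i ∈ G.tightIndices t,
      (Sum.elim (coordIneq G.coordEquiv) h i).1 p =
        (Sum.elim (coordIneq G.coordEquiv) h i).2 := by
  simp only [imageFace, mem_ofPred_eq, hp, true_and]
  constructor
  · rintro ⟨h1, h2⟩ ((v | e) | u) hi
    · exact absurd hi inl_inl_notMem_tightIndices
    · exact neg_eq_zero.2 (h2 e (inl_inr_mem_tightIndices.1 hi))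
    · obtain ⟨hV, rfl⟩ := inr_mem_tightIndices.1 hi
      exact h1 hV
  · intro h1
    exact ⟨fun hV => h1 _ (inr_mem_tightIndices.2 ⟨hV, rfl⟩),
      fun e he => neg_eq_zero.1 (h1 _ (inl_inr_mem_tightIndices.2 he))⟩

lemma isBounded_basePolyhedron [G.Loopless] : Bornology.IsBounded G.basePolyhedron := by
  have hle : ∀ y ∈ G.bundlesAndRays, y ∈ Icc (0 : E(G) → ℝ) 1 := by
    intro y hy
    have : ∀ e, y e ∈ Icc (0 : ℝ) 1 := fun e => by
      rcases exists_isLoopAt_or_isBundle e with ⟨x, hx⟩ | ⟨B, hB, he⟩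
      · exact absurd hx (G.not_isLoopAt e x)
      · exact mem_Icc_of_mem_stdSimplex (hy.1 B hB) ⟨e, he⟩
    exact ⟨fun e => (this e).1, fun e => (this e).2⟩
  exact (bounded_stdSimplex V(G)).prod (isCompact_Icc.isBounded.subset hle)

end NonFullTubes

/-- The truncations at the faces of the non-full tubes give a pseudograph associahedron. -/
theorem isPseudographAssociahedron_of_isTruncationSequence {α β : Type*} {G : Graph α β}
    [Fintype V(G)] [Fintype E(G)]
    (hG : G.IsConnected) {L₁ : List (Graph α β)} (hL₁ : L₁.Nodup)
    (hL₁_mem : ∀ t, t ∈ L₁ ↔ G.IsFullTube t)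
    (hL₁_sorted : L₁.Pairwise fun s t => V(t).ncard ≤ V(s).ncard)
    {L₂ : List (Graph α β)} (hL₂ : L₂.Nodup)
    (hL₂_mem : ∀ t, t ∈ L₂ ↔ G.IsTube t ∧ ¬ G.IsFullTube t)
    (hL₂_sorted : L₂.Pairwise fun s t => s.numElements ≤ t.numElements)
    {h : Graph α β → StrongDual ℝ ((V(G) → ℝ) × (E(G) → ℝ)) × ℝ}
    (hseq : IsTruncationSequence G.basePolyhedron G.tubeFace h L₁) :
    CanTruncate (cut G.basePolyhedron h L₁) (G.imageFace h (cut G.basePolyhedron h L₁)) L₂ ∧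
      ∀ k, IsTruncationSequence (cut G.basePolyhedron h L₁)
          (G.imageFace h (cut G.basePolyhedron h L₁)) k L₂ →
        G.IsPseudographAssociahedron (cut (cut G.basePolyhedron h L₁) k L₂) := by
  classical
  obtain ⟨hs, hnode, hnerve⟩ :=
    isSimpleSystem_of_isTruncationSequence hG hL₁ hL₁_mem hL₁_sorted hseq
  have htube : ∀ t ∈ L₂, G.IsTube t := fun t ht => ((hL₂_mem t).1 ht).1
  have hV : V(G).Finite := Set.toFinite _
  set A := blockSubspace G.coordEquiv G.blocks with hA
  set a := Sum.elim (coordIneq G.coordEquiv) h with ha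
  have hsol : cut G.basePolyhedron h L₁ = solutions A a (cutIndices univ L₁) := by
    rw [← solutions_blocks, cut_solutions]
  have hσ : ∀ t ∈ L₂, G.tightIndices t ⊆ cutIndices univ L₁ := by
    rintro t ht (i | u) hi
    · exact .inl ⟨i, mem_univ i, rfl⟩
    · obtain ⟨hVt, rfl⟩ := inr_mem_tightIndices.1 hi
      exact .inr ⟨_, (hL₁_mem _).2 ((htube t ht).isFullTube_induce hVt), rfl⟩
  have hface : ∀ t ∈ L₂, ∀ x ∈ solutions A a (cutIndices univ L₁),
      x ∈ G.imageFace h (cut G.basePolyhedron h L₁) t ↔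
        ∀ i ∈ G.tightIndices t, (a i).1 x = (a i).2 :=
    fun t _ x hx => mem_imageFace_iff_tight (hsol ▸ hx)
  -- the faces before the second round, indexed by full tubes `N` and non-full tubes `M`
  have hunion : ∀ N M : Set (Graph α β),
      (Sum.inr '' N ∪ {i | ∃ t ∈ M, i ∈ G.tightIndices t} : Set ((V(G) ⊕ E(G)) ⊕ Graph α β)) =
      Sum.inl '' (Sum.inr '' {e | ∃ t ∈ M, e ∉ G.labelEdges t}) ∪
        Sum.inr '' (N ∪ {u | ∃ t ∈ M, V(t) ≠ V(G) ∧ G.induce V(t) = u}) := by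
    intro N M
    ext ((v | e) | u) <;> simp [-Subtype.exists]
  have hNM : ∀ N M : Set (Graph α β), (∀ t ∈ N, t ∈ L₁) → (∀ t ∈ M, t ∈ L₂) →
      ((tightFace A a (cutIndices univ L₁)
        (Sum.inr '' N ∪ {i | ∃ t ∈ M, i ∈ G.tightIndices t})).Nonempty ↔
      (N ∪ {u | ∃ t ∈ M, V(t) ≠ V(G) ∧ G.induce V(t) = u}).Pairwise G.TubesCompatible ∧
        ∀ B : Finset E(G), G.IsBundle B → ∃ e ∈ B, ∀ t ∈ M, e ∈ G.labelEdges t) := by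
    intro N M hN hM
    rw [hunion, hnerve]
    · simp [-Subtype.exists]
    · rintro _ (ht | ⟨t, ht, hVt, rfl⟩)
      · exact hN _ ht
      · exact (hL₁_mem _).2 ((htube t (hM t ht)).isFullTube_induce hVt)
  have hcompat := fun N M (hN : ∀ t ∈ N, t ∈ L₁) (hM : ∀ t ∈ M, t ∈ L₂) =>
    pairwise_tubesCompatible_union_iff hV hL₂ hL₂_mem hL₂_sorted
      (fun t ht => (hL₁_mem t).1 (hN t ht)) hM
  constructor
  · rw [hsol]
    rw [hsol] at hface
    refine hs.canTruncate hσ hface hL₂ (fun t ht => ?_) (fun t ht => ?_)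
      (pairwise_not_tightIndices_subset hV hL₂ htube hL₂_sorted)
    · obtain ⟨e, he⟩ := (htube t ht).exists_notMem_labelEdges ((hL₂_mem t).1 ht).2
      exact ⟨_, inl_inr_mem_tightIndices.2 he⟩
    -- A single tube is a pairwise compatible family, so its face is nonempty.
    · have h1 := (hNM ∅ {t} (by simp) (by simpa using ht)).2
        ((hcompat ∅ {t} (by simp) (by simpa using ht)).1 (by simp)).1
      simpa using h1
  · intro k hk
    have hbase : (cut (cut G.basePolyhedron h L₁) k L₂) ⊆ G.basePolyhedron :=
      cut_subset.trans cut_subset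
    have hray : ∀ (e : E(G)) (x : α), G.IsLoopAt e x →
        ∀ p ∈ cut (cut G.basePolyhedron h L₁) k L₂, ∀ c : ℝ, 0 ≤ c →
        p + c • ((0 : V(G) → ℝ), (Pi.single e 1 : E(G) → ℝ)) ∈
          cut (cut G.basePolyhedron h L₁) k L₂ := fun e x he =>
      hk.add_smul_mem (hseq.add_smul_mem (basePolyhedron_add_smul_mem he))
    have hpoly : IsPolyhedron (cut (cut G.basePolyhedron h L₁) k L₂) := by
      have := isPolyhedron_coordIneq (φ := G.coordEquiv) (𝓑 := G.blocks)
      rw [solutions_blocks] at this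
      exact this.cut.cut
    rw [hsol] at hface hk hbase hpoly hray ⊢
    obtain ⟨hs₂, hnerve₂⟩ := hs.truncationSequence hσ hface hL₂ hk
    -- the sets of tubes with a common point
    have hfinal : ∀ N M : Set (Graph α β), (∀ t ∈ N, t ∈ L₁) → (∀ t ∈ M, t ∈ L₂) →
        ((tightFace A (Sum.elim a k) (cutIndices (cutIndices univ L₁) L₂)
          (Sum.inl '' (Sum.inr '' N) ∪ Sum.inr '' M)).Nonempty ↔
          (N ∪ M).Pairwise G.TubesCompatible) := by
      intro N M hN hM
      have hNsub : (Sum.inr '' N : Set ((V(G) ⊕ E(G)) ⊕ Graph α β)) ⊆ cutIndices univ L₁ :=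
        (image_mono fun t ht => hN t ht).trans subset_union_right
      rw [hnerve₂ _ hNsub M hM, hNM N M hN hM, hcompat N M hN hM]
      -- What keeps the face of t from absorbing the given one is either the facet of its induced
      -- tube or an edge that t lacks: these are the two alternatives of the combinatorial
      -- criterion.
      refine and_congr_right fun _ => forall₂_congr fun t _ => ⟨?_, ?_⟩
      · rintro ⟨(v | e) | u, hi, hiN, hiM⟩
        · exact absurd hi inl_inl_notMem_tightIndices
        · refine .inr ⟨e, inl_inr_mem_tightIndices.1 hi, fun u hu htu => ?_⟩
          exact not_not.1 fun h => hiM u hu htu (inl_inr_mem_tightIndices.2 h)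
        · obtain ⟨hVt, rfl⟩ := inr_mem_tightIndices.1 hi
          exact .inl ⟨hVt, fun h => hiN ⟨_, h, rfl⟩, fun u hu htu h =>
            hiM u hu htu (inr_mem_tightIndices.2 h)⟩
      · rintro (⟨hVt, htN, htM⟩ | ⟨e, he, heM⟩)
        · refine ⟨.inr (G.induce V(t)), inr_mem_tightIndices.2 ⟨hVt, rfl⟩, by simpa using htN,
            fun u hu htu h => htM u hu htu (inr_mem_tightIndices.1 h)⟩
        · exact ⟨.inl (.inr e), inl_inr_mem_tightIndices.2 he, by simp, fun u hu htu h =>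
            inl_inr_mem_tightIndices.1 h (heM u hu htu)⟩
    have hne : (cut (solutions A a (cutIndices univ L₁)) k L₂).Nonempty := by
      obtain ⟨x, hx⟩ := (hfinal ∅ ∅ (by simp) (by simp)).2 (by simp)
      exact ⟨x, (mem_tightFace_cutIndices.1 hx).1⟩
    have hbdd : Bornology.IsBounded (cut (solutions A a (cutIndices univ L₁)) k L₂) ↔
        G.Loopless := by
      constructor
      · intro hb
        refine ⟨fun e x he => ?_⟩
        obtain ⟨p, hp⟩ := hne
        obtain ⟨C, hC⟩ := hb.exists_norm_le
        obtain ⟨m, hm⟩ := exists_nat_gt C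
        have heG := he.edge_mem
        have h1 := hC _ (hray ⟨e, heG⟩ x he p hp m m.cast_nonneg)
        -- The coordinate at e is nonnegative at p, so a move by m > C along the ray exceeds the
        -- bound.
        have h2 := (hbase hp).2.2 ⟨e, heG⟩ x he
        have h3 := (norm_le_pi_norm _ (⟨e, heG⟩ : E(G))).trans ((norm_snd_le _).trans h1)
        simp only [Prod.snd_add, Prod.smul_snd, Pi.add_apply, Pi.smul_apply, Pi.single_eq_same,
          smul_eq_mul, mul_one, Real.norm_eq_abs] at h3
        have h4 := (le_abs_self _).trans h3
        linarith
      · intro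
        exact isBounded_basePolyhedron.subset hbase
    rw [cut_solutions] at hbdd hpoly hbase ⊢
    -- The effective inequalities are the cuts of the two rounds; `⊥` is a dummy label for the
    -- coordinate inequalities.
    refine .of_isSimpleSystem hG hs₂
      (eff := Sum.inl '' (Sum.inr '' {t | t ∈ L₁}) ∪ Sum.inr '' {t | t ∈ L₂})
      (union_subset_union (image_mono subset_union_right) Subset.rfl)
      (tube := Sum.elim (Sum.elim (fun _ => ⊥) id) id) ?_ ?_ ?_ ?_ hpoly ?_ hbdd
    · have hdisj : ∀ t ∈ L₁, t ∉ L₂ := fun t h1 h2 => ((hL₂_mem t).1 h2).2 ((hL₁_mem t).1 h1)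
      rintro _ (⟨_, ⟨s, hs, rfl⟩, rfl⟩ | ⟨s, hs, rfl⟩) _ (⟨_, ⟨t, ht, rfl⟩, rfl⟩ | ⟨t, ht, rfl⟩) hst
      · obtain rfl : s = t := hst
        rfl
      · obtain rfl : s = t := hst
        exact absurd ht (hdisj s hs)
      · obtain rfl : s = t := hst
        exact absurd hs (hdisj s ht)
      · obtain rfl : s = t := hst
        rfl
    · rw [image_union, ← image_comp, ← image_comp, ← image_comp]
      ext t
      simp only [Sum.elim_comp_inl, Sum.elim_comp_inr, image_id, mem_union, mem_ofPred_eq, hL₁_mem,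
        hL₂_mem]
      exact ⟨fun h => h.elim (fun h => h.1) fun h => h.1, fun h =>
        (em _).imp id fun h' => ⟨h, h'⟩⟩
    · rw [← cut_solutions]
      rintro p hp (((v | e) | t) | t) hi hip
      · exfalso
        refine hnode p ?_ v (neg_eq_zero.1 hip)
        rw [hsol]
        exact hp.1
      -- The facet where coordinate e vanishes is the face of the tube G - e and has been cut off,
      -- unless e is alone in its bundle and the facet was empty.
      · exfalso
        have h1 := (hnerve₂ {.inl (.inr e)} (by simp [cutIndices]) ∅ (by simp)).1
          ⟨p, mem_tightFace_cutIndices.2 ⟨hp, by simpa using hip, by simp⟩⟩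
        have h2 := (hnerve {e} ∅ (by simp)).1 (by simpa using h1.1)
        obtain ⟨h3, h4, h5⟩ := isTube_deleteEdges_singleton hG (e := e) (by simpa using h2.2)
        obtain ⟨i, hi, hie, -⟩ := h1.2 _ ((hL₂_mem _).2 ⟨h3, h4⟩)
        refine hie ?_
        rcases i with (v | f) | u
        · exact absurd hi inl_inl_notMem_tightIndices
        · rw [h5 f (inl_inr_mem_tightIndices.1 hi)]
          rfl
        · exact absurd rfl (inr_mem_tightIndices.1 hi).1
      · refine .inl ⟨_, ⟨t, ?_, rfl⟩, rfl⟩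
        simpa [cutIndices] using hi
      · exact .inr ⟨t, by simpa [cutIndices] using hi, rfl⟩
    · intro N hN
      have h1 : N = Sum.inl '' (Sum.inr '' {t | Sum.inl (Sum.inr t) ∈ N}) ∪
          Sum.inr '' {t | Sum.inr t ∈ N} := by
        ext ((i | t) | t)
        · refine iff_of_false (fun h => ?_) (by simp)
          have := hN h
          simp at this
        · simp
        · simp
      have h2 : Sum.elim (Sum.elim (fun _ => ⊥) id) id '' N =
          {t | Sum.inl (Sum.inr t) ∈ N} ∪ {t | Sum.inr t ∈ N} := by
        conv_lhs => rw [h1]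
        rw [image_union, ← image_comp, ← image_comp, ← image_comp]
        simp only [Sum.elim_comp_inl, Sum.elim_comp_inr, image_id]
      rw [h2, ← hfinal _ _ (fun t ht => by simpa using hN ht) (fun t ht => by simpa using hN ht),
        ← h1]
    · obtain ⟨⟨v, hv⟩, -⟩ := isConnected_iff.1 hG
      obtain ⟨R, hR, hcard⟩ := exists_isTransversal_blocks (⟨v, hv⟩ : V(G))
      rw [hA, finrank_direction_blockSubspace blocks_disjoint hR, hcard]

end Graph

/-! ### Both rounds together. -/

theorem theorem6 {α β : Type*} (G : Graph α β) [Fintype V(G)] [Fintype E(G)]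
    (hG : G.IsConnected)
    -- the full tubes, in increasing order of the dimension of the faces they label
    (L₁ : List (Graph α β)) (hL₁ : L₁.Nodup) (hL₁_mem : ∀ t, t ∈ L₁ ↔ G.IsFullTube t)
    (hL₁_sorted : L₁.Pairwise fun s t =>
      Polyhedral.dim (G.tubeFace s) ≤ Polyhedral.dim (G.tubeFace t))
    -- the remaining tubes, in increasing order of the number of elements
    (L₂ : List (Graph α β)) (hL₂ : L₂.Nodup)
    (hL₂_mem : ∀ t, t ∈ L₂ ↔ G.IsTube t ∧ ¬ G.IsFullTube t)
    (hL₂_sorted : L₂.Pairwise fun s t => s.numElements ≤ t.numElements) :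
    -- the first round of truncations
    Polyhedral.CanTruncate G.basePolyhedron G.tubeFace L₁ ∧
    ∀ h, Polyhedral.IsTruncationSequence G.basePolyhedron G.tubeFace h L₁ →
      (∃ K : Set (V(G) → ℝ), G.underlyingSimple.IsPseudographAssociahedron K ∧
        Polyhedral.cut G.basePolyhedron h L₁ = K ×ˢ G.bundlesAndRays) ∧
      -- the second round of truncations
      Polyhedral.CanTruncate (Polyhedral.cut G.basePolyhedron h L₁)
        (G.imageFace h (Polyhedral.cut G.basePolyhedron h L₁)) L₂ ∧
      ∀ k, Polyhedral.IsTruncationSequence (Polyhedral.cut G.basePolyhedron h L₁)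
          (G.imageFace h (Polyhedral.cut G.basePolyhedron h L₁)) k L₂ →
        G.IsPseudographAssociahedron
          (Polyhedral.cut (Polyhedral.cut G.basePolyhedron h L₁) k L₂) := by
  have hfull : ∀ t ∈ L₁, G.IsFullTube t := fun t ht => (hL₁_mem t).1 ht
  have hsort := Graph.pairwise_ncard_of_pairwise_dim hfull hL₁_sorted
  refine ⟨Graph.canTruncate_tubeFace hL₁ hL₁_mem hsort, fun h hseq => ⟨?_,
    Graph.isPseudographAssociahedron_of_isTruncationSequence hG hL₁ hL₁_mem hsort
      hL₂ hL₂_mem hL₂_sorted hseq⟩⟩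
  obtain ⟨⟨v, hv⟩, -⟩ := Graph.isConnected_iff.1 hG
  -- The vertex given by R has as second component a vertex of `G.bundlesAndRays`, at which the
  -- product can be sliced.
  obtain ⟨R, hR, -⟩ := Graph.exists_isTransversal_blocks (⟨v, hv⟩ : V(G))
  have hext := hR.indicatorPoint_mem_extremePoints (φ := G.coordEquiv)
  rw [Graph.solutions_blocks, Graph.basePolyhedron, extremePoints_prod] at hext
  obtain ⟨hcut, hseq'⟩ := Polyhedral.IsTruncationSequence.slice
    (S := stdSimplex ℝ V(G)) (B := G.bundlesAndRays) (face := G.tubeFace) (h := h)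
    (face' := fun t => {x : V(G) → ℝ | ∀ v ∈ G.nodeSet t, x v = 0}) hext.2
    (fun t ht x hx y hy => (hfull t ht).mem_tubeFace_iff ⟨hx, hy⟩) hseq
  exact ⟨_, Graph.isPseudographAssociahedron_underlyingSimple hG hL₁ hL₁_mem hsort hseq', hcut⟩
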